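/- Let $N=\mathbb H^3/\Gamma$ be a complete orientable hyperbolic 3-manifold (for instance the complement $M\setminus K$ of a hyperbolic knot in a closed orientable 3-manifold, with its complete hyperbolic metric $h$): $\mathbb H^3=\{(x,y,z): z>0\}$ with metric $(dx^2+dy^2+dz^2)/z^2$, and $\Gamma\subset \mathrm{PSL}(2,\mathbb C)$ is discrete and acts freely. Let $T\subset N$ be a horo-torus, i.e. the boundary of an embedded closed cusp neighbourhood. With the cusp placed at $\infty$, this means: $T$ is the image of $\{z=a\}$ for some $a>0$ such that every $g\in\Gamma$ either lies in a rank-two lattice of horizontal translations contained in $\Gamma$, or satisfies $g\{z\ge a\}\cap\{z\ge a\}=\varnothing$. A geodesic cord of $T$ is a geodesic $c:[0,1]\to N$ with $c(0),c(1)\in T$ and $\dot c(0),\dot c(1)\perp T$. Let $E(c)=\frac12\int_0^1|\dot c|_h^2\,dt$ on the space $\mathcal P(N,T)$ of smooth paths $c:[0,1]\to N$ with end points on $T$. (1) For every non-constant geodesic cord $c$ of $T$, the second variation $d^2E(c)$ is a well-defined symmetric bilinear form on $T_c\mathcal P(N,T)$, the space of smooth vector fields along $c$ that are tangent to $T$ at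 both end points; that is, every $V\in T_c\mathcal P(N,T)$ is the variational field of a smooth variation $c_s$ of $c$ in $\mathcal P(N,T)$, and $\frac{d^2}{ds^2}\big|_{s=0}E(c_s)=d^2E(c)(V,V)$ for every such variation. Its Morse index (maximal dimension of a subspace on which $d^2E(c)$ is negative definite) and its nullity (dimension of its null space) are both $0$. (2) Let $H_h(q,p)=\frac12|p|_h^2$ on $T^*N$ with $\omega=dq\wedge dp$, and let $\nu^*T\subset T^*N$ be the conormal bundle of $T$. Every non-constant Hamiltonian chord $\gamma:[0,1]\to T^*N$ of $\nu^*T$ (that is, $\dot\gamma=X_{H_h}(\gamma)$ and $\gamma(0),\gamma(1)\in\nu^*T$) is rigid (isolated: $\gamma(0)$ has a neighbourhood in $T^*N$ in which no other Hamiltonian chord of $\nu^*T$ starts) and nondegenerate (the linearized Hamilton equation along $\gamma$ has no nonzero solution $\xi$ with $\xi(0)\in T_{\gamma(0)}\nu^*T$ and $\xi(1)\in T_{\gamma(1)}\nu^*T$). -/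

import Mathlib

open Set Filter Topology
open scoped ContDiff InnerProductSpace

noncomputable section

namespace HoroTorus

/-! ### The upper half-space model of hyperbolic 3-space -/

/-- Coordinate space; the coordinates `0, 1, 2` are `x, y, z`. -/
abbrev E3 : Type := EuclideanSpace ℝ (Fin 3)

/-- Hyperbolic 3-space: the upper half-space `z > 0`, with the metric `(dx² + dy² + dz²) / z²`. -/
abbrev H3 : Type := {q : E3 // 0 < q 2}

/-- The hyperbolic metric at `q`. -/
def hInner (q v w : E3) : ℝ := ⟪v, w⟫_ℝ / (q 2) ^ 2

/-- The bilinear map `(v, w) ↦ (∑ᵢⱼ Γᵏᵢⱼ(q) vⁱ wʲ)ₖ` of the Christoffel symbols of the hyperbolic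
metric: `Γ³₁₁ = Γ³₂₂ = 1/z`, `Γ¹₁₃ = Γ¹₃₁ = Γ²₂₃ = Γ²₃₂ = Γ³₃₃ = -1/z`, all others zero. -/
def christoffel (q v w : E3) : E3 :=
  !₂[-(v 0 * w 2 + v 2 * w 0) / q 2,
     -(v 1 * w 2 + v 2 * w 1) / q 2,
     (v 0 * w 0 + v 1 * w 1 - v 2 * w 2) / q 2]

open scoped MatrixGroups in
lemma poincare_denom_pos (A : SL(2, ℂ)) (q : H3) :
    0 < Complex.normSq (A 1 0 * (⟨q.1 0, q.1 1⟩ : ℂ) + A 1 1)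
      + Complex.normSq (A 1 0) * (q.1 2) ^ 2 := by
  have hq := q.2
  have hdet := A.det_coe
  rw [Matrix.det_fin_two] at hdet
  by_cases hc : A 1 0 = 0
  · have hd : A 1 1 ≠ 0 := by
      intro hd
      rw [hc, hd] at hdet
      simp at hdet
    have := Complex.normSq_pos.mpr hd
    simpa [hc] using this
  · have h1 := Complex.normSq_pos.mpr hc
    have h2 := Complex.normSq_nonneg (A 1 0 * (⟨q.1 0, q.1 1⟩ : ℂ) + A 1 1)
    have h3 : 0 < Complex.normSq (A 1 0) * (q.1 2) ^ 2 := by positivity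
    linarith

open scoped MatrixGroups in
/-- The Poincaré extension of the Möbius transformation `w ↦ (a w + b) / (c w + d)`: writing a point
of the half-space as `(w, z)` with `w = x + i y`, it is mapped to
`(((a w + b) conj(c w + d) + a conj(c) z²) / D, z / D)` where `D = |c w + d|² + |c|² z²`. -/
def poincare (A : SL(2, ℂ)) (q : H3) : H3 :=
  let w : ℂ := ⟨q.1 0, q.1 1⟩
  let D : ℝ := Complex.normSq (A 1 0 * w + A 1 1) + Complex.normSq (A 1 0) * (q.1 2) ^ 2
  let w' : ℂ := ((A 0 0 * w + A 0 1) * (starRingEnd ℂ) (A 1 0 * w + A 1 1)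
      + A 0 0 * (starRingEnd ℂ) (A 1 0) * ((q.1 2 : ℝ) : ℂ) ^ 2) / (D : ℂ)
  ⟨!₂[w'.re, w'.im, q.1 2 / D], by
    simpa using div_pos q.2 (poincare_denom_pos A q)⟩

/-! ### Complete hyperbolic 3-manifolds and horo-tori -/

/-- `Γ` is a discrete torsion-free group of orientation preserving isometries of hyperbolic 3-space,
that is, it acts properly discontinuously and freely, through Poincaré extensions. -/
structure IsHyperbolicGroup (Γ : Subgroup (Equiv.Perm H3)) : Prop where
  moebius : ∀ g ∈ Γ, ∃ A, ∀ q, g q = poincare A q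
  properlyDiscontinuous : ProperlyDiscontinuousSMul Γ H3
  free : ∀ g ∈ Γ, ∀ q, g q = q → g = 1

/-- The hyperbolic manifold `N = ℍ³ / Γ`. -/
abbrev Mfd (Γ : Subgroup (Equiv.Perm H3)) : Type := MulAction.orbitRel.Quotient Γ H3

/-- The universal covering `ℍ³ → N`. -/
def proj (Γ : Subgroup (Equiv.Perm H3)) (q : H3) : Mfd Γ := Quotient.mk _ q

/-- `z = a` covers a horo-torus of `ℍ³ / Γ`: the stabilizer of the horoball `z ≥ a` in `Γ` is a rank
two lattice of horizontal translations, and the other elements of `Γ` move the horoball off itself.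
Equivalently, `{z ≥ a}` projects onto a closed embedded cusp neighbourhood, with boundary a torus
with universal covering `{z = a}`. -/
structure IsHoroTorusLevel (Γ : Subgroup (Equiv.Perm H3)) (a : ℝ) : Prop where
  pos : 0 < a
  cusp : ∃ m l : E3, m 2 = 0 ∧ l 2 = 0 ∧ LinearIndependent ℝ ![m, l] ∧
    (∀ j k : ℤ, ∃ g ∈ Γ, ∀ q : H3, (g q : E3) = q + (j • m + k • l)) ∧
    ∀ g ∈ Γ, (∃ j k : ℤ, ∀ q : H3, (g q : E3) = q + (j • m + k • l)) ∨
      ∀ q : H3, a ≤ q.1 2 → (g q).1 2 < a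

/-- The horo-torus `T`, a subset of `N`. -/
def horoTorus (Γ : Subgroup (Equiv.Perm H3)) (a : ℝ) : Set (Mfd Γ) :=
  proj Γ '' {q | q.1 2 = a}

/-- The full preimage of a subset of `N` in the upper half-space. -/
def preimageSet (Γ : Subgroup (Equiv.Perm H3)) (T : Set (Mfd Γ)) : Set E3 :=
  Subtype.val '' (proj Γ ⁻¹' T)

/-- Tangent space at `x` of a submanifold `S` of a normed space: the span of the velocities at `x`
of the smooth curves in `S` through `x`. -/
def tangentSpaceOf {E : Type*} [NormedAddCommGroup E] [NormedSpace ℝ E] (S : Set E) (x : E) :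
    Submodule ℝ E :=
  Submodule.span ℝ {v | ∃ α : ℝ → E, ContDiffAt ℝ ∞ α 0 ∧ α 0 = x ∧
    (∀ᶠ s in 𝓝 0, α s ∈ S) ∧ deriv α 0 = v}

/-! ### Paths, energy and geodesic cords -/

/-- A map on `[0, 1]` as a map on `ℝ`; only its values on `[0, 1]` are ever used. -/
def ext {E : Type*} (f : unitInterval → E) : ℝ → E := Set.IccExtend zero_le_one f

/-- The velocity of a path in coordinate space, one-sided at the end points. -/
def vel (f : ℝ → E3) (t : ℝ) : E3 := derivWithin f (Icc 0 1) t

/-- The coordinates of a path in `ℍ³`. -/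
def coords (c : unitInterval → H3) : ℝ → E3 := ext fun t => (c t : E3)

/-- `l` is a smooth lift to `ℍ³` of the path `c` in `N`. A path in `N` is smooth if and only if
it has such a lift, and then the lift is unique up to the action of `Γ`. -/
structure IsLift (Γ : Subgroup (Equiv.Perm H3)) (c : unitInterval → Mfd Γ)
    (l : unitInterval → H3) : Prop where
  smooth : ContDiffOn ℝ ∞ (coords l) (Icc 0 1)
  proj_eq : ∀ t, proj Γ (l t) = c t

/-- The energy `(1/2) ∫₀¹ |l'(t)|² dt` of a path in `ℍ³`. -/
def energyH3 (l : unitInterval → H3) : ℝ :=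
  (1 / 2) * ∫ t in (0 : ℝ)..1, hInner (coords l t) (vel (coords l) t) (vel (coords l) t)

open Classical in
/-- The energy of a smooth path in `N`, computed in any lift: `ℍ³ → N` is a local isometry. -/
def energy (Γ : Subgroup (Equiv.Perm H3)) (c : unitInterval → Mfd Γ) : ℝ :=
  if h : ∃ l, IsLift Γ c l then energyH3 h.choose else 0

/-- A geodesic cord: a geodesic `c : [0, 1] → N` with both end points on `T`, and perpendicular to
`T` at both end points. -/
def IsGeodesicCord (Γ : Subgroup (Equiv.Perm H3)) (T : Set (Mfd Γ)) (c : unitInterval → Mfd Γ) :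
    Prop :=
  ∃ l, IsLift Γ c l ∧
    (∀ t ∈ Icc (0 : ℝ) 1, vel (vel (coords l)) t
      + christoffel (coords l t) (vel (coords l) t) (vel (coords l) t) = 0) ∧
    c 0 ∈ T ∧ c 1 ∈ T ∧
    (∀ v ∈ tangentSpaceOf (preimageSet Γ T) (l 0), hInner (l 0) (vel (coords l) 0) v = 0) ∧
    (∀ v ∈ tangentSpaceOf (preimageSet Γ T) (l 1), hInner (l 1) (vel (coords l) 1) v = 0)

/-! ### Second variation, Morse index and nullity -/

/-- The tangent space at `c` of the space of paths in `N` with end points on `T`: smooth vector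
fields along `c`, tangent to `T` at the end points. Vectors are written in the coordinates of `ℍ³`
along a fixed lift `l` of `c`. -/
def pathTangent (Γ : Subgroup (Equiv.Perm H3)) (T : Set (Mfd Γ)) (l : unitInterval → H3) :
    Submodule ℝ (unitInterval → E3) where
  carrier := {V | ContDiffOn ℝ ∞ (ext V) (Icc 0 1) ∧
    V 0 ∈ tangentSpaceOf (preimageSet Γ T) (l 0) ∧ V 1 ∈ tangentSpaceOf (preimageSet Γ T) (l 1)}
  add_mem' := fun ha hb =>
    ⟨ha.1.add hb.1, Submodule.add_mem _ ha.2.1 hb.2.1, Submodule.add_mem _ ha.2.2 hb.2.2⟩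
  zero_mem' := ⟨contDiffOn_const (c := (0 : E3)), Submodule.zero_mem _, Submodule.zero_mem _⟩
  smul_mem' := fun r _ ha =>
    ⟨ha.1.const_smul r, Submodule.smul_mem _ r ha.2.1, Submodule.smul_mem _ r ha.2.2⟩

/-- `C` is a smooth variation, through paths in `N` with end points on `T`, of the path with lift
`l`, and `V` is its variational vector field `∂C/∂s (0, ·)`. -/
def IsVariation (Γ : Subgroup (Equiv.Perm H3)) (T : Set (Mfd Γ)) (l : unitInterval → H3)
    (V : unitInterval → E3) (C : ℝ → unitInterval → Mfd Γ) : Prop :=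
  ∃ ε > 0, ∃ L : ℝ → unitInterval → H3,
    ContDiffOn ℝ ∞ (fun x : ℝ × ℝ => coords (L x.1) x.2) (Ioo (-ε) ε ×ˢ Icc 0 1) ∧
    (∀ s ∈ Ioo (-ε) ε, (∀ t, proj Γ (L s t) = C s t) ∧ C s 0 ∈ T ∧ C s 1 ∈ T) ∧
    L 0 = l ∧ ∀ t, deriv (fun s => (L s t : E3)) 0 = V t

/-- `B` is the second variation `d²E(c)` of the energy on paths in `N` with end points on `T`, at
the path with lift `l`: the symmetric bilinear form such that `B(V, V)` is the second derivative at
`s = 0` of the energy, along any variation with variational vector field `V`. -/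
structure IsSecondVariation (Γ : Subgroup (Equiv.Perm H3)) (T : Set (Mfd Γ))
    (l : unitInterval → H3) (B : LinearMap.BilinForm ℝ (pathTangent Γ T l)) : Prop where
  symm : ∀ V W, B V W = B W V
  exists_variation : ∀ V : pathTangent Γ T l, ∃ C, IsVariation Γ T l V C
  second_deriv : ∀ (V : pathTangent Γ T l) (C : ℝ → unitInterval → Mfd Γ),
    IsVariation Γ T l V C →
    (∀ᶠ s in 𝓝 0, DifferentiableAt ℝ (fun s => energy Γ (C s)) s) ∧
    HasDerivAt (deriv fun s => energy Γ (C s)) (B V V) 0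

/-- The Morse index: the largest dimension of a subspace on which the form is negative definite. -/
def morseIndex {M : Type*} [AddCommGroup M] [Module ℝ M] (B : LinearMap.BilinForm ℝ M) : ℕ∞ :=
  ⨆ W : {W : Submodule ℝ M // ∀ v ∈ W, v ≠ 0 → B v v < 0}, Cardinal.toENat (Module.rank ℝ W.1)

/-- The nullity: the dimension of the null space `{V | B(V, W) = 0 for all W}`. -/
def nullity {M : Type*} [AddCommGroup M] [Module ℝ M] (B : LinearMap.BilinForm ℝ M) : ℕ∞ :=
  Cardinal.toENat (Module.rank ℝ (LinearMap.ker B))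

/-! ### The cotangent bundle, the conormal of `T` and Hamiltonian chords -/

/-- A transformation of `ℍ³` as a map of coordinate space (the identity off the half-space). -/
def permCoords (g : Equiv.Perm H3) (q : E3) : E3 :=
  if h : 0 < q 2 then (g ⟨q, h⟩ : E3) else q

/-- `y` is the image of `x` under the cotangent lift `(q, p) ↦ (g q, ((d_q g)⁻¹)^* p)` of an element
`g` of `Γ`. Covectors are given by their coordinates `(p_x, p_y, p_z)`. -/
def cotangentRel (Γ : Subgroup (Equiv.Perm H3)) (x y : H3 × E3) : Prop :=
  ∃ g ∈ Γ, g x.1 = y.1 ∧ ∀ v : E3, ⟪x.2, v⟫_ℝ = ⟪y.2, fderiv ℝ (permCoords g) x.1 v⟫_ℝ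

/-- The cotangent bundle `T*N = T*ℍ³ / Γ`, with the quotient topology. -/
abbrev Cotangent (Γ : Subgroup (Equiv.Perm H3)) : Type := Quot (cotangentRel Γ)

/-- The covering `T*ℍ³ → T*N`. -/
def cotProj (Γ : Subgroup (Equiv.Perm H3)) (x : H3 × E3) : Cotangent Γ := Quot.mk _ x

/-- The preimage in `T*ℍ³` of the conormal bundle of `T`. -/
def conormalLift (Γ : Subgroup (Equiv.Perm H3)) (T : Set (Mfd Γ)) : Set (E3 × E3) :=
  {x | x.1 ∈ preimageSet Γ T ∧ ∀ v ∈ tangentSpaceOf (preimageSet Γ T) x.1, ⟪x.2, v⟫_ℝ = 0}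

/-- The conormal bundle of `T` in `T*N`. -/
def conormal (Γ : Subgroup (Equiv.Perm H3)) (T : Set (Mfd Γ)) : Set (Cotangent Γ) :=
  cotProj Γ '' {x | ((x.1 : E3), x.2) ∈ conormalLift Γ T}

/-- The kinetic energy `|p|² / 2` in the dual hyperbolic metric, in the coordinates of `T*ℍ³`. -/
def hamiltonian (x : E3 × E3) : ℝ := (1 / 2) * (x.1 2) ^ 2 * ‖x.2‖ ^ 2

/-- The Hamiltonian vector field `(∂H/∂p, -∂H/∂q)`, that is, `ω(X, ·) = dH` with `ω = dq ∧ dp`. -/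
def hamiltonianField (x : E3 × E3) : E3 × E3 :=
  (gradient (fun p => hamiltonian (x.1, p)) x.2, -gradient (fun q => hamiltonian (q, x.2)) x.1)

/-- The coordinates of a path in `T*ℍ³`. -/
def cotCoords (l : unitInterval → H3 × E3) : ℝ → E3 × E3 := ext fun t => ((l t).1.1, (l t).2)

/-- `l` is a lift to `T*ℍ³` of the path `γ` in `T*N`, and a Hamiltonian trajectory. -/
def IsHamiltonianLift (Γ : Subgroup (Equiv.Perm H3)) (γ : unitInterval → Cotangent Γ)
    (l : unitInterval → H3 × E3) : Prop :=
  (∀ t, cotProj Γ (l t) = γ t) ∧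
  ∀ t ∈ Icc (0 : ℝ) 1,
    HasDerivWithinAt (cotCoords l) (hamiltonianField (cotCoords l t)) (Icc 0 1) t

/-- A Hamiltonian chord of the conormal of `T`: a Hamiltonian trajectory `γ : [0, 1] → T*N` with
both end points on the conormal. -/
def IsHamiltonianChord (Γ : Subgroup (Equiv.Perm H3)) (T : Set (Mfd Γ))
    (γ : unitInterval → Cotangent Γ) : Prop :=
  (∃ l, IsHamiltonianLift Γ γ l) ∧ γ 0 ∈ conormal Γ T ∧ γ 1 ∈ conormal Γ T

/-- A chord is nondegenerate if `dφ(T_{γ(0)} L) ∩ T_{γ(1)} L = 0`, where `L` is the conormal and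
`φ` the time-one Hamiltonian flow: the linearized Hamilton equation along `γ` has no nonzero solution
`ξ` that is tangent to `L` at both end points. -/
def ChordNondegenerate (Γ : Subgroup (Equiv.Perm H3)) (T : Set (Mfd Γ))
    (γ : unitInterval → Cotangent Γ) : Prop :=
  ∀ l, IsHamiltonianLift Γ γ l → ∀ ξ : ℝ → E3 × E3,
    (∀ t ∈ Icc (0 : ℝ) 1,
      HasDerivWithinAt ξ (fderiv ℝ hamiltonianField (cotCoords l t) (ξ t)) (Icc 0 1) t) →
    ξ 0 ∈ tangentSpaceOf (conormalLift Γ T) (cotCoords l 0) →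
    ξ 1 ∈ tangentSpaceOf (conormalLift Γ T) (cotCoords l 1) →
    ∀ t ∈ Icc (0 : ℝ) 1, ξ t = 0

/-- A chord is rigid if it is isolated: it has no other chord near it. (A trajectory is determined
by its starting point, so nearness is measured there.) -/
def ChordRigid (Γ : Subgroup (Equiv.Perm H3)) (T : Set (Mfd Γ))
    (γ : unitInterval → Cotangent Γ) : Prop :=
  ∃ U : Set (Cotangent Γ), IsOpen U ∧ γ 0 ∈ U ∧
    ∀ γ' : unitInterval → Cotangent Γ, IsHamiltonianChord Γ T γ' → γ' 0 ∈ U → γ' = γ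

end HoroTorus

end

noncomputable section

namespace HoroTorus

/-! ### Isometries of the half-space in coordinates -/

/-! Everything is computed in the upper half-space. The preimage of the horo-torus is the union of
the `Γ`-translates of the plane `z = a`. None of it lies above `z = a` (`le_of_mem`), and each piece
below that plane is a Euclidean sphere touching `z = 0` at a point `P` (`exists_sphere`). By proper
discontinuity only one piece is seen near a given point (`eventually_mem_iff`).

A deck transformation moves the start of a chord to the plane `z = a`. The initial covector is then
vertical, so the trajectory is a vertical line (`IsTrajectory.eq_vertical`). A non-constant one
cannot go up, so it ends on a sphere. It meets the sphere orthogonally, hence at its top `P + 2r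
e_z` (`IsTrajectory.isVerticalChord`). The sphere thus determines the chord, and a nearby chord ends
on the same sphere; this is rigidity. For nondegeneracy, the linearized flow carries a horizontal
displacement unchanged down the line with zero horizontal momentum, whereas the curvature of the
sphere demands a nonzero one. The vertical part vanishes because `δz / z` is affine in time and zero
at both ends.

Geodesic cords are treated by the same classification after passing to momenta
(`isTrajectory_phaseCurve`). Along a vertical cord of speed `μ` the second variation is `∫ |V' + μ
V_z e_z|² / z² dt` plus a multiple of the squared horizontal part of `V(1)`. The multiple is
positive because the lower sphere bends away from the cord. The form is therefore positive definite
(`indexForm_pos`), so index and nullity vanish.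

To pass to the quotient, the deck transformations must be isometries whose cotangent lifts preserve
the geodesic flow. This is checked for similarities and inversions, which generate the Poincaré
extensions of Möbius maps. -/

/-- The open half-space `z > 0` of coordinate space. -/
def halfSpace : Set E3 := {q | 0 < q 2}

lemma mem_halfSpace {q : E3} : q ∈ halfSpace ↔ 0 < q 2 := Iff.rfl

lemma isOpen_halfSpace : IsOpen halfSpace :=
  isOpen_lt continuous_const (by fun_prop)

lemma halfSpace_mem_nhds {q : E3} (hq : q ∈ halfSpace) : halfSpace ∈ 𝓝 q :=
  isOpen_halfSpace.mem_nhds hq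

/-- The vertical unit vector. -/
def e3 : E3 := EuclideanSpace.single 2 1

@[simp] lemma e3_zero : e3 0 = 0 := by simp [e3]
@[simp] lemma e3_one : e3 1 = 0 := by simp [e3]
@[simp] lemma e3_two : e3 2 = 1 := by simp [e3]

lemma inner_eq_sum (v w : E3) : ⟪v, w⟫_ℝ = v 0 * w 0 + v 1 * w 1 + v 2 * w 2 := by
  simp [PiLp.inner_apply, Fin.sum_univ_three, mul_comm]

lemma norm_sq_eq_sum (v : E3) : ‖v‖ ^ 2 = v 0 ^ 2 + v 1 ^ 2 + v 2 ^ 2 := by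
  rw [EuclideanSpace.real_norm_sq_eq, Fin.sum_univ_three]

lemma ext_coords {v w : E3} (h0 : v 0 = w 0) (h1 : v 1 = w 1) (h2 : v 2 = w 2) : v = w := by
  ext i; fin_cases i <;> assumption

lemma inner_e3 (v : E3) : ⟪v, e3⟫_ℝ = v 2 := by simp [inner_eq_sum]

lemma hasFDerivAt_coord (i : Fin 3) (q : E3) :
    HasFDerivAt (fun q : E3 => q i) (EuclideanSpace.proj i : E3 →L[ℝ] ℝ) q :=
  (EuclideanSpace.proj i : E3 →L[ℝ] ℝ).hasFDerivAt

lemma hamiltonianField_eq (x : E3 × E3) :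
    hamiltonianField x = ((x.1 2) ^ 2 • x.2, -((x.1 2 * ‖x.2‖ ^ 2) • e3)) := by
  have h1 : HasGradientAt (fun p : E3 => hamiltonian (x.1, p)) ((x.1 2) ^ 2 • x.2) x.2 := by
    rw [hasGradientAt_iff_hasFDerivAt]
    have := ((hasStrictFDerivAt_norm_sq x.2).hasFDerivAt).const_mul ((1 / 2) * (x.1 2) ^ 2)
    refine this.congr_fderiv ?_
    ext v
    simp
    ring
  have h2 : HasGradientAt (fun q : E3 => hamiltonian (q, x.2)) ((x.1 2 * ‖x.2‖ ^ 2) • e3) x.1 := by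
    rw [hasGradientAt_iff_hasFDerivAt]
    have := ((((hasFDerivAt_coord 2 x.1).pow 2).const_mul (1 / 2)).mul_const (‖x.2‖ ^ 2))
    refine this.congr_fderiv ?_
    ext v
    simp [real_inner_comm, inner_e3]
    ring
  rw [hamiltonianField, h1.gradient, h2.gradient]

/-- The cotangent lift of a conformal map `φ` of the half-space with conformal factor
`φ(q)_z / q_z`. -/
def cotLift (φ : E3 → E3) (x : E3 × E3) : E3 × E3 :=
  (φ x.1, (x.1 2 / φ x.1 2) ^ 2 • fderiv ℝ φ x.1 x.2)

/-- Smooth isometries of the half-space model, together with the equivariance of the geodesic flow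
under their cotangent lifts. -/
structure IsHypIsometry (φ : E3 → E3) : Prop where
  mapsTo : MapsTo φ halfSpace halfSpace
  contDiffOn : ContDiffOn ℝ ∞ φ halfSpace
  conformal : ∀ q ∈ halfSpace, ∀ v w : E3,
    ⟪fderiv ℝ φ q v, fderiv ℝ φ q w⟫_ℝ = (φ q 2 / q 2) ^ 2 * ⟪v, w⟫_ℝ
  equivariant : ∀ x : E3 × E3, x.1 ∈ halfSpace →
    fderiv ℝ (cotLift φ) x (hamiltonianField x) = hamiltonianField (cotLift φ x)

namespace IsHypIsometry

variable {φ ψ : E3 → E3}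

lemma contDiffAt (h : IsHypIsometry φ) {q : E3} (hq : q ∈ halfSpace) : ContDiffAt ℝ ∞ φ q :=
  h.contDiffOn.contDiffAt (halfSpace_mem_nhds hq)

lemma differentiableAt (h : IsHypIsometry φ) {q : E3} (hq : q ∈ halfSpace) :
    DifferentiableAt ℝ φ q :=
  (h.contDiffAt hq).differentiableAt (by simp)

end IsHypIsometry

lemma contDiffAt_cotLift {φ : E3 → E3} (hm : MapsTo φ halfSpace halfSpace)
    (hφ : ContDiffOn ℝ ∞ φ halfSpace) {x : E3 × E3}
    (hx : x.1 ∈ halfSpace) : ContDiffAt ℝ ∞ (cotLift φ) x := by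
  have h0 : ContDiffAt ℝ ∞ φ x.1 := hφ.contDiffAt (halfSpace_mem_nhds hx)
  have h1 : ContDiffAt ℝ ∞ (fun x : E3 × E3 => φ x.1) x := h0.comp x contDiffAt_fst
  have h2 : ContDiffAt ℝ ∞ (fderiv ℝ φ) x.1 := h0.fderiv_right (by simp)
  have h3 : ContDiffAt ℝ ∞ (fun x : E3 × E3 => fderiv ℝ φ x.1) x := h2.comp x contDiffAt_fst
  have hz : ContDiffAt ℝ ∞ (fun x : E3 × E3 => x.1 2) x :=
    (EuclideanSpace.proj 2 : E3 →L[ℝ] ℝ).contDiff.contDiffAt.comp x contDiffAt_fst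
  have hz' : ContDiffAt ℝ ∞ (fun x : E3 × E3 => φ x.1 2) x :=
    (EuclideanSpace.proj 2 : E3 →L[ℝ] ℝ).contDiff.contDiffAt.comp x h1
  exact h1.prodMk (((hz.div hz' (hm hx).ne').pow 2).smul (h3.clm_apply contDiffAt_snd))

lemma IsHypIsometry.contDiffAt_cotLift {φ : E3 → E3} (h : IsHypIsometry φ) {x : E3 × E3}
    (hx : x.1 ∈ halfSpace) : ContDiffAt ℝ ∞ (cotLift φ) x :=
  HoroTorus.contDiffAt_cotLift h.mapsTo h.contDiffOn hx

lemma fst_mem_nhds {x : E3 × E3} (hx : x.1 ∈ halfSpace) :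
    ∀ᶠ y in 𝓝 x, y.1 ∈ halfSpace :=
  continuous_fst.continuousAt.eventually (halfSpace_mem_nhds hx)

lemma cotLift_congr {φ ψ : E3 → E3} (h : EqOn φ ψ halfSpace) {x : E3 × E3}
    (hx : x.1 ∈ halfSpace) : cotLift φ x = cotLift ψ x := by
  have : φ =ᶠ[𝓝 x.1] ψ := h.eventuallyEq_of_mem (halfSpace_mem_nhds hx)
  rw [cotLift, cotLift, this.fderiv_eq, h hx]

/-- Chain rule; the conformal factors telescope, since the intermediate height cancels. -/
lemma cotLift_comp {φ ψ : E3 → E3} (hm : MapsTo φ halfSpace halfSpace)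
    (hφ : ContDiffOn ℝ ∞ φ halfSpace) (hψ : ContDiffOn ℝ ∞ ψ halfSpace) {x : E3 × E3}
    (hx : x.1 ∈ halfSpace) : cotLift (ψ ∘ φ) x = cotLift ψ (cotLift φ x) := by
  have h1 : DifferentiableAt ℝ φ x.1 :=
    (hφ.contDiffAt (halfSpace_mem_nhds hx)).differentiableAt (by simp)
  have h2 : DifferentiableAt ℝ ψ (φ x.1) :=
    (hψ.contDiffAt (halfSpace_mem_nhds (hm hx))).differentiableAt (by simp)
  have h3 : φ x.1 2 ≠ 0 := (hm hx).ne'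
  simp only [cotLift, Function.comp, Prod.mk.injEq, true_and]
  rw [fderiv_comp _ h2 h1]
  simp only [ContinuousLinearMap.comp_apply, map_smul, smul_smul]
  congr 1
  field_simp

namespace IsHypIsometry

variable {φ ψ : E3 → E3}

lemma congr (h : IsHypIsometry φ) (he : EqOn ψ φ halfSpace) : IsHypIsometry ψ where
  mapsTo := h.mapsTo.congr he.symm
  contDiffOn := h.contDiffOn.congr he
  conformal q hq v w := by
    rw [(he.eventuallyEq_of_mem (halfSpace_mem_nhds hq)).fderiv_eq, he hq]
    exact h.conformal q hq v w
  equivariant x hx := by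
    have : cotLift ψ =ᶠ[𝓝 x] cotLift φ := by
      filter_upwards [fst_mem_nhds hx] with y hy using cotLift_congr he hy
    rw [this.fderiv_eq, this.eq_of_nhds]
    exact h.equivariant x hx

/-- All four properties pass through the chain rule, so only similarities and inversions need direct
computation. -/
lemma comp (hψ : IsHypIsometry ψ) (hφ : IsHypIsometry φ) : IsHypIsometry (ψ ∘ φ) where
  mapsTo := hψ.mapsTo.comp hφ.mapsTo
  contDiffOn := hψ.contDiffOn.comp hφ.contDiffOn hφ.mapsTo
  conformal q hq v w := by
    have h3 : φ q 2 ≠ 0 := (hφ.mapsTo hq).ne'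
    rw [fderiv_comp _ (hψ.differentiableAt (hφ.mapsTo hq)) (hφ.differentiableAt hq)]
    simp only [ContinuousLinearMap.comp_apply, Function.comp]
    rw [hψ.conformal _ (hφ.mapsTo hq), hφ.conformal q hq]
    field_simp
  equivariant x hx := by
    have h1 : cotLift (ψ ∘ φ) =ᶠ[𝓝 x] cotLift ψ ∘ cotLift φ := by
      filter_upwards [fst_mem_nhds hx] with y hy
        using cotLift_comp hφ.mapsTo hφ.contDiffOn hψ.contDiffOn hy
    have hx' : (cotLift φ x).1 ∈ halfSpace := hφ.mapsTo hx
    rw [h1.fderiv_eq, h1.eq_of_nhds, fderiv_comp _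
      ((hψ.contDiffAt_cotLift hx').differentiableAt (by simp))
      ((hφ.contDiffAt_cotLift hx).differentiableAt (by simp))]
    simp only [ContinuousLinearMap.comp_apply, Function.comp]
    rw [hφ.equivariant x hx, hψ.equivariant _ hx']

end IsHypIsometry

/-- Orthogonal maps of coordinate space fixing the vertical direction; `ε = 1` for rotations and
`ε = -1` for reflections. -/
def horizontalRot (α β ε : ℝ) : E3 →L[ℝ] E3 :=
  LinearMap.toContinuousLinearMap
    { toFun := fun v => !₂[α * v 0 - ε * β * v 1, β * v 0 + ε * α * v 1, v 2]
      map_add' := fun v w => by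
        refine ext_coords ?_ ?_ ?_ <;> simp <;> ring
      map_smul' := fun c v => by
        refine ext_coords ?_ ?_ ?_ <;> simp <;> ring }

lemma horizontalRot_apply (α β ε : ℝ) (v : E3) : horizontalRot α β ε v =
    !₂[α * v 0 - ε * β * v 1, β * v 0 + ε * α * v 1, v 2] := rfl

lemma inner_horizontalRot {α β ε : ℝ} (h : α ^ 2 + β ^ 2 = 1) (hε : ε ^ 2 = 1) (v w : E3) :
    ⟪horizontalRot α β ε v, horizontalRot α β ε w⟫_ℝ = ⟪v, w⟫_ℝ := by
  simp only [inner_eq_sum, horizontalRot_apply]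
  simp
  linear_combination (v 0 * w 0 + ε ^ 2 * v 1 * w 1) * h + v 1 * w 1 * hε

/-- A horizontal similarity `q ↦ k R q + b` is a hyperbolic isometry. -/
lemma isHypIsometry_similarity {α β ε k : ℝ} (h : α ^ 2 + β ^ 2 = 1) (hε : ε ^ 2 = 1)
    (hk : 0 < k) {b : E3} (hb : b 2 = 0) :
    IsHypIsometry (fun q => k • horizontalRot α β ε q + b) := by
  set R := horizontalRot α β ε with hR
  have hR2 : ∀ v, R v 2 = v 2 := fun v => by simp [hR, horizontalRot_apply]
  have hfd : ∀ q, HasFDerivAt (fun q => k • R q + b) (k • R) q := fun q =>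
    (R.hasFDerivAt.const_smul k).add_const b
  have hm : MapsTo (fun q => k • R q + b) halfSpace halfSpace := fun q hq => by
    simp only [mem_halfSpace, PiLp.add_apply, PiLp.smul_apply, hR2, hb, smul_eq_mul, add_zero]
    exact mul_pos hk hq
  refine ⟨hm, ((R.contDiff.const_smul k).add contDiff_const).contDiffOn, ?_, ?_⟩
  · intro q hq v w
    have hq' : q 2 ≠ 0 := (mem_halfSpace.1 hq).ne'
    rw [(hfd q).fderiv]
    simp only [_root_.smul_apply, inner_smul_left, inner_smul_right, hR,
      inner_horizontalRot h hε]
    simp [hb, horizontalRot_apply]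
    field_simp
  · intro x hx
    -- The height ratio is `1/k`, so the cotangent lift is affine and its derivative can be read
    -- off.
    have he : ∀ y : E3 × E3, y.1 ∈ halfSpace →
        cotLift (fun q => k • R q + b) y = (k • R y.1 + b, k⁻¹ • R y.2) := by
      intro y hy
      have hy' : y.1 2 ≠ 0 := (mem_halfSpace.1 hy).ne'
      simp only [cotLift, (hfd y.1).fderiv, _root_.smul_apply, smul_smul,
        PiLp.add_apply, PiLp.smul_apply, hR2, hb, smul_eq_mul, add_zero, Prod.mk.injEq, true_and]
      congr 1
      field_simp
    have h1 : cotLift (fun q => k • R q + b) =ᶠ[𝓝 x] fun y => (k • R y.1 + b, k⁻¹ • R y.2) := by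
      filter_upwards [fst_mem_nhds hx] with y hy using he y hy
    have h2 : HasFDerivAt (fun y : E3 × E3 => (k • R y.1 + b, k⁻¹ • R y.2))
        ((k • R.comp (ContinuousLinearMap.fst ℝ E3 E3)).prod
          (k⁻¹ • R.comp (ContinuousLinearMap.snd ℝ E3 E3))) x :=
      (((R.hasFDerivAt.comp x hasFDerivAt_fst).const_smul k).add_const b).prodMk
        ((R.hasFDerivAt.comp x hasFDerivAt_snd).const_smul k⁻¹)
    have h3 : ‖R x.2‖ = ‖x.2‖ := by
      have := inner_horizontalRot h hε x.2 x.2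
      rw [real_inner_self_eq_norm_sq, real_inner_self_eq_norm_sq] at this
      exact (pow_left_inj₀ (norm_nonneg _) (norm_nonneg _) two_ne_zero).1 this
    have h4 : R e3 = e3 := by
      refine ext_coords ?_ ?_ ?_ <;> simp [hR, horizontalRot_apply]
    rw [h1.fderiv_eq, h1.eq_of_nhds, h2.fderiv, hamiltonianField_eq, hamiltonianField_eq]
    simp only [ContinuousLinearMap.prod_apply, _root_.smul_apply,
      ContinuousLinearMap.comp_apply, ContinuousLinearMap.coe_fst', ContinuousLinearMap.coe_snd',
      map_smul, map_neg, h4, smul_smul, norm_smul, h3, hR2, hb, PiLp.add_apply, PiLp.smul_apply,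
      smul_eq_mul, add_zero, smul_neg, Prod.mk.injEq, neg_inj]
    constructor
    · congr 1
      field_simp
    · congr 1
      simp only [norm_inv, Real.norm_eq_abs, abs_of_pos hk]
      field_simp

lemma ne_of_mem_halfSpace {P q : E3} (hP : P 2 = 0) (hq : q ∈ halfSpace) : q ≠ P := by
  rintro rfl
  exact hq.ne' hP

/-- The inversion in a sphere centred on the boundary plane is a hyperbolic isometry. -/
lemma isHypIsometry_inversion {P : E3} (hP : P 2 = 0) :
    IsHypIsometry (EuclideanGeometry.inversion P 1) := by
  set ι := EuclideanGeometry.inversion P 1 with hι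
  have hfd : ∀ q ∈ halfSpace, HasFDerivAt ι ((1 / dist q P) ^ 2 •
      ((ℝ ∙ (q - P))ᗮ.reflection : E3 →L[ℝ] E3)) q := fun q hq =>
    EuclideanGeometry.hasFDerivAt_inversion (ne_of_mem_halfSpace hP hq)
  have hd : ∀ q ∈ halfSpace, 0 < dist q P := fun q hq =>
    dist_pos.2 (ne_of_mem_halfSpace hP hq)
  have hz : ∀ q, ι q 2 = (1 / dist q P) ^ 2 * q 2 := fun q => by
    simp [hι, EuclideanGeometry.inversion, hP]
  have hm : MapsTo ι halfSpace halfSpace := fun q hq => by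
    rw [mem_halfSpace, hz]
    have := hd q hq
    exact mul_pos (by positivity) hq
  have hc : ContDiffOn ℝ ∞ ι halfSpace :=
    contDiffOn_const.inversion contDiffOn_const contDiffOn_id
      (fun q hq => ne_of_mem_halfSpace hP hq)
  refine ⟨hm, hc, ?_, ?_⟩
  · intro q hq v w
    have hq' : q 2 ≠ 0 := (mem_halfSpace.1 hq).ne'
    rw [(hfd q hq).fderiv, hz]
    simp only [_root_.smul_apply, inner_smul_left, inner_smul_right]
    have := ((ℝ ∙ (q - P))ᗮ.reflection).inner_map_map v w
    simp only [ContinuousLinearEquiv.coe_coe, LinearIsometryEquiv.coe_toContinuousLinearEquiv]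
    rw [this]
    simp
    field_simp
  · intro x hx
    -- With `Q = q - P`, the derivative of the inversion is `|Q|⁻²` times the reflection in the
    -- hyperplane orthogonal to `Q`, and the squared height ratio is `|Q|⁴`. The covector part is
    -- therefore polynomial in `Q` and `p`, hence easy to differentiate.
    have he : ∀ y : E3 × E3, y.1 ∈ halfSpace → cotLift ι y =
        (ι y.1, (‖y.1 - P‖ ^ 2) • y.2 - (2 * ⟪y.1 - P, y.2⟫_ℝ) • (y.1 - P)) := by
      intro y hy
      have hy' : y.1 2 ≠ 0 := (mem_halfSpace.1 hy).ne'
      have hd' : ‖y.1 - P‖ ≠ 0 := by rw [← dist_eq_norm]; exact (hd _ hy).ne'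
      simp only [cotLift, (hfd y.1 hy).fderiv, hz, Prod.mk.injEq, true_and, dist_eq_norm,
        _root_.smul_apply, ContinuousLinearEquiv.coe_coe,
        LinearIsometryEquiv.coe_toContinuousLinearEquiv, Submodule.reflection_orthogonal_apply,
        Submodule.reflection_singleton_apply, neg_sub]
      generalize y.1 - P = Q at *
      rw [smul_sub, smul_sub, smul_smul, smul_smul]
      congr 1
      · congr 1
        field_simp
      · rw [← Nat.cast_smul_eq_nsmul ℝ, smul_smul, smul_smul]
        congr 1
        simp
        field_simp
    have h1 : cotLift ι =ᶠ[𝓝 x] fun y =>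
        (ι y.1, (‖y.1 - P‖ ^ 2) • y.2 - (2 * ⟪y.1 - P, y.2⟫_ℝ) • (y.1 - P)) := by
      filter_upwards [fst_mem_nhds hx] with y hy using he y hy
    have hs : HasFDerivAt (fun y : E3 × E3 => y.1 - P) (ContinuousLinearMap.fst ℝ E3 E3) x :=
      hasFDerivAt_fst.sub_const P
    have hp : HasFDerivAt (fun y : E3 × E3 => y.2) (ContinuousLinearMap.snd ℝ E3 E3) x :=
      hasFDerivAt_snd
    have h2 := ((hfd x.1 hx).comp x hasFDerivAt_fst).prodMk
      ((hs.norm_sq.smul hp).sub (((hs.inner ℝ hp).const_mul 2).smul hs))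
    have hcl : cotLift ι x =
        (ι x.1, (‖x.1 - P‖ ^ 2) • x.2 - (2 * ⟪x.1 - P, x.2⟫_ℝ) • (x.1 - P)) := he x hx
    have hcl' : (‖x.1 - P‖ ^ 2) • x.2 - (2 * ⟪x.1 - P, x.2⟫_ℝ) • (x.1 - P) =
        (x.1 2 / ι x.1 2) ^ 2 • fderiv ℝ ι x.1 x.2 := by
      have := congrArg Prod.snd hcl
      exact this.symm
    have hn : ‖(‖x.1 - P‖ ^ 2) • x.2 - (2 * ⟪x.1 - P, x.2⟫_ℝ) • (x.1 - P)‖ ^ 2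
        = ‖x.1 - P‖ ^ 4 * ‖x.2‖ ^ 2 := by
      rw [norm_sub_sq_real, norm_smul, norm_smul, inner_smul_left, inner_smul_right,
        real_inner_comm (x.1 - P) x.2]
      simp only [mul_pow, Real.norm_eq_abs, sq_abs]
      simp
      ring
    have h3 : fderiv ℝ (fun y : E3 × E3 =>
        (ι y.1, (‖y.1 - P‖ ^ 2) • y.2 - (2 * ⟪y.1 - P, y.2⟫_ℝ) • (y.1 - P))) x = _ :=
      HasFDerivAt.fderiv h2
    rw [h1.fderiv_eq, hcl, h3, hamiltonianField_eq, hamiltonianField_eq]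
    simp only [hn]
    refine Prod.ext ?_ ?_
    · rw [hcl', (hfd x.1 hx).fderiv]
      simp only [ContinuousLinearMap.prod_apply, ContinuousLinearMap.comp_apply,
        ContinuousLinearMap.coe_fst', smul_smul]
      rw [map_smul]
      congr 1
      have := (mem_halfSpace.1 (hm hx)).ne'
      field_simp
    -- The centre has height zero, so the height too is a coordinate of `Q`. What remains is a
    -- polynomial identity in the coordinates of `Q` and `p`.
    · have hxp : x.1 2 = (x.1 - P) 2 := by simp [hP]
      simp only [hz, dist_eq_norm]
      rw [hxp]
      generalize x.1 - P = Q at *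
      rw [show (1 / ‖Q‖) ^ 2 * Q 2 * (‖Q‖ ^ 4 * ‖x.2‖ ^ 2) = Q 2 * ‖Q‖ ^ 2 * ‖x.2‖ ^ 2 by
        field_simp]
      refine ext_coords ?_ ?_ ?_ <;>
      · simp [inner_smul_left, inner_smul_right, inner_eq_sum, norm_sq_eq_sum]
        ring

end HoroTorus

namespace HoroTorus

/-! ### Möbius transformations are isometries -/

/-- The horizontal component of a point of coordinate space as a complex number. -/
def horiz (q : E3) : ℂ := ⟨q 0, q 1⟩

/-- The point of the boundary plane with a given horizontal component. -/
def ofHoriz (w : ℂ) : E3 := !₂[w.re, w.im, 0]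

@[simp] lemma ofHoriz_two (w : ℂ) : ofHoriz w 2 = 0 := by simp [ofHoriz]

@[simp] lemma horiz_ofHoriz (w : ℂ) : horiz (ofHoriz w) = w := by
  apply Complex.ext <;> simp [ofHoriz, horiz]

@[simp] lemma horiz_add (p q : E3) : horiz (p + q) = horiz p + horiz q := by
  apply Complex.ext <;> simp [horiz]

@[simp] lemma horiz_sub (p q : E3) : horiz (p - q) = horiz p - horiz q := by
  apply Complex.ext <;> simp [horiz]

@[simp] lemma horiz_smul (k : ℝ) (q : E3) : horiz (k • q) = k * horiz q := by
  apply Complex.ext <;> simp [horiz]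

lemma horiz_rot (μ : ℂ) (q : E3) : horiz (horizontalRot μ.re μ.im 1 q) = μ * horiz q := by
  apply Complex.ext <;> simp [horiz, horizontalRot_apply]
  ring

lemma horiz_rot_conj (μ : ℂ) (q : E3) :
    horiz (horizontalRot μ.re μ.im (-1) q) = μ * (starRingEnd ℂ) (horiz q) := by
  apply Complex.ext <;> simp [horiz, horizontalRot_apply]
  ring

@[simp] lemma horizontalRot_two (α β ε : ℝ) (q : E3) : horizontalRot α β ε q 2 = q 2 := by
  simp [horizontalRot_apply]

lemma ext_horiz {p q : E3} (h : horiz p = horiz q) (hz : p 2 = q 2) : p = q :=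
  ext_coords (congrArg Complex.re h) (congrArg Complex.im h) hz

lemma norm_sq_eq_horiz (q : E3) : ‖q‖ ^ 2 = Complex.normSq (horiz q) + q 2 ^ 2 := by
  rw [norm_sq_eq_sum, Complex.normSq_apply, horiz]
  ring

open scoped MatrixGroups

/-- The conformal factor of the Poincaré extension is `1 / D` with this `D`. -/
def poincareDenom (A : SL(2, ℂ)) (q : E3) : ℝ :=
  Complex.normSq (A 1 0 * horiz q + A 1 1) + Complex.normSq (A 1 0) * (q 2) ^ 2

lemma poincareDenom_pos (A : SL(2, ℂ)) (q : H3) : 0 < poincareDenom A q := poincare_denom_pos A q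

lemma poincare_two (A : SL(2, ℂ)) (q : H3) :
    (poincare A q : E3) 2 = (q : E3) 2 / poincareDenom A q := rfl

lemma horiz_poincare (A : SL(2, ℂ)) (q : H3) :
    horiz (poincare A q) = ((A 0 0 * horiz q + A 0 1) * (starRingEnd ℂ) (A 1 0 * horiz q + A 1 1)
      + A 0 0 * (starRingEnd ℂ) (A 1 0) * (((q : E3) 2 : ℝ) : ℂ) ^ 2) / (poincareDenom A q : ℂ) :=
  rfl

/-- Factor `c w + d = c (w - (-d/c))`. The conformal factor thus depends only on the distance to the
pole `-d/c`. This exhibits the map as an inversion up to similarity, and makes the level sets of the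
image height spheres tangent to the boundary at the pole. -/
lemma poincareDenom_eq {A : SL(2, ℂ)} (hc : A 1 0 ≠ 0) (q : E3) :
    poincareDenom A q = Complex.normSq (A 1 0) * ‖q - ofHoriz (-A 1 1 / A 1 0)‖ ^ 2 := by
  have : A 1 0 * horiz q + A 1 1 = A 1 0 * (horiz q - -A 1 1 / A 1 0) := by
    field_simp
    ring
  rw [poincareDenom, this, map_mul, norm_sq_eq_horiz]
  simp
  ring

lemma det_eq (A : SL(2, ℂ)) : A 0 0 * A 1 1 - A 0 1 * A 1 0 = 1 := by
  have := A.det_coe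
  rwa [Matrix.det_fin_two] at this

/-- Here `d = a⁻¹`, so the boundary map is `w ↦ a² w + a b`: dilation by `|a|²`, rotation by `a² /
|a|²`, then translation by `a b`. -/
lemma isHypIsometry_of_eq_poincare_of_eq_zero {A : SL(2, ℂ)} {φ : E3 → E3}
    (h : ∀ q : H3, φ q = poincare A q) (hc : A 1 0 = 0) : IsHypIsometry φ := by
  have hdet := det_eq A
  rw [hc, mul_zero, sub_zero] at hdet
  have ha : A 0 0 ≠ 0 := left_ne_zero_of_mul_eq_one hdet
  have hd' : A 1 1 = (A 0 0)⁻¹ := eq_inv_of_mul_eq_one_right hdet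
  set k := Complex.normSq (A 0 0) with hk
  have hk0 : 0 < k := Complex.normSq_pos.2 ha
  set μ : ℂ := A 0 0 ^ 2 / k with hμ
  have hμ1 : μ.re ^ 2 + μ.im ^ 2 = 1 := by
    have : Complex.normSq μ = 1 := by
      rw [hμ, map_div₀, map_pow, Complex.normSq_ofReal, ← hk]
      field_simp
    rw [Complex.normSq_apply] at this
    linarith
  refine (isHypIsometry_similarity hμ1 (one_pow 2) hk0 (ofHoriz_two (A 0 0 * A 0 1))).congr ?_
  intro q hq
  have hD : poincareDenom A q = k⁻¹ := by simp [poincareDenom, hc, hd', hk]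
  rw [h ⟨q, hq⟩]
  apply ext_horiz
  · rw [horiz_poincare, hD, horiz_add, horiz_smul, horiz_rot, horiz_ofHoriz, hc, hd', hμ]
    simp only [zero_mul, zero_add, map_zero, mul_zero, add_zero, map_inv₀]
    have hk2 : (k : ℂ) = A 0 0 * (starRingEnd ℂ) (A 0 0) := by rw [Complex.mul_conj]
    have ha' : (starRingEnd ℂ) (A 0 0) ≠ 0 := by simpa using ha
    push_cast
    rw [hk2]
    field_simp
  · rw [poincare_two, hD]
    simp
    ring

/-- On the boundary `w ↦ a/c - 1 / (c² (w - P))` with `P = -d/c`. Since `1/u = conj u / |u|²`, this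
is the unit inversion about `P` followed by an orientation-reversing similarity with factor `k =
|c|⁻²` and rotation `μ = -|c|² / c²`, so that `k μ = -1/c²`. -/
lemma isHypIsometry_of_eq_poincare_of_ne_zero {A : SL(2, ℂ)} {φ : E3 → E3}
    (h : ∀ q : H3, φ q = poincare A q) (hc : A 1 0 ≠ 0) : IsHypIsometry φ := by
  have hdet := det_eq A
  set k := (Complex.normSq (A 1 0))⁻¹ with hk
  have hk0 : 0 < k := inv_pos.2 (Complex.normSq_pos.2 hc)
  set μ : ℂ := -(k⁻¹ / A 1 0 ^ 2) with hμ
  have hμ1 : μ.re ^ 2 + μ.im ^ 2 = 1 := by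
    have : Complex.normSq μ = 1 := by
      have hn : Complex.normSq (A 1 0) ≠ 0 := (Complex.normSq_pos.2 hc).ne'
      rw [hμ, Complex.normSq_neg, map_div₀, map_pow, Complex.normSq_ofReal, hk]
      field_simp
    rw [Complex.normSq_apply] at this
    linarith
  set P := ofHoriz (-A 1 1 / A 1 0) with hP
  have hP2 : P 2 = 0 := ofHoriz_two _
  -- The inversion is centred at `P` and not at the origin, so the translation part must cancel the
  -- image of `P`.
  have hb : (ofHoriz (A 0 0 / A 1 0) - k • horizontalRot μ.re μ.im (-1) P) 2 = 0 := by
    simp [hP2]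
  refine ((isHypIsometry_similarity hμ1 (by norm_num : (-1 : ℝ) ^ 2 = 1) hk0 hb).comp
    (isHypIsometry_inversion hP2)).congr ?_
  intro q hq
  have hD := poincareDenom_eq hc q
  rw [← hP] at hD
  have hD0 : poincareDenom A q ≠ 0 := (poincareDenom_pos A ⟨q, hq⟩).ne'
  rw [h ⟨q, hq⟩]
  apply ext_horiz
  · rw [horiz_poincare]
    simp only [Function.comp, EuclideanGeometry.inversion, vsub_eq_sub, vadd_eq_add, horiz_add,
      horiz_sub, horiz_smul, horiz_rot_conj, horiz_ofHoriz, map_add, map_mul, dist_eq_norm, hP]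
    rw [← hP]
    have hN : ((‖q - P‖ : ℝ) : ℂ) ^ 2 = (poincareDenom A q : ℂ) * k := by
      rw [hD, hk]
      push_cast
      have : ((Complex.normSq (A 1 0) : ℝ) : ℂ) ≠ 0 := by
        exact_mod_cast (Complex.normSq_pos.2 hc).ne'
      field_simp
    have hkc : (k : ℂ) = (A 1 0 * (starRingEnd ℂ) (A 1 0))⁻¹ := by
      rw [Complex.mul_conj, hk]; push_cast; rfl
    have hDC : (poincareDenom A q : ℂ) ≠ 0 := by exact_mod_cast hD0
    have hDexp : (poincareDenom A q : ℂ) =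
        (A 1 0 * horiz q + A 1 1) * (starRingEnd ℂ) (A 1 0 * horiz q + A 1 1)
        + A 1 0 * (starRingEnd ℂ) (A 1 0) * ((q 2 : ℝ) : ℂ) ^ 2 := by
      rw [poincareDenom, Complex.mul_conj, Complex.mul_conj]; push_cast; rfl
    have hc' : (starRingEnd ℂ) (A 1 0) ≠ 0 := by simpa using hc
    -- The relation `ad - bc = 1` rewrites the numerator as `(a D - conj (c w + d)) / c`, which
    -- splits off the constant `a/c`.
    have key : (A 0 0 * horiz q + A 0 1) * (starRingEnd ℂ) (A 1 0 * horiz q + A 1 1)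
        + A 0 0 * (starRingEnd ℂ) (A 1 0) * ((q 2 : ℝ) : ℂ) ^ 2 =
        (A 0 0 * (poincareDenom A q : ℂ) - (starRingEnd ℂ) (A 1 0 * horiz q + A 1 1)) / A 1 0 := by
      rw [hDexp, eq_div_iff hc]
      linear_combination (-(starRingEnd ℂ) (A 1 0 * horiz q + A 1 1)) * hdet
    have hr : ((1 / ‖q - P‖) ^ 2 : ℝ) = ((1 / ((poincareDenom A q : ℂ) * k) : ℂ)) := by
      push_cast
      rw [div_pow, hN, one_pow]
    simp only [map_add, map_mul] at key
    simp only [map_sub, map_div₀, map_neg, Complex.conj_ofReal]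
    rw [key, hr, hμ]
    push_cast
    field_simp
    rw [hkc]
    field_simp
    ring
  · rw [poincare_two, hD]
    simp [EuclideanGeometry.inversion, dist_eq_norm, hP2, hk]
    field_simp

lemma isHypIsometry_of_eq_poincare {A : SL(2, ℂ)} {φ : E3 → E3}
    (h : ∀ q : H3, φ q = poincare A q) : IsHypIsometry φ := by
  by_cases hc : A 1 0 = 0
  · exact isHypIsometry_of_eq_poincare_of_eq_zero h hc
  · exact isHypIsometry_of_eq_poincare_of_ne_zero h hc

/-! ### The action of the group in coordinates -/

lemma permCoords_coe (g : Equiv.Perm H3) (q : H3) : permCoords g q = g q := by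
  simp [permCoords, q.2]

lemma permCoords_mem (g : Equiv.Perm H3) {q : E3} (hq : q ∈ halfSpace) :
    permCoords g q ∈ halfSpace := by
  rw [permCoords_coe g ⟨q, hq⟩]
  exact (g _).2

lemma permCoords_one : permCoords 1 = id := by
  funext q
  by_cases h : 0 < q 2 <;> simp [permCoords, h]

lemma permCoords_mul (g h : Equiv.Perm H3) : permCoords (g * h) = permCoords g ∘ permCoords h := by
  funext q
  by_cases hq : 0 < q 2
  · have h1 := permCoords_coe (g * h) ⟨q, hq⟩
    have h2 := permCoords_coe h ⟨q, hq⟩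
    simp only at h1 h2
    rw [Function.comp, h1, h2, permCoords_coe]
    rfl
  · simp [permCoords, hq]

lemma permCoords_inv_apply (g : Equiv.Perm H3) (q : E3) :
    permCoords g⁻¹ (permCoords g q) = q := by
  have := congrFun (permCoords_mul g⁻¹ g) q
  rwa [inv_mul_cancel, permCoords_one, id, Function.comp, eq_comm] at this

variable {Γ : Subgroup (Equiv.Perm H3)}

lemma IsHyperbolicGroup.isHypIsometry (hΓ : IsHyperbolicGroup Γ) {g : Equiv.Perm H3} (hg : g ∈ Γ) :
    IsHypIsometry (permCoords g) := by
  obtain ⟨A, hA⟩ := hΓ.moebius g hg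
  exact isHypIsometry_of_eq_poincare (A := A) fun q => by rw [permCoords_coe, hA]

lemma IsHyperbolicGroup.continuous (hΓ : IsHyperbolicGroup Γ) {g : Equiv.Perm H3} (hg : g ∈ Γ) :
    Continuous g := by
  rw [continuous_induced_rng]
  have h := (hΓ.isHypIsometry hg).contDiffOn.continuousOn.domRestrict
  refine h.congr fun q => ?_
  exact permCoords_coe g q

lemma IsHyperbolicGroup.fderiv_inv_apply (hΓ : IsHyperbolicGroup Γ) {g : Equiv.Perm H3}
    (hg : g ∈ Γ) {q : E3} (hq : q ∈ halfSpace) (v : E3) :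
    fderiv ℝ (permCoords g⁻¹) (permCoords g q) (fderiv ℝ (permCoords g) q v) = v := by
  have h1 := (hΓ.isHypIsometry hg).differentiableAt hq
  have h2 := (hΓ.isHypIsometry (Γ.inv_mem hg)).differentiableAt (permCoords_mem g hq)
  have h3 := fderiv_comp q h2 h1
  rw [← permCoords_mul, inv_mul_cancel, permCoords_one, fderiv_id] at h3
  have := congrArg (fun L : E3 →L[ℝ] E3 => L v) h3
  simpa using this.symm

lemma IsHyperbolicGroup.fderiv_apply_inv (hΓ : IsHyperbolicGroup Γ) {g : Equiv.Perm H3}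
    (hg : g ∈ Γ) {q : E3} (hq : q ∈ halfSpace) (v : E3) :
    fderiv ℝ (permCoords g) q (fderiv ℝ (permCoords g⁻¹) (permCoords g q) v) = v := by
  have := hΓ.fderiv_inv_apply (Γ.inv_mem hg) (permCoords_mem g hq) v
  rwa [inv_inv, permCoords_inv_apply] at this

end HoroTorus

namespace HoroTorus

/-! ### Tangent spaces -/

section Tangent

variable {E F : Type*} [NormedAddCommGroup E] [NormedSpace ℝ E] [NormedAddCommGroup F]
  [NormedSpace ℝ F]

lemma mem_tangentSpaceOf_of_curve {S : Set E} {x v : E} {α : ℝ → E} (hα : ContDiffAt ℝ ∞ α 0)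
    (h0 : α 0 = x) (hS : ∀ᶠ s in 𝓝 0, α s ∈ S) (hd : HasDerivAt α v 0) :
    v ∈ tangentSpaceOf S x :=
  Submodule.subset_span ⟨α, hα, h0, hS, hd.deriv⟩

/-- The tangent space is spanned by velocities of curves, and `Φ` sends curves in `S` to curves in
`S'`. -/
lemma map_mem_tangentSpaceOf {S : Set E} {S' : Set F} {x v : E} {Φ : E → F}
    (hΦ : ContDiffAt ℝ ∞ Φ x) (hS : ∀ᶠ y in 𝓝 x, y ∈ S → Φ y ∈ S')
    (hv : v ∈ tangentSpaceOf S x) : fderiv ℝ Φ x v ∈ tangentSpaceOf S' (Φ x) := by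
  have : tangentSpaceOf S x ≤ (tangentSpaceOf S' (Φ x)).comap (fderiv ℝ Φ x : E →ₗ[ℝ] F) := by
    refine Submodule.span_le.2 ?_
    rintro _ ⟨α, hα, rfl, hαS, rfl⟩
    have hd : HasDerivAt α (deriv α 0) 0 := (hα.differentiableAt (by simp)).hasDerivAt
    refine mem_tangentSpaceOf_of_curve (α := Φ ∘ α) (hΦ.comp 0 hα) rfl ?_ ?_
    · filter_upwards [hαS, hα.continuousAt.eventually hS] with s h1 h2 using h2 h1
    · exact (hΦ.differentiableAt (by simp)).hasFDerivAt.comp_hasDerivAt 0 hd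
  exact this hv

/-- Tangent vectors are annihilated by the derivatives of functions vanishing on the set. -/
lemma fderiv_eq_zero_of_mem_tangentSpaceOf {S : Set E} {x v : E} {f : E → ℝ} {f' : E →L[ℝ] ℝ}
    (hf : HasFDerivAt f f' x) (hS : ∀ᶠ y in 𝓝 x, y ∈ S → f y = 0)
    (hv : v ∈ tangentSpaceOf S x) : f' v = 0 := by
  have : tangentSpaceOf S x ≤ LinearMap.ker (f' : E →ₗ[ℝ] ℝ) := by
    refine Submodule.span_le.2 ?_
    rintro _ ⟨α, hα, rfl, hαS, rfl⟩
    have hd : HasDerivAt α (deriv α 0) 0 := (hα.differentiableAt (by simp)).hasDerivAt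
    have h1 : HasDerivAt (f ∘ α) (f' (deriv α 0)) 0 := hf.comp_hasDerivAt 0 hd
    have h2 : f ∘ α =ᶠ[𝓝 0] fun _ => (0 : ℝ) := by
      filter_upwards [hαS, hα.continuousAt.eventually hS] with s h1 h2 using h2 h1
    exact (h1.congr_of_eventuallyEq h2.symm).unique (hasDerivAt_const _ _)
  exact this hv

end Tangent

lemma mem_tangentSpaceOf_plane {S : Set E3} {q v : E3}
    (hS : ∀ᶠ y in 𝓝 q, y 2 = q 2 → y ∈ S) (hv : v 2 = 0) : v ∈ tangentSpaceOf S q := by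
  have hc : ContDiff ℝ ∞ (fun s : ℝ => q + s • v) := by fun_prop
  refine mem_tangentSpaceOf_of_curve (α := fun s => q + s • v) hc.contDiffAt (by simp) ?_ ?_
  · have h0 : Tendsto (fun s : ℝ => q + s • v) (𝓝 0) (𝓝 q) := by
      simpa using hc.continuous.tendsto 0
    filter_upwards [h0.eventually hS] with s hs using hs (by simp [hv])
  · simpa using ((hasDerivAt_id (0 : ℝ)).smul_const v).const_add q

/-- It follows that `|y - P|² = 2 r y_z` describes the sphere of radius `r` about `P + r e_z`,
tangent to the boundary plane at `P`. -/
lemma norm_sq_sub_center {P y : E3} {r : ℝ} (hP : P 2 = 0) :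
    ‖y - (P + r • e3)‖ ^ 2 = ‖y - P‖ ^ 2 - 2 * r * y 2 + r ^ 2 := by
  simp [norm_sq_eq_sum, hP]
  ring

lemma mem_tangentSpaceOf_sphere {S : Set E3} {P q v : E3} {r : ℝ} (hr : 0 < r) (hP : P 2 = 0)
    (hq : ‖q - P‖ ^ 2 = 2 * r * q 2) (hS : ∀ᶠ y in 𝓝 q, ‖y - P‖ ^ 2 = 2 * r * y 2 → y ∈ S)
    (hv : ⟪q - (P + r • e3), v⟫_ℝ = 0) : v ∈ tangentSpaceOf S q := by
  set C := P + r • e3 with hC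
  set n := q - C with hn
  have hn2 : ‖n‖ ^ 2 = r ^ 2 := by rw [hn, hC, norm_sq_sub_center hP, hq]; ring
  have hpos : ∀ s : ℝ, 0 < r ^ 2 + s ^ 2 * ‖v‖ ^ 2 := fun s => by positivity
  -- The curve is the line `n + s v` projected radially onto the sphere. Since `v ⊥ n` and `|n| =
  -- r`, its norm is `√(r² + s²|v|²)`, so the scaling factor is `1` to first order and the velocity
  -- at `0` is `v`.
  set f : ℝ → ℝ := fun s => r / √(r ^ 2 + s ^ 2 * ‖v‖ ^ 2) with hf
  have hf0 : f 0 = 1 := by simp [hf, Real.sqrt_sq hr.le, hr.ne']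
  have hfc : ContDiff ℝ ∞ f := by
    refine contDiff_const.div (ContDiff.sqrt (by fun_prop) fun s => (hpos s).ne') fun s => ?_
    exact (Real.sqrt_pos.2 (hpos s)).ne'
  have hfd : HasDerivAt f 0 0 := by
    have h1 : HasDerivAt (fun s : ℝ => r ^ 2 + s ^ 2 * ‖v‖ ^ 2) 0 0 := by
      simpa using (((hasDerivAt_id (0 : ℝ)).pow 2).mul_const (‖v‖ ^ 2)).const_add (r ^ 2)
    have h2 := (hasDerivAt_const (0 : ℝ) r).div (h1.sqrt (hpos 0).ne')
      (Real.sqrt_pos.2 (hpos 0)).ne'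
    refine h2.congr_deriv ?_
    simp
  have hc : ContDiff ℝ ∞ (fun s : ℝ => C + f s • (n + s • v)) := by fun_prop
  refine mem_tangentSpaceOf_of_curve hc.contDiffAt (by simp [hf0, hn]) ?_ ?_
  · have h0 : Tendsto (fun s : ℝ => C + f s • (n + s • v)) (𝓝 0) (𝓝 q) := by
      simpa [hf0, hn] using hc.continuous.tendsto 0
    filter_upwards [h0.eventually hS] with s hs
    apply hs
    have h3 := norm_sq_sub_center (P := P) (y := C + f s • (n + s • v)) (r := r) hP
    rw [← hC, add_sub_cancel_left, norm_smul, mul_pow, norm_add_sq_real, inner_smul_right, hv,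
      norm_smul, mul_pow, hn2, Real.norm_eq_abs, Real.norm_eq_abs, sq_abs, sq_abs, mul_zero,
      mul_zero, add_zero] at h3
    have h4 : f s ^ 2 * (r ^ 2 + s ^ 2 * ‖v‖ ^ 2) = r ^ 2 := by
      simp only [hf, div_pow, Real.sq_sqrt (hpos s).le]
      exact div_mul_cancel₀ _ (hpos s).ne'
    linarith
  · have h5 := ((hasDerivAt_id (0 : ℝ)).smul_const v).const_add n
    have h6 := (hfd.smul h5).const_add C
    simpa [hf0] using h6

/-! ### Geometry of the preimage of a horo-torus -/

variable {Γ : Subgroup (Equiv.Perm H3)}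

lemma proj_eq_proj {p q : H3} : proj Γ p = proj Γ q ↔ ∃ g ∈ Γ, g p = q := by
  rw [eq_comm, proj, proj, Quotient.eq, MulAction.orbitRel_apply, MulAction.mem_orbit_iff]
  constructor
  · rintro ⟨g, hg⟩; exact ⟨g.1, g.2, hg⟩
  · rintro ⟨g, hg, h⟩; exact ⟨⟨g, hg⟩, h⟩

lemma mem_preimageSet_coe {T : Set (Mfd Γ)} {q : H3} :
    (q : E3) ∈ preimageSet Γ T ↔ proj Γ q ∈ T := by
  constructor
  · rintro ⟨p, hp, h⟩
    rwa [Subtype.ext h] at hp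
  · exact fun h => ⟨q, h, rfl⟩

lemma preimageSet_subset {T : Set (Mfd Γ)} : preimageSet Γ T ⊆ halfSpace := by
  rintro _ ⟨q, -, rfl⟩; exact q.2

lemma permCoords_mem_preimageSet {T : Set (Mfd Γ)} {g : Equiv.Perm H3} (hg : g ∈ Γ) {q : E3}
    (hq : q ∈ halfSpace) : permCoords g q ∈ preimageSet Γ T ↔ q ∈ preimageSet Γ T := by
  have h1 : proj Γ (g ⟨q, hq⟩) = proj Γ ⟨q, hq⟩ := (proj_eq_proj.2 ⟨g, hg, rfl⟩).symm
  rw [permCoords_coe g ⟨q, hq⟩, mem_preimageSet_coe, h1, ← mem_preimageSet_coe]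

variable {a : ℝ}

lemma mem_preimageSet_horoTorus {q : E3} (hq : q ∈ halfSpace) :
    q ∈ preimageSet Γ (horoTorus Γ a) ↔ ∃ g ∈ Γ, permCoords g q 2 = a := by
  rw [show q = ((⟨q, hq⟩ : H3) : E3) from rfl, mem_preimageSet_coe]
  constructor
  · rintro ⟨p, hp, h⟩
    obtain ⟨g, hg, hgp⟩ := proj_eq_proj.1 h.symm
    exact ⟨g, hg, by rw [permCoords_coe, hgp]; exact hp⟩
  · rintro ⟨g, hg, h⟩
    exact ⟨g ⟨q, hq⟩, by rw [← h, permCoords_coe]; rfl, (proj_eq_proj.2 ⟨g, hg, rfl⟩).symm⟩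

lemma IsHyperbolicGroup.fderiv_mem_tangentSpaceOf (hΓ : IsHyperbolicGroup Γ) {T : Set (Mfd Γ)}
    {g : Equiv.Perm H3} (hg : g ∈ Γ) {q v : E3} (hq : q ∈ halfSpace)
    (hv : v ∈ tangentSpaceOf (preimageSet Γ T) q) :
    fderiv ℝ (permCoords g) q v ∈ tangentSpaceOf (preimageSet Γ T) (permCoords g q) := by
  refine map_mem_tangentSpaceOf ((hΓ.isHypIsometry hg).contDiffAt hq) ?_ hv
  filter_upwards [halfSpace_mem_nhds hq] with y hy h
  exact (permCoords_mem_preimageSet hg hy).2 h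

namespace IsHoroTorusLevel

lemma horizontal_or_lt (ha : IsHoroTorusLevel Γ a) {g : Equiv.Perm H3} (hg : g ∈ Γ) :
    (∀ q ∈ halfSpace, permCoords g q 2 = q 2) ∨
      ∀ q ∈ halfSpace, a ≤ q 2 → permCoords g q 2 < a := by
  obtain ⟨m, l, hm, hl, -, -, h⟩ := ha.cusp
  rcases h g hg with ⟨j, k, h⟩ | h
  · left
    intro q hq
    rw [permCoords_coe g ⟨q, hq⟩, h]
    simp [hm, hl]
  · right
    intro q hq hqa
    rw [permCoords_coe g ⟨q, hq⟩]
    exact h ⟨q, hq⟩ hqa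

/-- A point above level `a` cannot be moved to level `a`: translations keep its height, and all
other elements push it strictly below `a`. -/
lemma le_of_mem (ha : IsHoroTorusLevel Γ a) {q : E3} (hq : q ∈ preimageSet Γ (horoTorus Γ a)) :
    q 2 ≤ a := by
  have hq' := preimageSet_subset hq
  obtain ⟨g, hg, h⟩ := (mem_preimageSet_horoTorus hq').1 hq
  by_contra! hlt
  rcases ha.horizontal_or_lt hg with h1 | h1
  · linarith [h1 q hq']
  · linarith [h1 q hq' hlt.le]

lemma horizontal_of_eq (ha : IsHoroTorusLevel Γ a) {g : Equiv.Perm H3} (hg : g ∈ Γ) {q : E3}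
    (hq : q ∈ halfSpace) (hqa : q 2 = a) (hgq : permCoords g q 2 = a) :
    ∀ y ∈ halfSpace, permCoords g y 2 = y 2 := by
  rcases ha.horizontal_or_lt hg with h1 | h1
  · exact h1
  · exact absurd hgq (h1 q hq hqa.ge).ne

/-- The horosphere `z = a` is covered by the translates of a compact set under the translations
in `Γ`. -/
lemma exists_compact (ha : IsHoroTorusLevel Γ a) : ∃ K : Set H3, IsCompact K ∧
    ∀ y : H3, (y : E3) 2 = a → ∃ g ∈ Γ, g y ∈ K ∧ ∀ q ∈ halfSpace, permCoords g q 2 = q 2 := by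
  obtain ⟨m, l, hm, hl, hli, hex, -⟩ := ha.cusp
  -- Both generators are horizontal, so their independence is the nonvanishing of a two-by-two
  -- determinant.
  have hdet : m 0 * l 1 - m 1 * l 0 ≠ 0 := by
    intro h0
    rw [LinearIndependent.pair_iff] at hli
    have h1 := hli (l 1) (-m 1) (ext_coords (by simp; linarith) (by simp; ring) (by simp [hm, hl]))
    have h2 := hli (l 0) (-m 0) (ext_coords (by simp; ring) (by simp; linarith) (by simp [hm, hl]))
    have h3 := hli 1 0 (ext_coords (by simp; linarith [h2.2]) (by simp; linarith [h1.2])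
      (by simp [hm]))
    exact one_ne_zero h3.1
  set f : ℝ × ℝ → H3 := fun x => ⟨x.1 • m + x.2 • l + a • e3, by simp [hm, hl, ha.pos]⟩ with hf
  have hfc : Continuous f := by
    rw [continuous_induced_rng]
    simp only [hf, Function.comp_def]
    fun_prop
  refine ⟨f '' (Icc 0 1 ×ˢ Icc 0 1), (isCompact_Icc.prod isCompact_Icc).image hfc, ?_⟩
  intro y hy
  set D := m 0 * l 1 - m 1 * l 0 with hD
  -- Cramer's rule gives the coordinates in the lattice basis. Subtracting the integer parts moves
  -- the point into the fundamental parallelogram.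
  set α := ((y : E3) 0 * l 1 - (y : E3) 1 * l 0) / D with hα
  set β := (m 0 * (y : E3) 1 - m 1 * (y : E3) 0) / D with hβ
  obtain ⟨g, hg, h⟩ := hex (-⌊α⌋) (-⌊β⌋)
  refine ⟨g, hg, ⟨(Int.fract α, Int.fract β),
    ⟨⟨Int.fract_nonneg _, (Int.fract_lt_one _).le⟩, Int.fract_nonneg _, (Int.fract_lt_one _).le⟩,
    ?_⟩, ?_⟩
  · apply Subtype.ext
    rw [h y]
    have e0 : (y : E3) 0 = α * m 0 + β * l 0 := by rw [hα, hβ]; field_simp; rw [hD]; ring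
    have e1 : (y : E3) 1 = α * m 1 + β * l 1 := by rw [hα, hβ]; field_simp; rw [hD]; ring
    simp only [← Int.cast_smul_eq_zsmul ℝ]
    refine ext_coords ?_ ?_ ?_
    · simp [hf, ← Int.self_sub_floor]; linarith
    · simp [hf, ← Int.self_sub_floor]; linarith
    · simp [hf, hm, hl, hy]
  · intro q hq
    rw [permCoords_coe g ⟨q, hq⟩, h]
    simp [hm, hl]

/-- The preimage of the horo-torus is locally a single horosphere. -/
lemma eventually_mem_iff (hΓ : IsHyperbolicGroup Γ) (ha : IsHoroTorusLevel Γ a)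
    {h : Equiv.Perm H3} (hh : h ∈ Γ) {q : E3} (hq : q ∈ halfSpace) (hqa : permCoords h q 2 = a) :
    ∀ᶠ y in 𝓝 q, y ∈ preimageSet Γ (horoTorus Γ a) ↔ permCoords h y 2 = a := by
  obtain ⟨K', hK', hcov⟩ := ha.exists_compact
  have : LocallyCompactSpace H3 := isOpen_halfSpace.locallyCompactSpace
  obtain ⟨K, hK, hqK⟩ := exists_compact_mem_nhds (⟨q, hq⟩ : H3)
  have := hΓ.properlyDiscontinuous
  -- If `g y` has height `a`, a horizontal translation brings it into `K'`. Hence for `y ∈ K` only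
  -- the finitely many elements taking `K` to meet `K'` have to be examined.
  have hfin : Set.Finite {g : Γ | ((g • ·) '' K ∩ K').Nonempty} :=
    ProperlyDiscontinuousSMul.finite_disjoint_inter_image hK hK'
  have hKn : Subtype.val '' K ∈ 𝓝 q := by
    have := isOpen_halfSpace.isOpenEmbedding_subtypeVal.isOpenMap.image_mem_nhds hqK
    exact this
  -- Either `g` also sends `q` to level `a`, and then `g` and `h` differ by a horizontal translation
  -- and give the same condition; or it does not, and by continuity it sends no nearby point there.
  have hev : ∀ g ∈ {g : Γ | ((g • ·) '' K ∩ K').Nonempty},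
      ∀ᶠ y in 𝓝 q, permCoords g y 2 = a → permCoords h y 2 = a := by
    intro g _
    by_cases hga : permCoords g q 2 = a
    · filter_upwards [halfSpace_mem_nhds hq] with y hy hgy
      have h1 := ha.horizontal_of_eq (Γ.mul_mem hh (Γ.inv_mem g.2)) (permCoords_mem g hq) hga
        (by rw [permCoords_mul, Function.comp, permCoords_inv_apply, hqa])
        _ (permCoords_mem g hy)
      rw [permCoords_mul, Function.comp, permCoords_inv_apply] at h1
      rw [h1, hgy]
    · have hc : ContinuousAt (fun y => permCoords g y 2) q := by
        have := ((hΓ.isHypIsometry g.2).contDiffAt hq).continuousAt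
        exact (EuclideanSpace.proj 2 : E3 →L[ℝ] ℝ).continuous.continuousAt.comp this
      filter_upwards [hc.eventually_ne hga] with y h1 h2 using absurd h2 h1
  filter_upwards [hKn, (hfin.eventually_all).2 hev] with y hyK hy
  obtain ⟨y, hyK, rfl⟩ := hyK
  rw [mem_preimageSet_horoTorus y.2]
  constructor
  · rintro ⟨g, hg, hgy⟩
    rw [permCoords_coe] at hgy
    obtain ⟨t, ht, htK, hth⟩ := hcov (g y) hgy
    refine hy ⟨t * g, Γ.mul_mem ht hg⟩ ⟨t (g y), ⟨y, hyK, rfl⟩, htK⟩ ?_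
    rw [permCoords_mul, Function.comp, hth _ (permCoords_mem g y.2), permCoords_coe, hgy]
  · exact fun hy' => ⟨h, hh, hy'⟩

lemma eventually_mem_iff_of_eq (hΓ : IsHyperbolicGroup Γ) (ha : IsHoroTorusLevel Γ a) {q : E3}
    (hqa : q 2 = a) : ∀ᶠ y in 𝓝 q, y ∈ preimageSet Γ (horoTorus Γ a) ↔ y 2 = a := by
  have := ha.eventually_mem_iff hΓ Γ.one_mem (q := q) (by rw [mem_halfSpace, hqa]; exact ha.pos)
    (by rw [permCoords_one]; exact hqa)
  simpa [permCoords_one] using this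

open scoped MatrixGroups in
/-- Below the level `a`, the preimage of the horo-torus is locally a Euclidean sphere tangent to
the boundary plane. -/
lemma exists_sphere (hΓ : IsHyperbolicGroup Γ) (ha : IsHoroTorusLevel Γ a) {q : E3}
    (hq : q ∈ preimageSet Γ (horoTorus Γ a)) (hqa : q 2 < a) :
    ∃ (P : E3) (r : ℝ), P 2 = 0 ∧ 0 < r ∧ ‖q - P‖ ^ 2 = 2 * r * q 2 ∧
      (∀ y ∈ halfSpace, ‖y - P‖ ^ 2 = 2 * r * y 2 → y ∈ preimageSet Γ (horoTorus Γ a)) ∧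
      ∀ᶠ y in 𝓝 q, y ∈ preimageSet Γ (horoTorus Γ a) → ‖y - P‖ ^ 2 = 2 * r * y 2 := by
  have hq' := preimageSet_subset hq
  obtain ⟨h, hh, hhq⟩ := (mem_preimageSet_horoTorus hq').1 hq
  obtain ⟨A, hA⟩ := hΓ.moebius h hh
  have hz : ∀ y ∈ halfSpace, permCoords h y 2 = y 2 / poincareDenom A y := fun y hy => by
    rw [permCoords_coe h ⟨y, hy⟩, hA, poincare_two]
  -- If `c = 0`, the map multiplies every height by `|d|⁻²`. A sufficiently high point of the
  -- horoball would then stay in it, which a non-translation forbids.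
  have hc : A 1 0 ≠ 0 := by
    intro hc
    rcases ha.horizontal_or_lt hh with h1 | h1
    · linarith [h1 q hq']
    have hD : ∀ y, poincareDenom A y = Complex.normSq (A 1 1) := fun y => by
      simp [poincareDenom, hc]
    have hD0 : 0 < Complex.normSq (A 1 1) := by
      rw [← hD q]; exact poincareDenom_pos A ⟨q, hq'⟩
    have ha0 := ha.pos
    -- This height lies above `a`, and after division by `|d|²` it becomes `a (1 + |d|⁻²)`, still
    -- above `a`.
    set y : E3 := (a * (1 + Complex.normSq (A 1 1))) • e3 with hy
    have hy2 : y 2 = a * (1 + Complex.normSq (A 1 1)) := by simp [hy]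
    have hyH : y ∈ halfSpace := by rw [mem_halfSpace, hy2]; positivity
    have := h1 y hyH (by rw [hy2]; nlinarith)
    rw [hz y hyH, hD, hy2, div_lt_iff₀ hD0] at this
    nlinarith
  set k := Complex.normSq (A 1 0) with hk
  have hk0 : 0 < k := Complex.normSq_pos.2 hc
  have ha0 := ha.pos
  -- The image height is `y_z / (k |y - P|²)`. Setting it equal to `a` gives `|y - P|² = y_z / (a
  -- k)`, whence `r = 1 / (2 a k)`.
  have key : ∀ y ∈ halfSpace, permCoords h y 2 = a ↔
      ‖y - ofHoriz (-A 1 1 / A 1 0)‖ ^ 2 = 2 * (1 / (2 * a * k)) * y 2 := by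
    intro y hy
    have hD := poincareDenom_pos A ⟨y, hy⟩
    rw [hz y hy, div_eq_iff hD.ne', poincareDenom_eq hc, ← hk]
    constructor
    · intro h1
      rw [h1]; field_simp
    · intro h1
      rw [h1]; field_simp
  refine ⟨ofHoriz (-A 1 1 / A 1 0), 1 / (2 * a * k), ofHoriz_two _, by positivity,
    (key q hq').1 hhq, fun y hy h1 => ?_, ?_⟩
  · exact (mem_preimageSet_horoTorus hy).2 ⟨h, hh, (key y hy).2 h1⟩
  · filter_upwards [ha.eventually_mem_iff hΓ hh hq' hhq, halfSpace_mem_nhds hq'] with y h1 hy h2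
    exact (key y hy).1 (h1.1 h2)

end IsHoroTorusLevel

end HoroTorus

namespace HoroTorus

/-! ### The group action on the cotangent bundle -/

variable {Γ : Subgroup (Equiv.Perm H3)}

/-- The coordinates of a point of `T*ℍ³`. -/
def cotVal (x : H3 × E3) : E3 × E3 := (x.1, x.2)

/-- The action on `T*ℍ³` of a transformation of `ℍ³`. -/
def cotAct (g : Equiv.Perm H3) (x : H3 × E3) : H3 × E3 :=
  (g x.1, (cotLift (permCoords g) (cotVal x)).2)

lemma cotVal_cotAct (g : Equiv.Perm H3) (x : H3 × E3) :
    cotVal (cotAct g x) = cotLift (permCoords g) (cotVal x) := by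
  simp only [cotVal, cotAct, cotLift, permCoords_coe]

lemma cotVal_injective : Function.Injective cotVal := fun x y h => by
  simp only [cotVal, Prod.mk.injEq] at h
  exact Prod.ext (Subtype.ext h.1) h.2

lemma cotVal_mem (x : H3 × E3) : (cotVal x).1 ∈ halfSpace := x.1.2

lemma cotLift_id {x : E3 × E3} (hx : x.1 ∈ halfSpace) : cotLift id x = x := by
  have : x.1 2 ≠ 0 := (mem_halfSpace.1 hx).ne'
  simp [cotLift, div_self this]

lemma cotAct_one (x : H3 × E3) : cotAct 1 x = x := by
  apply cotVal_injective
  rw [cotVal_cotAct, permCoords_one, cotLift_id (cotVal_mem x)]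

lemma IsHyperbolicGroup.cotLift_mul (hΓ : IsHyperbolicGroup Γ) {g h : Equiv.Perm H3} (hg : g ∈ Γ)
    (hh : h ∈ Γ) {x : E3 × E3} (hx : x.1 ∈ halfSpace) :
    cotLift (permCoords (g * h)) x = cotLift (permCoords g) (cotLift (permCoords h) x) := by
  rw [permCoords_mul, cotLift_comp (hΓ.isHypIsometry hh).mapsTo (hΓ.isHypIsometry hh).contDiffOn
    (hΓ.isHypIsometry hg).contDiffOn hx]

lemma IsHyperbolicGroup.cotLift_inv (hΓ : IsHyperbolicGroup Γ) {g : Equiv.Perm H3} (hg : g ∈ Γ)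
    {x : E3 × E3} (hx : x.1 ∈ halfSpace) :
    cotLift (permCoords g⁻¹) (cotLift (permCoords g) x) = x := by
  rw [← hΓ.cotLift_mul (Γ.inv_mem hg) hg hx, inv_mul_cancel, permCoords_one, cotLift_id hx]

lemma IsHyperbolicGroup.cotAct_mul (hΓ : IsHyperbolicGroup Γ) {g h : Equiv.Perm H3} (hg : g ∈ Γ)
    (hh : h ∈ Γ) (x : H3 × E3) : cotAct (g * h) x = cotAct g (cotAct h x) := by
  apply cotVal_injective
  rw [cotVal_cotAct, cotVal_cotAct, cotVal_cotAct, hΓ.cotLift_mul hg hh (cotVal_mem x)]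

lemma IsHyperbolicGroup.cotAct_inv (hΓ : IsHyperbolicGroup Γ) {g : Equiv.Perm H3} (hg : g ∈ Γ)
    (x : H3 × E3) : cotAct g⁻¹ (cotAct g x) = x := by
  rw [← hΓ.cotAct_mul (Γ.inv_mem hg) hg, inv_mul_cancel, cotAct_one]

/-- By conformality, the scaling in `cotLift` is the one that turns the derivative into the inverse
transpose, so covectors are transported by duality. -/
lemma IsHyperbolicGroup.inner_cotLift (hΓ : IsHyperbolicGroup Γ) {g : Equiv.Perm H3} (hg : g ∈ Γ)
    {x : E3 × E3} (hx : x.1 ∈ halfSpace) (v : E3) :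
    ⟪(cotLift (permCoords g) x).2, fderiv ℝ (permCoords g) x.1 v⟫_ℝ = ⟪x.2, v⟫_ℝ := by
  have h1 : x.1 2 ≠ 0 := (mem_halfSpace.1 hx).ne'
  have h2 : permCoords g x.1 2 ≠ 0 := (mem_halfSpace.1 (permCoords_mem g hx)).ne'
  rw [cotLift, inner_smul_left, (hΓ.isHypIsometry hg).conformal _ hx]
  simp
  field_simp

lemma IsHyperbolicGroup.cotangentRel_iff (hΓ : IsHyperbolicGroup Γ) {x y : H3 × E3} :
    cotangentRel Γ x y ↔ ∃ g ∈ Γ, cotAct g x = y := by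
  constructor
  · rintro ⟨g, hg, h1, h2⟩
    refine ⟨g, hg, Prod.ext h1 ?_⟩
    refine ext_inner_right ℝ fun v => ?_
    rw [← hΓ.fderiv_apply_inv hg x.1.2 v, ← h2]
    exact hΓ.inner_cotLift hg (cotVal_mem x) _
  · rintro ⟨g, hg, rfl⟩
    exact ⟨g, hg, rfl, fun v => (hΓ.inner_cotLift hg (cotVal_mem x) v).symm⟩

/-- `Quot` divides by the generated equivalence relation; since `Γ` acts as a group, `cotangentRel`
is one already. -/
lemma IsHyperbolicGroup.cotProj_eq (hΓ : IsHyperbolicGroup Γ) {x y : H3 × E3} :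
    cotProj Γ x = cotProj Γ y ↔ ∃ g ∈ Γ, cotAct g x = y := by
  have he : Equivalence (cotangentRel Γ) := by
    refine ⟨fun x => ?_, fun {x y} h => ?_, fun {x y z} h h' => ?_⟩
    · exact hΓ.cotangentRel_iff.2 ⟨1, Γ.one_mem, cotAct_one x⟩
    · obtain ⟨g, hg, rfl⟩ := hΓ.cotangentRel_iff.1 h
      exact hΓ.cotangentRel_iff.2 ⟨g⁻¹, Γ.inv_mem hg, hΓ.cotAct_inv hg x⟩
    · obtain ⟨g, hg, rfl⟩ := hΓ.cotangentRel_iff.1 h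
      obtain ⟨g', hg', rfl⟩ := hΓ.cotangentRel_iff.1 h'
      exact hΓ.cotangentRel_iff.2 ⟨g' * g, Γ.mul_mem hg' hg, hΓ.cotAct_mul hg' hg x⟩
  rw [cotProj, cotProj, he.quot_mk_eq_iff, hΓ.cotangentRel_iff]

lemma IsHyperbolicGroup.continuous_cotAct (hΓ : IsHyperbolicGroup Γ) {g : Equiv.Perm H3}
    (hg : g ∈ Γ) : Continuous (cotAct g) := by
  have h0 : Continuous cotVal := by unfold cotVal; fun_prop
  refine ((hΓ.continuous hg).comp continuous_fst).prodMk (continuous_snd.comp ?_)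
  rw [continuous_iff_continuousAt]
  intro x
  exact ContinuousAt.comp (f := cotVal)
    ((hΓ.isHypIsometry hg).contDiffAt_cotLift (cotVal_mem x)).continuousAt h0.continuousAt

/-- The saturation of an open set is the union of its preimages under the homeomorphisms by which
`Γ` acts. -/
lemma IsHyperbolicGroup.isOpen_cotProj_image (hΓ : IsHyperbolicGroup Γ) {W : Set (H3 × E3)}
    (hW : IsOpen W) : IsOpen (cotProj Γ '' W) := by
  rw [← isQuotientMap_quot_mk.isOpen_preimage]
  have : Quot.mk (cotangentRel Γ) ⁻¹' (cotProj Γ '' W) = ⋃ g : Γ, cotAct g ⁻¹' W := by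
    ext x
    simp only [mem_preimage, mem_image, mem_iUnion]
    constructor
    · rintro ⟨w, hw, h⟩
      obtain ⟨g, hg, rfl⟩ := hΓ.cotProj_eq.1 (show cotProj Γ x = cotProj Γ w from h.symm)
      exact ⟨⟨g, hg⟩, hw⟩
    · rintro ⟨g, hg⟩
      exact ⟨_, hg, (hΓ.cotProj_eq.2 ⟨g, g.2, rfl⟩).symm⟩
  rw [this]
  exact isOpen_iUnion fun g => hW.preimage (hΓ.continuous_cotAct g.2)

lemma conormalLift_fst_mem {T : Set (Mfd Γ)} {x : E3 × E3} (hx : x ∈ conormalLift Γ T) :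
    x.1 ∈ halfSpace := preimageSet_subset hx.1

lemma IsHyperbolicGroup.cotLift_mem_conormalLift (hΓ : IsHyperbolicGroup Γ) {T : Set (Mfd Γ)}
    {g : Equiv.Perm H3} (hg : g ∈ Γ) {x : E3 × E3} (hx : x ∈ conormalLift Γ T) :
    cotLift (permCoords g) x ∈ conormalLift Γ T := by
  have hx' := conormalLift_fst_mem hx
  refine ⟨(permCoords_mem_preimageSet hg hx').2 hx.1, fun v hv => ?_⟩
  have h1 := hΓ.fderiv_mem_tangentSpaceOf (Γ.inv_mem hg) (permCoords_mem g hx') hv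
  rw [permCoords_inv_apply] at h1
  rw [← hΓ.fderiv_apply_inv hg hx' v, hΓ.inner_cotLift hg hx']
  exact hx.2 _ h1

lemma IsHyperbolicGroup.cotProj_mem_conormal (hΓ : IsHyperbolicGroup Γ) {T : Set (Mfd Γ)}
    {x : H3 × E3} : cotProj Γ x ∈ conormal Γ T ↔ cotVal x ∈ conormalLift Γ T := by
  constructor
  · rintro ⟨y, hy, h⟩
    obtain ⟨g, hg, rfl⟩ := hΓ.cotProj_eq.1 h
    rw [cotVal_cotAct]
    exact hΓ.cotLift_mem_conormalLift hg hy
  · exact fun h => ⟨x, h, rfl⟩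

/-! ### Trajectories of the geodesic flow -/

/-- Hamiltonian trajectories over the half-space, in coordinates. -/
structure IsTrajectory (c : ℝ → E3 × E3) : Prop where
  mem : ∀ t ∈ Icc (0 : ℝ) 1, (c t).1 ∈ halfSpace
  deriv : ∀ t ∈ Icc (0 : ℝ) 1, HasDerivWithinAt c (hamiltonianField (c t)) (Icc 0 1) t

lemma cotCoords_coe (l : unitInterval → H3 × E3) (t : unitInterval) :
    cotCoords l t = cotVal (l t) := by
  simp [cotCoords, ext, cotVal]

lemma cotCoords_zero (l : unitInterval → H3 × E3) : cotCoords l 0 = cotVal (l 0) :=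
  cotCoords_coe l 0

lemma cotCoords_one (l : unitInterval → H3 × E3) : cotCoords l 1 = cotVal (l 1) :=
  cotCoords_coe l 1

lemma IsHamiltonianLift.isTrajectory {γ : unitInterval → Cotangent Γ} {l : unitInterval → H3 × E3}
    (h : IsHamiltonianLift Γ γ l) : IsTrajectory (cotCoords l) :=
  ⟨fun t ht => by rw [cotCoords_coe l ⟨t, ht⟩]; exact cotVal_mem _, h.2⟩

lemma cotCoords_cotAct (g : Equiv.Perm H3) (l : unitInterval → H3 × E3) (t : ℝ) :
    cotCoords (fun t => cotAct g (l t)) t = cotLift (permCoords g) (cotCoords l t) := by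
  rw [show cotCoords l t = cotVal (l (projIcc 0 1 zero_le_one t)) from rfl, ← cotVal_cotAct]
  rfl

lemma IsHyperbolicGroup.cotLift_comp_isTrajectory (hΓ : IsHyperbolicGroup Γ) {g : Equiv.Perm H3}
    (hg : g ∈ Γ) {c : ℝ → E3 × E3} (hc : IsTrajectory c) :
    IsTrajectory (fun t => cotLift (permCoords g) (c t)) := by
  refine ⟨fun t ht => permCoords_mem g (hc.mem t ht), fun t ht => ?_⟩
  have h := hΓ.isHypIsometry hg
  rw [← h.equivariant _ (hc.mem t ht)]
  exact ((h.contDiffAt_cotLift (hc.mem t ht)).differentiableAt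
    (by simp)).hasFDerivAt.comp_hasDerivWithinAt t (hc.deriv t ht)

lemma IsHyperbolicGroup.cotAct_isHamiltonianLift (hΓ : IsHyperbolicGroup Γ) {g : Equiv.Perm H3}
    (hg : g ∈ Γ) {γ : unitInterval → Cotangent Γ} {l : unitInterval → H3 × E3}
    (h : IsHamiltonianLift Γ γ l) : IsHamiltonianLift Γ γ (fun t => cotAct g (l t)) := by
  refine ⟨fun t => ?_, ?_⟩
  · rw [← h.1 t]
    exact (hΓ.cotProj_eq.2 ⟨g, hg, rfl⟩).symm
  · rw [show cotCoords (fun t => cotAct g (l t)) = fun t => cotLift (permCoords g) (cotCoords l t)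
      from funext (cotCoords_cotAct g l)]
    exact (hΓ.cotLift_comp_isTrajectory hg h.isTrajectory).deriv

lemma contDiff_hamiltonianField : ContDiff ℝ ∞ hamiltonianField := by
  rw [show hamiltonianField = _ from funext hamiltonianField_eq]
  have h1 : ContDiff ℝ ∞ (fun x : E3 × E3 => ‖x.2‖ ^ 2) := contDiff_snd.norm_sq ℝ
  have h2 : ContDiff ℝ ∞ (fun x : E3 × E3 => x.1 2) :=
    (EuclideanSpace.proj 2 : E3 →L[ℝ] ℝ).contDiff.comp contDiff_fst
  exact ((h2.pow 2).smul contDiff_snd).prodMk ((h2.mul h1).smul contDiff_const).neg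

/-- A symmetry of a vector field carries solutions of the linearized equation to solutions of the
linearized equation. -/
lemma hasDerivWithinAt_linearized {E : Type*} [NormedAddCommGroup E] [NormedSpace ℝ E]
    {X Φ : E → E} {c ξ : ℝ → E} {s : Set ℝ} {t : ℝ} (hX : Differentiable ℝ X)
    (hΦ : ContDiffAt ℝ ∞ Φ (c t)) (hinv : ∀ᶠ y in 𝓝 (c t), fderiv ℝ Φ y (X y) = X (Φ y))
    (hc : HasDerivWithinAt c (X (c t)) s t) (hξ : HasDerivWithinAt ξ (fderiv ℝ X (c t) (ξ t)) s t) :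
    HasDerivWithinAt (fun t => fderiv ℝ Φ (c t) (ξ t))
      (fderiv ℝ X (Φ (c t)) (fderiv ℝ Φ (c t) (ξ t))) s t := by
  have h1 : DifferentiableAt ℝ (fderiv ℝ Φ) (c t) :=
    (hΦ.fderiv_right (m := ∞) (by simp)).differentiableAt (by simp)
  have h2 : HasDerivWithinAt (fun t => fderiv ℝ Φ (c t)) (fderiv ℝ (fderiv ℝ Φ) (c t) (X (c t)))
      s t :=
    h1.hasFDerivAt.comp_hasDerivWithinAt t hc
  have h3 := h2.clm_apply hξ
  -- Differentiating `dΦ(X) = X ∘ Φ` in the direction `ξ` yields the linearized equation, once the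
  -- arguments of `D²Φ` are swapped.
  have hsymm : IsSymmSndFDerivAt ℝ Φ (c t) :=
    hΦ.isSymmSndFDerivAt (by simpa using WithTop.coe_le_coe.2 (le_top : (2 : ℕ∞) ≤ ⊤))
  have h4 : HasFDerivAt (fun y => fderiv ℝ Φ y (X y)) _ (c t) :=
    h1.hasFDerivAt.clm_apply (hX (c t)).hasFDerivAt
  have h5 : HasFDerivAt (fun y => X (Φ y)) _ (c t) :=
    (hX (Φ (c t))).hasFDerivAt.comp (c t) (hΦ.differentiableAt (by simp)).hasFDerivAt
  have h6 := congrArg (fun L : E →L[ℝ] E => L (ξ t)) (h4.unique (h5.congr_of_eventuallyEq hinv))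
  simp at h6
  refine h3.congr_deriv ?_
  rw [hsymm (X (c t)) (ξ t), ← h6]
  abel

lemma eq_of_hasDerivWithinAt_zero {f : ℝ → ℝ}
    (hf : ∀ t ∈ Icc (0 : ℝ) 1, HasDerivWithinAt f 0 (Icc 0 1) t) :
    ∀ t ∈ Icc (0 : ℝ) 1, f t = f 0 :=
  constant_of_derivWithin_zero (fun t ht => (hf t ht).differentiableWithinAt) fun t ht =>
    (hf t (Ico_subset_Icc_self ht)).derivWithin (uniqueDiffOn_Icc zero_lt_one t
      (Ico_subset_Icc_self ht))

lemma hasDerivWithinAt_fst_coord {c : ℝ → E3 × E3} {c' : E3 × E3} {s : Set ℝ} {t : ℝ}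
    (h : HasDerivWithinAt c c' s t) (i : Fin 3) :
    HasDerivWithinAt (fun t => (c t).1 i) (c'.1 i) s t :=
  ((EuclideanSpace.proj i : E3 →L[ℝ] ℝ).comp
    (ContinuousLinearMap.fst ℝ E3 E3)).hasFDerivAt.comp_hasDerivWithinAt t h

lemma hasDerivWithinAt_snd_coord {c : ℝ → E3 × E3} {c' : E3 × E3} {s : Set ℝ} {t : ℝ}
    (h : HasDerivWithinAt c c' s t) (i : Fin 3) :
    HasDerivWithinAt (fun t => (c t).2 i) (c'.2 i) s t :=
  ((EuclideanSpace.proj i : E3 →L[ℝ] ℝ).comp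
    (ContinuousLinearMap.snd ℝ E3 E3)).hasFDerivAt.comp_hasDerivWithinAt t h

/-- The trajectory of the geodesic flow along a vertical line, at speed `μ` downwards, starting at
height `a`. -/
def verticalTrajectory (x y a μ t : ℝ) : E3 × E3 :=
  (!₂[x, y, a * Real.exp (-(μ * t))], (-μ / (a * Real.exp (-(μ * t)))) • e3)

/-- The Hamiltonian is invariant under horizontal translations, so the horizontal momenta are
conserved and stay zero. The horizontal position is then fixed, and the vertical motion integrates
explicitly, without an ODE uniqueness theorem. -/
lemma IsTrajectory.eq_vertical {c : ℝ → E3 × E3} (hc : IsTrajectory c) (h0 : (c 0).2 0 = 0)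
    (h1 : (c 0).2 1 = 0) : ∀ t ∈ Icc (0 : ℝ) 1,
      c t = verticalTrajectory ((c 0).1 0) ((c 0).1 1) ((c 0).1 2)
        (-((c 0).1 2 * (c 0).2 2)) t := by
  have hd : ∀ t ∈ Icc (0 : ℝ) 1, HasDerivWithinAt c
      (((c t).1 2) ^ 2 • (c t).2, -(((c t).1 2 * ‖(c t).2‖ ^ 2) • e3)) (Icc 0 1) t := fun t ht => by
    rw [← hamiltonianField_eq]; exact hc.deriv t ht
  have hq : ∀ t ∈ Icc (0 : ℝ) 1, ∀ i, HasDerivWithinAt (fun t => (c t).1 i)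
      ((c t).1 2 ^ 2 * (c t).2 i) (Icc 0 1) t := fun t ht i =>
    hasDerivWithinAt_fst_coord (hd t ht) i
  have hp : ∀ t ∈ Icc (0 : ℝ) 1, ∀ i, HasDerivWithinAt (fun t => (c t).2 i)
      (-((c t).1 2 * ‖(c t).2‖ ^ 2 * e3 i)) (Icc 0 1) t := fun t ht i =>
    by simpa using hasDerivWithinAt_snd_coord (hd t ht) i
  have p0 : ∀ t ∈ Icc (0 : ℝ) 1, (c t).2 0 = 0 := fun t ht => by
    rw [← h0]
    exact eq_of_hasDerivWithinAt_zero (f := fun t => (c t).2 0)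
      (fun t ht => by simpa using hp t ht 0) t ht
  have p1 : ∀ t ∈ Icc (0 : ℝ) 1, (c t).2 1 = 0 := fun t ht => by
    rw [← h1]
    exact eq_of_hasDerivWithinAt_zero (f := fun t => (c t).2 1)
      (fun t ht => by simpa using hp t ht 1) t ht
  have q0 := eq_of_hasDerivWithinAt_zero (f := fun t => (c t).1 0)
      (fun t ht => by simpa [p0 t ht] using hq t ht 0)
  have q1 := eq_of_hasDerivWithinAt_zero (f := fun t => (c t).1 1)
      (fun t ht => by simpa [p1 t ht] using hq t ht 1)
  set μ := -((c 0).1 2 * (c 0).2 2) with hμ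
  -- With zero horizontal momentum, `z p_z` is the conserved quantity attached to dilations. It
  -- gives `z' = z² p_z = -μ z`, so `z e^{μt}` is constant.
  have hzp : ∀ t ∈ Icc (0 : ℝ) 1, (c t).1 2 * (c t).2 2 = -μ := by
    rw [hμ, neg_neg]
    refine eq_of_hasDerivWithinAt_zero (f := fun t => (c t).1 2 * (c t).2 2) fun t ht => ?_
    refine ((hq t ht 2).mul (hp t ht 2)).congr_deriv ?_
    rw [norm_sq_eq_sum, p0 t ht, p1 t ht]
    simp
    ring
  have hze : ∀ t ∈ Icc (0 : ℝ) 1, (c t).1 2 * Real.exp (μ * t) = (c 0).1 2 := by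
    intro t ht
    have := eq_of_hasDerivWithinAt_zero (f := fun t => (c t).1 2 * Real.exp (μ * t)) ?_ t ht
    · simpa using this
    intro t ht
    have he : HasDerivWithinAt (fun t => Real.exp (μ * t)) (Real.exp (μ * t) * (μ * 1))
      (Icc 0 1) t := ((hasDerivWithinAt_id t _).const_mul μ).exp
    refine ((hq t ht 2).mul he).congr_deriv ?_
    linear_combination ((c t).1 2 * Real.exp (μ * t)) * hzp t ht
  intro t ht
  have hz : (c t).1 2 = (c 0).1 2 * Real.exp (-(μ * t)) := by
    rw [← hze t ht, mul_assoc, ← Real.exp_add]; simp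
  have hz0 : (c t).1 2 ≠ 0 := (mem_halfSpace.1 (hc.mem t ht)).ne'
  refine Prod.ext (ext_coords ?_ ?_ ?_) (ext_coords ?_ ?_ ?_)
  · simpa [verticalTrajectory] using q0 t ht
  · simpa [verticalTrajectory] using q1 t ht
  · simpa [verticalTrajectory] using hz
  · simpa [verticalTrajectory] using p0 t ht
  · simpa [verticalTrajectory] using p1 t ht
  · simp only [verticalTrajectory, ← hz]
    simp
    rw [eq_div_iff hz0, ← hzp t ht, mul_comm]

end HoroTorus

namespace HoroTorus

/-! ### Chords of the conormal -/

variable {Γ : Subgroup (Equiv.Perm H3)} {a : ℝ}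

/-- A chord of the conormal which starts at the horosphere `z = a` runs down a vertical line to the
top of a Euclidean sphere of radius `r` that touches the boundary plane at `P`. -/
structure IsVerticalChord (Γ : Subgroup (Equiv.Perm H3)) (a : ℝ) (P : E3) (r μ : ℝ)
    (c : ℝ → E3 × E3) : Prop where
  height_pos : 0 < a
  foot : P 2 = 0
  radius_pos : 0 < r
  speed_pos : 0 < μ
  height : a * Real.exp (-μ) = 2 * r
  eq_vertical : ∀ t ∈ Icc (0 : ℝ) 1, c t = verticalTrajectory (P 0) (P 1) a μ t
  sphere_subset : ∀ y ∈ halfSpace, ‖y - P‖ ^ 2 = 2 * r * y 2 → y ∈ preimageSet Γ (horoTorus Γ a)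
  eventually_sphere : ∀ᶠ y in 𝓝 (P + (2 * r) • e3),
    y ∈ preimageSet Γ (horoTorus Γ a) → ‖y - P‖ ^ 2 = 2 * r * y 2

lemma plane_subset {y : E3} (ha : 0 < a) (hy : y 2 = a) : y ∈ preimageSet Γ (horoTorus Γ a) := by
  have hy' : y ∈ halfSpace := by rw [mem_halfSpace, hy]; exact ha
  refine (mem_preimageSet_horoTorus hy').2 ⟨1, Γ.one_mem, ?_⟩
  rw [permCoords_one]; exact hy

lemma conormal_vertical (ha : 0 < a) {x : E3 × E3} (hx : x ∈ conormalLift Γ (horoTorus Γ a))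
    (hxa : x.1 2 = a) : x.2 0 = 0 ∧ x.2 1 = 0 := by
  have h : ∀ v : E3, v 2 = 0 → ⟪x.2, v⟫_ℝ = 0 := fun v hv =>
    hx.2 v (mem_tangentSpaceOf_plane
      (Eventually.of_forall fun y hy => plane_subset ha (hy.trans hxa)) hv)
  have h0 := h (EuclideanSpace.single 0 1) (by simp)
  have h1 := h (EuclideanSpace.single 1 1) (by simp)
  simp [inner_eq_sum] at h0 h1
  exact ⟨h0, h1⟩

/-- A point of a sphere with vertical normal is its top, since the sphere touches `z = 0`. -/
lemma eq_top_of_vertical {P q : E3} {r s : ℝ} (hr : 0 < r) (hP : P 2 = 0) (hq : q ∈ halfSpace)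
    (hqs : ‖q - P‖ ^ 2 = 2 * r * q 2)
    (hS : ∀ y ∈ halfSpace, ‖y - P‖ ^ 2 = 2 * r * y 2 → y ∈ preimageSet Γ (horoTorus Γ a))
    (hs : s ≠ 0) (hc : (q, s • e3) ∈ conormalLift Γ (horoTorus Γ a)) : q = P + (2 * r) • e3 := by
  have hS' : ∀ᶠ y in 𝓝 q, ‖y - P‖ ^ 2 = 2 * r * y 2 → y ∈ preimageSet Γ (horoTorus Γ a) := by
    filter_upwards [halfSpace_mem_nhds hq] with y hy using hS y hy
  set n := q - (P + r • e3) with hn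
  -- The vector `|n|² e_z - n_z n` is orthogonal to the normal `n`, hence tangent. Its pairing with
  -- `s e_z` is `s (n_x² + n_y²)`, so `n` must be vertical.
  have h := hc.2 (‖n‖ ^ 2 • e3 - n 2 • n) (mem_tangentSpaceOf_sphere hr hP hqs hS' (by
    rw [← hn, inner_sub_right, inner_smul_right, inner_smul_right, inner_e3,
      real_inner_self_eq_norm_sq]
    ring))
  simp only [inner_smul_left, inner_eq_sum, norm_sq_eq_sum] at h
  simp at h
  have h' : n 0 ^ 2 + n 1 ^ 2 = 0 := by
    rcases h with h | h
    · exact absurd h hs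
    · linarith
  have h0 : n 0 = 0 := by nlinarith [sq_nonneg (n 0), sq_nonneg (n 1)]
  have h1 : n 1 = 0 := by nlinarith [sq_nonneg (n 0), sq_nonneg (n 1)]
  simp [hn] at h0 h1
  -- A vertical normal leaves the two poles; the bottom one lies on the boundary plane.
  have hz : 0 < q 2 := hq
  refine ext_coords (by simp; linarith) (by simp; linarith) ?_
  rw [norm_sq_eq_sum] at hqs
  simp [hP, h0, h1] at hqs ⊢
  nlinarith

lemma verticalTrajectory_fst_one (x y a μ : ℝ) :
    (verticalTrajectory x y a μ 1).1 = !₂[x, y, a * Real.exp (-μ)] := by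
  simp [verticalTrajectory]

/-- The trajectory is vertical. It does not rise, because the preimage of the torus has no point
above `a`, and `μ = 0` would make it constant. So it ends strictly below `a`, orthogonally to a
sphere, and therefore at its top. -/
lemma IsTrajectory.isVerticalChord (hΓ : IsHyperbolicGroup Γ) (ha : IsHoroTorusLevel Γ a)
    {c : ℝ → E3 × E3} (hc : IsTrajectory c) (h0a : (c 0).1 2 = a)
    (h0 : c 0 ∈ conormalLift Γ (horoTorus Γ a)) (h1 : c 1 ∈ conormalLift Γ (horoTorus Γ a))
    (hne : ∃ t ∈ Icc (0 : ℝ) 1, c t ≠ c 0) : ∃ P r μ, IsVerticalChord Γ a P r μ c := by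
  have ha0 := ha.pos
  obtain ⟨hp0, hp1⟩ := conormal_vertical ha0 h0 h0a
  have hv := hc.eq_vertical hp0 hp1
  rw [h0a] at hv
  set μ := -(a * (c 0).2 2) with hμ
  have hc1 : (c 1).1 = !₂[(c 0).1 0, (c 0).1 1, a * Real.exp (-μ)] := by
    rw [hv 1 (by simp), verticalTrajectory_fst_one]
  have hle : (c 1).1 2 ≤ a := ha.le_of_mem h1.1
  rw [hc1] at hle
  simp at hle
  have hμ0 : μ ≠ 0 := by
    intro h
    obtain ⟨t, ht, htne⟩ := hne
    apply htne
    rw [hv t ht, hv 0 (by simp), h]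
    simp [verticalTrajectory]
  have hμpos : 0 < μ := by
    rcases lt_or_gt_of_ne hμ0 with h | h
    · have : 1 < Real.exp (-μ) := by rw [Real.one_lt_exp_iff]; linarith
      nlinarith
    · exact h
  have hlt : (c 1).1 2 < a := by
    have : Real.exp (-μ) < 1 := by rw [Real.exp_lt_one_iff]; linarith
    rw [hc1]
    simp
    nlinarith
  obtain ⟨P, r, hP, hr, hqs, hS, hev⟩ := ha.exists_sphere hΓ h1.1 hlt
  have hc1m := conormalLift_fst_mem h1
  have htop : (c 1).1 = P + (2 * r) • e3 := by
    refine eq_top_of_vertical (Γ := Γ) (a := a) (s := -μ / (a * Real.exp (-(μ * 1)))) hr hP hc1m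
      hqs hS ?_ ?_
    · exact div_ne_zero (neg_ne_zero.2 hμ0) (by positivity)
    · have : c 1 = ((c 1).1, (-μ / (a * Real.exp (-(μ * 1)))) • e3) :=
        Prod.ext rfl (by rw [hv 1 (by simp)]; rfl)
      rwa [← this]
  have e0 := congrArg (fun v : E3 => v 0) (hc1.symm.trans htop)
  have e1 := congrArg (fun v : E3 => v 1) (hc1.symm.trans htop)
  have e2 := congrArg (fun v : E3 => v 2) (hc1.symm.trans htop)
  simp [hP] at e0 e1 e2
  refine ⟨P, r, μ, ha0, hP, hr, hμpos, e2, ?_, hS, ?_⟩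
  · rw [← e0, ← e1]; exact hv
  · rwa [← htop]

lemma hasFDerivAt_fst_coord (x : E3 × E3) (i : Fin 3) : HasFDerivAt (fun x : E3 × E3 => x.1 i)
    ((EuclideanSpace.proj i : E3 →L[ℝ] ℝ).comp (ContinuousLinearMap.fst ℝ E3 E3)) x :=
  ((EuclideanSpace.proj i : E3 →L[ℝ] ℝ).comp (ContinuousLinearMap.fst ℝ E3 E3)).hasFDerivAt

lemma hasFDerivAt_snd_coord (x : E3 × E3) (i : Fin 3) : HasFDerivAt (fun x : E3 × E3 => x.2 i)
    ((EuclideanSpace.proj i : E3 →L[ℝ] ℝ).comp (ContinuousLinearMap.snd ℝ E3 E3)) x :=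
  ((EuclideanSpace.proj i : E3 →L[ℝ] ℝ).comp (ContinuousLinearMap.snd ℝ E3 E3)).hasFDerivAt

namespace IsVerticalChord

variable {P : E3} {r μ : ℝ} {c : ℝ → E3 × E3}

lemma fst_zero (h : IsVerticalChord Γ a P r μ c) : (c 0).1 = P + a • e3 := by
  rw [h.eq_vertical 0 (by simp)]
  refine ext_coords ?_ ?_ ?_ <;> simp [verticalTrajectory, h.foot]

lemma fst_one (h : IsVerticalChord Γ a P r μ c) : (c 1).1 = P + (2 * r) • e3 := by
  rw [h.eq_vertical 1 (by simp), verticalTrajectory_fst_one, h.height]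
  refine ext_coords ?_ ?_ ?_ <;> simp [h.foot]

/-- Rigidity of chords. -/
lemma eventually_eqOn (hΓ : IsHyperbolicGroup Γ) (ha : IsHoroTorusLevel Γ a)
    (h : IsVerticalChord Γ a P r μ c) : ∀ᶠ x in 𝓝 (c 0), ∀ c', IsTrajectory c' → c' 0 = x →
      c' 0 ∈ conormalLift Γ (horoTorus Γ a) → c' 1 ∈ conormalLift Γ (horoTorus Γ a) →
      EqOn c' c (Icc 0 1) := by
  have ha0 := ha.pos
  have hc0 : (c 0).1 2 = a := by rw [h.fst_zero]; simp [h.foot]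
  have hev1 : ∀ᶠ x in 𝓝 (c 0), x.1 ∈ preimageSet Γ (horoTorus Γ a) → x.1 2 = a := by
    filter_upwards [continuous_fst.continuousAt.eventually (ha.eventually_mem_iff_of_eq hΓ hc0)]
      with x hx using hx.1
  have hp0 : (c 0).2 2 = -(μ / a) := by
    rw [h.eq_vertical 0 (by simp)]
    simp [verticalTrajectory]
    ring
  -- Nearby starting covectors still point down, which excludes the constant chords.
  have hev2 : ∀ᶠ x in 𝓝 (c 0), x.2 2 < 0 := by
    have hct : ContinuousAt (fun x : E3 × E3 => x.2 2) (c 0) := by fun_prop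
    refine hct.eventually_lt_const ?_
    change (c 0).2 2 < 0
    rw [hp0, neg_lt_zero]
    exact div_pos h.speed_pos ha0
  -- For a vertical covector this is the end point at time one. It is continuous in all starting
  -- data, so nearby chords end near the top of the same sphere.
  set Ψ : E3 × E3 → E3 := fun x => (x.1 0) • EuclideanSpace.single 0 1 +
    (x.1 1) • EuclideanSpace.single 1 1 + (x.1 2 * Real.exp (x.1 2 * x.2 2)) • e3 with hΨ
  have hΨc : Continuous Ψ := by fun_prop
  have hΨ0 : Ψ (c 0) = P + (2 * r) • e3 := by
    rw [← h.height]
    simp only [hΨ, hp0, h.fst_zero]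
    have hexp : a * -(μ / a) = -μ := by field_simp
    refine ext_coords ?_ ?_ ?_ <;> simp [h.foot]
    left
    linarith
  have hev3 : ∀ᶠ x in 𝓝 (c 0), Ψ x ∈ preimageSet Γ (horoTorus Γ a) →
      ‖Ψ x - P‖ ^ 2 = 2 * r * Ψ x 2 := by
    have := hΨc.continuousAt (x := c 0)
    rw [ContinuousAt, hΨ0] at this
    exact this.eventually h.eventually_sphere
  filter_upwards [hev1, hev2, hev3] with x h1 h2 h3 c' hc' hcx hL0 hL1
  subst hcx
  have hz0 := h1 hL0.1
  obtain ⟨hx0, hx1⟩ := conormal_vertical ha0 hL0 hz0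
  have hv := hc'.eq_vertical hx0 hx1
  rw [hz0] at hv
  set μ' := -(a * (c' 0).2 2) with hμ'
  have hμ'pos : 0 < μ' := by rw [hμ']; nlinarith
  have hend : (c' 1).1 = Ψ (c' 0) := by
    rw [hv 1 (by simp), verticalTrajectory_fst_one]
    refine ext_coords ?_ ?_ ?_ <;> simp [hΨ, hz0, hμ']
  have hsph := h3 (hend ▸ hL1.1)
  rw [← hend] at hsph
  have htop : (c' 1).1 = P + (2 * r) • e3 := by
    refine eq_top_of_vertical (Γ := Γ) (a := a) (s := -μ' / (a * Real.exp (-(μ' * 1))))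
      h.radius_pos h.foot (conormalLift_fst_mem hL1) hsph h.sphere_subset ?_ ?_
    · exact div_ne_zero (neg_ne_zero.2 hμ'pos.ne') (by positivity)
    · have : c' 1 = ((c' 1).1, (-μ' / (a * Real.exp (-(μ' * 1)))) • e3) :=
        Prod.ext rfl (by rw [hv 1 (by simp)]; rfl)
      rwa [← this]
  rw [hv 1 (by simp), verticalTrajectory_fst_one] at htop
  have e0 := congrArg (fun v : E3 => v 0) htop
  have e1 := congrArg (fun v : E3 => v 1) htop
  have e2 := congrArg (fun v : E3 => v 2) htop
  simp [h.foot] at e0 e1 e2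
  have hμμ : μ' = μ := by
    have := h.height
    rw [← e2] at this
    have := Real.exp_injective (mul_left_cancel₀ ha0.ne' this)
    linarith
  intro t ht
  rw [hv t ht, h.eq_vertical t ht, e0, e1, hμμ]

lemma fderiv_hamiltonianField_apply (x ξ : E3 × E3) :
    fderiv ℝ hamiltonianField x ξ = ((2 * x.1 2 * ξ.1 2) • x.2 + (x.1 2) ^ 2 • ξ.2,
      -((ξ.1 2 * ‖x.2‖ ^ 2 + 2 * x.1 2 * ⟪x.2, ξ.2⟫_ℝ) • e3)) := by
  have hz : HasFDerivAt (fun x : E3 × E3 => x.1 2)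
      ((EuclideanSpace.proj 2 : E3 →L[ℝ] ℝ).comp (ContinuousLinearMap.fst ℝ E3 E3)) x :=
    ((EuclideanSpace.proj 2 : E3 →L[ℝ] ℝ).comp (ContinuousLinearMap.fst ℝ E3 E3)).hasFDerivAt
  have hp : HasFDerivAt (fun x : E3 × E3 => x.2) (ContinuousLinearMap.snd ℝ E3 E3) x :=
    hasFDerivAt_snd
  have h1 := ((hz.pow 2).smul hp).prodMk ((hz.mul hp.norm_sq).smul_const e3).neg
  have h2 := HasFDerivAt.fderiv (h1.congr_of_eventuallyEq
    (Eventually.of_forall hamiltonianField_eq))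
  rw [h2]
  refine Prod.ext ?_ ?_
  · simp
    module
  · simp
    module

/-- Tangent vectors to the conormal at the upper end of a vertical chord. -/
lemma tangent_zero (hΓ : IsHyperbolicGroup Γ) (ha : IsHoroTorusLevel Γ a)
    (h : IsVerticalChord Γ a P r μ c) {ξ : E3 × E3}
    (hξ : ξ ∈ tangentSpaceOf (conormalLift Γ (horoTorus Γ a)) (c 0)) :
    ξ.1 2 = 0 ∧ ξ.2 0 = 0 ∧ ξ.2 1 = 0 := by
  have hc0 : (c 0).1 2 = a := by rw [h.fst_zero]; simp [h.foot]
  have hev : ∀ᶠ x in 𝓝 (c 0), x ∈ conormalLift Γ (horoTorus Γ a) →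
      x.1 2 - a = 0 ∧ x.2 0 = 0 ∧ x.2 1 = 0 := by
    filter_upwards [continuous_fst.continuousAt.eventually (ha.eventually_mem_iff_of_eq hΓ hc0)]
      with x hx hxL
    have := hx.1 hxL.1
    exact ⟨by linarith, conormal_vertical ha.pos hxL this⟩
  have hf : ∀ i, HasFDerivAt (fun x : E3 × E3 => x.1 i)
      ((EuclideanSpace.proj i : E3 →L[ℝ] ℝ).comp (ContinuousLinearMap.fst ℝ E3 E3)) (c 0) :=
    hasFDerivAt_fst_coord _
  have hs : ∀ i, HasFDerivAt (fun x : E3 × E3 => x.2 i)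
      ((EuclideanSpace.proj i : E3 →L[ℝ] ℝ).comp (ContinuousLinearMap.snd ℝ E3 E3)) (c 0) :=
    hasFDerivAt_snd_coord _
  exact ⟨fderiv_eq_zero_of_mem_tangentSpaceOf ((hf 2).sub_const a) (hev.mono fun x hx h => (hx h).1)
      hξ, fderiv_eq_zero_of_mem_tangentSpaceOf (hs 0) (hev.mono fun x hx h => (hx h).2.1) hξ,
    fderiv_eq_zero_of_mem_tangentSpaceOf (hs 1) (hev.mono fun x hx h => (hx h).2.2) hξ⟩

/-- Tangent vectors to the conormal at the lower end of a vertical chord. -/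
lemma tangent_one (h : IsVerticalChord Γ a P r μ c) {ξ : E3 × E3}
    (hξ : ξ ∈ tangentSpaceOf (conormalLift Γ (horoTorus Γ a)) (c 1)) :
    ξ.1 2 = 0 ∧ ξ.2 0 * r = (c 1).2 2 * ξ.1 0 ∧ ξ.2 1 * r = (c 1).2 2 * ξ.1 1 := by
  have hr := h.radius_pos
  -- Near the end point the conormal satisfies the sphere equation, and its covectors are parallel
  -- to the normal. Differentiating these equations at the top, where `z - r = r`, yields the three
  -- conditions.
  have hev : ∀ᶠ x in 𝓝 (c 1), x ∈ conormalLift Γ (horoTorus Γ a) →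
      ‖x.1 - P‖ ^ 2 - 2 * r * x.1 2 = 0 ∧
      x.2 0 * (x.1 2 - r) - x.2 2 * (x.1 0 - P 0) = 0 ∧
      x.2 1 * (x.1 2 - r) - x.2 2 * (x.1 1 - P 1) = 0 := by
    have hev' : ∀ᶠ x in 𝓝 (c 1), x.1 ∈ preimageSet Γ (horoTorus Γ a) →
        ‖x.1 - P‖ ^ 2 = 2 * r * x.1 2 :=
      continuous_fst.continuousAt.eventually (by rw [h.fst_one]; exact h.eventually_sphere)
    filter_upwards [hev'] with x hx hxL
    have hq := hx hxL.1
    have hS' : ∀ᶠ y in 𝓝 x.1, ‖y - P‖ ^ 2 = 2 * r * y 2 → y ∈ preimageSet Γ (horoTorus Γ a) := by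
      filter_upwards [halfSpace_mem_nhds (conormalLift_fst_mem hxL)] with y hy
        using h.sphere_subset y hy
    have hn : ∀ v : E3, ⟪x.1 - (P + r • e3), v⟫_ℝ = 0 → ⟪x.2, v⟫_ℝ = 0 := fun v hv =>
      hxL.2 v (mem_tangentSpaceOf_sphere hr h.foot hq hS' hv)
    -- This vector and the next are orthogonal to the normal `(x - P_x, y - P_y, z - r)`;
    -- annihilating them expresses parallelism to it.
    have h0 := hn !₂[x.1 2 - r, 0, -(x.1 0 - P 0)] (by simp [inner_eq_sum, h.foot]; ring)
    have h1 := hn !₂[0, x.1 2 - r, -(x.1 1 - P 1)] (by simp [inner_eq_sum, h.foot]; ring)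
    simp [inner_eq_sum] at h0 h1
    exact ⟨by linarith, by linarith, by linarith⟩
  have hf : ∀ i, HasFDerivAt (fun x : E3 × E3 => x.1 i)
      ((EuclideanSpace.proj i : E3 →L[ℝ] ℝ).comp (ContinuousLinearMap.fst ℝ E3 E3)) (c 1) :=
    hasFDerivAt_fst_coord _
  have hs : ∀ i, HasFDerivAt (fun x : E3 × E3 => x.2 i)
      ((EuclideanSpace.proj i : E3 →L[ℝ] ℝ).comp (ContinuousLinearMap.snd ℝ E3 E3)) (c 1) :=
    hasFDerivAt_snd_coord _
  have hsub : HasFDerivAt (fun x : E3 × E3 => x.1 - P) (ContinuousLinearMap.fst ℝ E3 E3) (c 1) :=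
    hasFDerivAt_fst.sub_const P
  have hc2 : ∀ i : Fin 3, (c 1).2 i = (-μ / (a * Real.exp (-μ))) * e3 i := fun i => by
    rw [h.eq_vertical 1 (by simp)]; simp [verticalTrajectory]
  have g0 := fderiv_eq_zero_of_mem_tangentSpaceOf (hsub.norm_sq.sub ((hf 2).const_mul (2 * r)))
    (hev.mono fun x hx h => (hx h).1) hξ
  have g1 := fderiv_eq_zero_of_mem_tangentSpaceOf
    (((hs 0).mul ((hf 2).sub_const r)).sub ((hs 2).mul ((hf 0).sub_const (P 0))))
    (hev.mono fun x hx h => (hx h).2.1) hξ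
  have g2 := fderiv_eq_zero_of_mem_tangentSpaceOf
    (((hs 1).mul ((hf 2).sub_const r)).sub ((hs 2).mul ((hf 1).sub_const (P 1))))
    (hev.mono fun x hx h => (hx h).2.2) hξ
  simp [h.fst_one, h.foot, inner_eq_sum] at g0 g1 g2
  rw [hc2 0] at g1
  rw [hc2 1] at g2
  simp at g1 g2
  refine ⟨?_, by linarith, by linarith⟩
  have : r * ξ.1 2 = 0 := by linarith
  exact (mul_eq_zero.1 this).resolve_left hr.ne'

/-- Nondegeneracy of chords. -/
lemma eq_zero_of_linearized (hΓ : IsHyperbolicGroup Γ) (ha : IsHoroTorusLevel Γ a)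
    (h : IsVerticalChord Γ a P r μ c) (hc : IsTrajectory c) {ξ : ℝ → E3 × E3}
    (hξ : ∀ t ∈ Icc (0 : ℝ) 1,
      HasDerivWithinAt ξ (fderiv ℝ hamiltonianField (c t) (ξ t)) (Icc 0 1) t)
    (h0 : ξ 0 ∈ tangentSpaceOf (conormalLift Γ (horoTorus Γ a)) (c 0))
    (h1 : ξ 1 ∈ tangentSpaceOf (conormalLift Γ (horoTorus Γ a)) (c 1)) :
    ∀ t ∈ Icc (0 : ℝ) 1, ξ t = 0 := by
  obtain ⟨h0z, h00, h01⟩ := h.tangent_zero hΓ ha h0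
  obtain ⟨h1z, h10, h11⟩ := h.tangent_one h1
  have one_mem : (1 : ℝ) ∈ Icc (0 : ℝ) 1 := by simp
  have ha0 := h.height_pos
  have hp0 : ∀ t ∈ Icc (0 : ℝ) 1, (c t).2 0 = 0 := fun t ht => by
    rw [h.eq_vertical t ht]; simp [verticalTrajectory]
  have hp1 : ∀ t ∈ Icc (0 : ℝ) 1, (c t).2 1 = 0 := fun t ht => by
    rw [h.eq_vertical t ht]; simp [verticalTrajectory]
  have hp2 : (c 1).2 2 ≠ 0 := by
    rw [h.eq_vertical 1 one_mem]
    simp [verticalTrajectory, h.speed_pos.ne', ha0.ne']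
  have hf := fun t ht i => hasDerivWithinAt_fst_coord (hξ t ht) i
  have hs := fun t ht i => hasDerivWithinAt_snd_coord (hξ t ht) i
  simp only [fderiv_hamiltonianField_apply] at hf hs
  have hcd : ∀ t ∈ Icc (0 : ℝ) 1, HasDerivWithinAt c
      (((c t).1 2) ^ 2 • (c t).2, -(((c t).1 2 * ‖(c t).2‖ ^ 2) • e3)) (Icc 0 1) t := fun t ht => by
    rw [← hamiltonianField_eq]; exact hc.deriv t ht
  have hz := fun t ht => hasDerivWithinAt_fst_coord (hcd t ht) 2
  have hp := fun t ht => hasDerivWithinAt_snd_coord (hcd t ht) 2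
  have hπ0 := eq_of_hasDerivWithinAt_zero (f := fun t => (ξ t).2 0)
    (fun t ht => (hs t ht 0).congr_deriv (by simp))
  have hπ1 := eq_of_hasDerivWithinAt_zero (f := fun t => (ξ t).2 1)
    (fun t ht => (hs t ht 1).congr_deriv (by simp))
  simp only [h00, h01] at hπ0 hπ1
  have hχ0 := eq_of_hasDerivWithinAt_zero (f := fun t => (ξ t).1 0)
    (fun t ht => (hf t ht 0).congr_deriv (by simp [hp0 t ht, hπ0 t ht]))
  have hχ1 := eq_of_hasDerivWithinAt_zero (f := fun t => (ξ t).1 1)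
    (fun t ht => (hf t ht 1).congr_deriv (by simp [hp1 t ht, hπ1 t ht]))
  -- The horizontal momentum is zero and the horizontal displacement constant, so the lower
  -- condition reduces to `p_z δx = 0` and `p_z δy = 0`, with `p_z ≠ 0` because the speed is
  -- positive.
  rw [hπ0 1 one_mem, zero_mul, eq_comm, mul_eq_zero, hχ0 1 one_mem] at h10
  rw [hπ1 1 one_mem, zero_mul, eq_comm, mul_eq_zero, hχ1 1 one_mem] at h11
  have hχ00 := h10.resolve_left hp2
  have hχ10 := h11.resolve_left hp2
  -- The linearization of the conserved quantity `z p_z`.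
  have hk := eq_of_hasDerivWithinAt_zero
    (f := fun t => (c t).1 2 * (ξ t).2 2 + (c t).2 2 * (ξ t).1 2)
    (fun t ht => (((hz t ht).mul (hs t ht 2)).add ((hp t ht).mul (hf t ht 2))).congr_deriv (by
      simp [norm_sq_eq_sum, inner_eq_sum, hp0 t ht, hp1 t ht]
      ring))
  set k := (c 0).1 2 * (ξ 0).2 2 + (c 0).2 2 * (ξ 0).1 2 with hk_def
  -- Linearizing `z' / z = z p_z` gives `(δz / z)' = k`. As `δz` vanishes at both ends, `k = 0`.
  have hw := eq_of_hasDerivWithinAt_zero (f := fun t => (ξ t).1 2 / (c t).1 2 - k * t)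
    (fun t ht => by
      have hz0 : (c t).1 2 ≠ 0 := (mem_halfSpace.1 (hc.mem t ht)).ne'
      refine (((hf t ht 2).div (hz t ht) hz0).sub
        ((hasDerivWithinAt_id t _).const_mul k)).congr_deriv ?_
      simp only [← hk t ht]
      simp
      field_simp
      ring)
  simp only [h0z, zero_div, mul_zero, sub_zero] at hw
  have hk0 : k = 0 := by
    have := hw 1 one_mem
    simp [h1z] at this
    exact this
  intro t ht
  have hz0 : (c t).1 2 ≠ 0 := (mem_halfSpace.1 (hc.mem t ht)).ne'
  have hζ : (ξ t).1 2 = 0 := by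
    have := hw t ht
    rw [hk0, zero_mul, sub_zero, div_eq_zero_iff] at this
    exact this.resolve_right hz0
  have hπ2 : (ξ t).2 2 = 0 := by
    have := hk t ht
    rw [hk0, hζ, mul_zero, add_zero, mul_eq_zero] at this
    exact this.resolve_left hz0
  exact Prod.ext (ext_coords ((hχ0 t ht).trans hχ00) ((hχ1 t ht).trans hχ10) hζ)
    (ext_coords (hπ0 t ht) (hπ1 t ht) hπ2)

end IsVerticalChord

/-! ### Rigidity and nondegeneracy in the quotient -/

/-- After translating by an element of `Γ`, a chord starts at the level `a`. -/
lemma exists_cotLift_level {x : E3 × E3}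
    (hx : x ∈ conormalLift Γ (horoTorus Γ a)) : ∃ g ∈ Γ, (cotLift (permCoords g) x).1 2 = a :=
  (mem_preimageSet_horoTorus (conormalLift_fst_mem hx)).1 hx.1

lemma exists_ne_zero_of_cotCoords {γ : unitInterval → Cotangent Γ} {l : unitInterval → H3 × E3}
    (hl : ∀ t, cotProj Γ (l t) = γ t) (hne : ∃ t, γ t ≠ γ 0) :
    ∃ t ∈ Icc (0 : ℝ) 1, cotCoords l t ≠ cotCoords l 0 := by
  obtain ⟨t, ht⟩ := hne
  refine ⟨t, t.2, fun h => ht ?_⟩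
  rw [cotCoords_coe, cotCoords_zero] at h
  rw [← hl, ← hl, cotVal_injective h]

lemma chord_conormalLift (hΓ : IsHyperbolicGroup Γ) {T : Set (Mfd Γ)}
    {γ : unitInterval → Cotangent Γ} (h : IsHamiltonianChord Γ T γ) {l : unitInterval → H3 × E3}
    (hl : IsHamiltonianLift Γ γ l) :
    cotCoords l 0 ∈ conormalLift Γ T ∧ cotCoords l 1 ∈ conormalLift Γ T := by
  rw [cotCoords_zero, cotCoords_one, ← hΓ.cotProj_mem_conormal, ← hΓ.cotProj_mem_conormal, hl.1,
    hl.1]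
  exact h.2

theorem chordRigid (hΓ : IsHyperbolicGroup Γ) (ha : IsHoroTorusLevel Γ a)
    {γ : unitInterval → Cotangent Γ} (h : IsHamiltonianChord Γ (horoTorus Γ a) γ)
    (hne : ∃ t, γ t ≠ γ 0) : ChordRigid Γ (horoTorus Γ a) γ := by
  obtain ⟨l₀, hl₀⟩ := h.1
  obtain ⟨g, hg, hga⟩ := exists_cotLift_level (chord_conormalLift hΓ h hl₀).1
  set l : unitInterval → H3 × E3 := fun t => cotAct g (l₀ t) with hl_def
  have hl : IsHamiltonianLift Γ γ l := hΓ.cotAct_isHamiltonianLift hg hl₀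
  rw [← cotCoords_cotAct] at hga
  obtain ⟨hL0, hL1⟩ := chord_conormalLift hΓ h hl
  obtain ⟨P, r, μ, hv⟩ := hl.isTrajectory.isVerticalChord hΓ ha hga hL0 hL1
    (exists_ne_zero_of_cotCoords hl.1 hne)
  obtain ⟨W, hWsub, hWo, hW0⟩ := eventually_nhds_iff.1 (hv.eventually_eqOn hΓ ha)
  have hcont : Continuous cotVal := by unfold cotVal; fun_prop
  -- The covering map is open, so a neighbourhood upstairs projects to a neighbourhood of `γ 0`.
  refine ⟨cotProj Γ '' (cotVal ⁻¹' {x | x ∈ W}), hΓ.isOpen_cotProj_image (hWo.preimage hcont),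
    ⟨l 0, by rw [mem_preimage, ← cotCoords_zero]; exact hW0, hl.1 0⟩, ?_⟩
  rintro γ' hγ' ⟨w, hw, hw0⟩
  obtain ⟨l₁, hl₁⟩ := hγ'.1
  -- A deck transformation makes the lift of `γ'` start in `W` itself, where the rigidity statement
  -- upstairs applies.
  obtain ⟨g', hg', rfl⟩ := hΓ.cotProj_eq.1 ((hl₁.1 0).trans hw0.symm)
  have hl' := hΓ.cotAct_isHamiltonianLift hg' hl₁
  obtain ⟨hL0', hL1'⟩ := chord_conormalLift hΓ hγ' hl'
  have heq := hWsub _ hw (cotCoords fun t => cotAct g' (l₁ t)) hl'.isTrajectory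
    (cotCoords_zero _) hL0' hL1'
  funext t
  have := heq t.2
  rw [cotCoords_coe, cotCoords_coe] at this
  rw [← hl'.1, ← hl.1]
  exact congrArg _ (cotVal_injective this)

theorem chordNondegenerate (hΓ : IsHyperbolicGroup Γ) (ha : IsHoroTorusLevel Γ a)
    {γ : unitInterval → Cotangent Γ} (h : IsHamiltonianChord Γ (horoTorus Γ a) γ)
    (hne : ∃ t, γ t ≠ γ 0) : ChordNondegenerate Γ (horoTorus Γ a) γ := by
  intro l₀ hl₀ ξ hξ hξ0 hξ1
  obtain ⟨g, hg, hga⟩ := exists_cotLift_level (chord_conormalLift hΓ h hl₀).1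
  have hl := hΓ.cotAct_isHamiltonianLift hg hl₀
  rw [← cotCoords_cotAct] at hga
  obtain ⟨hL0, hL1⟩ := chord_conormalLift hΓ h hl
  obtain ⟨P, r, μ, hv⟩ := hl.isTrajectory.isVerticalChord hΓ ha hga hL0 hL1
    (exists_ne_zero_of_cotCoords hl.1 hne)
  have hg' := hΓ.isHypIsometry hg
  have hmem := hl₀.isTrajectory.mem
  have hT : ∀ t ∈ Icc (0 : ℝ) 1,
      ξ t ∈ tangentSpaceOf (conormalLift Γ (horoTorus Γ a)) (cotCoords l₀ t) →
      fderiv ℝ (cotLift (permCoords g)) (cotCoords l₀ t) (ξ t) ∈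
        tangentSpaceOf (conormalLift Γ (horoTorus Γ a))
          (cotCoords (fun t => cotAct g (l₀ t)) t) := by
    intro t ht hxt
    rw [cotCoords_cotAct]
    exact map_mem_tangentSpaceOf (hg'.contDiffAt_cotLift (hmem t ht))
      (Eventually.of_forall fun y hy => hΓ.cotLift_mem_conormalLift hg hy) hxt
  have hzero := hv.eq_zero_of_linearized hΓ ha hl.isTrajectory
    (ξ := fun t => fderiv ℝ (cotLift (permCoords g)) (cotCoords l₀ t) (ξ t)) ?_
    (hT 0 (by simp) hξ0) (hT 1 (by simp) hξ1)
  -- The transported field vanishes; applying the derivative of the inverse cotangent lift recovers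
  -- `ξ`.
  · intro t ht
    have hx := hmem t ht
    have hginv := hΓ.isHypIsometry (Γ.inv_mem hg)
    have hx' : (cotLift (permCoords g) (cotCoords l₀ t)).1 ∈ halfSpace := permCoords_mem g hx
    have hid : cotLift (permCoords g⁻¹) ∘ cotLift (permCoords g) =ᶠ[𝓝 (cotCoords l₀ t)] id := by
      filter_upwards [fst_mem_nhds hx] with y hy using hΓ.cotLift_inv hg hy
    have h1 := hid.fderiv_eq (𝕜 := ℝ)
    rw [fderiv_comp _ ((hginv.contDiffAt_cotLift hx').differentiableAt (by simp))
      ((hg'.contDiffAt_cotLift hx).differentiableAt (by simp)), fderiv_id] at h1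
    have h2 := DFunLike.congr_fun h1 (ξ t)
    rw [ContinuousLinearMap.comp_apply, hzero t ht, map_zero] at h2
    exact h2.symm
  · intro t ht
    rw [cotCoords_cotAct]
    refine hasDerivWithinAt_linearized (contDiff_hamiltonianField.differentiable (by simp))
      (hg'.contDiffAt_cotLift (hmem t ht)) ?_ (hl₀.2 t ht) (hξ t ht)
    filter_upwards [fst_mem_nhds (hmem t ht)] with y hy using hg'.equivariant y hy

end HoroTorus

namespace HoroTorus

/-! ### Lifts and energy -/

variable {Γ : Subgroup (Equiv.Perm H3)}

lemma ext_coe {E : Type*} (f : unitInterval → E) (t : unitInterval) : ext f t = f t := by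
  simp [ext]

lemma ext_of_mem {E : Type*} (f : unitInterval → E) {t : ℝ} (ht : t ∈ Icc (0 : ℝ) 1) :
    ext f t = f ⟨t, ht⟩ := ext_coe f ⟨t, ht⟩

lemma coords_coe (l : unitInterval → H3) (t : unitInterval) : coords l t = l t := ext_coe _ t

lemma coords_mem (l : unitInterval → H3) (t : ℝ) : coords l t ∈ halfSpace :=
  (l (projIcc 0 1 zero_le_one t)).2

lemma coords_perm (g : Equiv.Perm H3) (l : unitInterval → H3) (t : ℝ) :
    coords (fun t => g (l t)) t = permCoords g (coords l t) :=
  (permCoords_coe g (l (projIcc 0 1 zero_le_one t))).symm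

lemma continuous_of_coords {l : unitInterval → H3} (h : ContinuousOn (coords l) (Icc 0 1)) :
    Continuous l := by
  rw [continuous_induced_rng]
  have := h.comp_continuous continuous_subtype_val (fun t : unitInterval => t.2)
  exact this.congr (coords_coe l)

/-- Lifts of a path are unique up to the action of the group. -/
lemma exists_perm_eq_of_lifts (hΓ : IsHyperbolicGroup Γ) {l l' : unitInterval → H3}
    (hl : Continuous l) (hl' : Continuous l') (h : ∀ t, proj Γ (l t) = proj Γ (l' t)) :
    ∃ g ∈ Γ, ∀ t, g (l t) = l' t := by
  have := hΓ.properlyDiscontinuous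
  have hfin : Set.Finite {g : Γ | ((g • ·) '' range l ∩ range l').Nonempty} :=
    ProperlyDiscontinuousSMul.finite_disjoint_inter_image (isCompact_range hl)
      (isCompact_range hl')
  set A : Γ → Set unitInterval := fun g => {t | (g : Equiv.Perm H3) (l t) = l' t} with hA
  have hclosed : ∀ g, IsClosed (A g) := fun g =>
    isClosed_eq ((hΓ.continuous g.2).comp hl) hl'
  have hmem : ∀ g t, t ∈ A g → g ∈ {g : Γ | ((g • ·) '' range l ∩ range l').Nonempty} :=
    fun g t ht => ⟨l' t, ⟨l t, mem_range_self t, ht⟩, mem_range_self t⟩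
  obtain ⟨g₀, hg₀, h0⟩ := proj_eq_proj.1 (h 0)
  -- The agreement sets are closed, pairwise disjoint by freeness, and all but finitely many are
  -- empty. Each is therefore clopen in the connected interval.
  have hcompl : (A ⟨g₀, hg₀⟩)ᶜ =
      ⋃ g ∈ {g : Γ | ((g • ·) '' range l ∩ range l').Nonempty} \ {⟨g₀, hg₀⟩}, A g := by
    ext t
    simp only [mem_compl_iff, mem_iUnion, exists_prop]
    constructor
    · intro ht
      obtain ⟨g, hg, hgt⟩ := proj_eq_proj.1 (h t)
      refine ⟨⟨g, hg⟩, ⟨hmem ⟨g, hg⟩ t hgt, ?_⟩, hgt⟩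
      intro hgg
      rw [mem_singleton_iff] at hgg
      exact ht (hgg ▸ hgt)
    · rintro ⟨g, ⟨-, hne⟩, hgt⟩ hgt'
      apply hne
      have h1 : (g₀⁻¹ * g : Equiv.Perm H3) (l t) = l t := by
        rw [Equiv.Perm.mul_apply, show (g : Equiv.Perm H3) (l t) = l' t from hgt,
          ← show g₀ (l t) = l' t from hgt', Equiv.Perm.inv_def, Equiv.symm_apply_apply]
      have h2 := hΓ.free _ (Γ.mul_mem (Γ.inv_mem hg₀) g.2) _ h1
      exact Subtype.ext (inv_mul_eq_one.1 h2).symm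
  have hopen : IsOpen (A ⟨g₀, hg₀⟩) := by
    rw [← isClosed_compl_iff, hcompl]
    exact (hfin.subset sdiff_subset).isClosed_biUnion fun g _ => hclosed g
  have huniv := IsClopen.eq_univ ⟨hclosed ⟨g₀, hg₀⟩, hopen⟩ ⟨0, h0⟩
  exact ⟨g₀, hg₀, fun t => (huniv ▸ mem_univ t : t ∈ A ⟨g₀, hg₀⟩)⟩

lemma IsLift.exists_perm_eq (hΓ : IsHyperbolicGroup Γ) {c : unitInterval → Mfd Γ}
    {l l' : unitInterval → H3} (h : IsLift Γ c l) (h' : IsLift Γ c l') :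
    ∃ g ∈ Γ, l' = fun t => g (l t) := by
  obtain ⟨g, hg, hgl⟩ := exists_perm_eq_of_lifts hΓ (continuous_of_coords h.smooth.continuousOn)
    (continuous_of_coords h'.smooth.continuousOn) fun t => (h.proj_eq t).trans (h'.proj_eq t).symm
  exact ⟨g, hg, funext fun t => (hgl t).symm⟩

lemma hasDerivWithinAt_vel {f : ℝ → E3} (hf : ContDiffOn ℝ ∞ f (Icc 0 1)) {t : ℝ}
    (ht : t ∈ Icc (0 : ℝ) 1) : HasDerivWithinAt f (vel f t) (Icc 0 1) t :=
  (hf.differentiableOn (by simp) t ht).hasDerivWithinAt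

lemma contDiffOn_vel {f : ℝ → E3} (hf : ContDiffOn ℝ ∞ f (Icc 0 1)) :
    ContDiffOn ℝ ∞ (vel f) (Icc 0 1) :=
  hf.derivWithin (uniqueDiffOn_Icc zero_lt_one) (by simp)

lemma vel_eq_of_hasDerivWithinAt {f : ℝ → E3} {f' : E3} {t : ℝ} (ht : t ∈ Icc (0 : ℝ) 1)
    (h : HasDerivWithinAt f f' (Icc 0 1) t) : vel f t = f' :=
  h.derivWithin (uniqueDiffOn_Icc zero_lt_one t ht)

lemma energyH3_perm (hΓ : IsHyperbolicGroup Γ) {g : Equiv.Perm H3} (hg : g ∈ Γ)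
    {l : unitInterval → H3} (hl : ContDiffOn ℝ ∞ (coords l) (Icc 0 1)) :
    energyH3 (fun t => g (l t)) = energyH3 l := by
  unfold energyH3
  congr 1
  refine intervalIntegral.integral_congr fun t ht => ?_
  rw [uIcc_of_le zero_le_one] at ht
  have hiso := hΓ.isHypIsometry hg
  have hm := coords_mem l t
  have h1 : vel (coords fun t => g (l t)) t =
      fderiv ℝ (permCoords g) (coords l t) (vel (coords l) t) := by
    refine vel_eq_of_hasDerivWithinAt ht ?_
    rw [show coords (fun t => g (l t)) = permCoords g ∘ coords l from funext (coords_perm g l)]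
    exact (hiso.differentiableAt hm).hasFDerivAt.comp_hasDerivWithinAt t
      (hasDerivWithinAt_vel hl ht)
  have h3 : permCoords g (coords l t) 2 ≠ 0 := (mem_halfSpace.1 (permCoords_mem g hm)).ne'
  simp only [hInner, h1, coords_perm]
  rw [hiso.conformal _ hm]
  field_simp

lemma IsLift.energy_eq (hΓ : IsHyperbolicGroup Γ) {c : unitInterval → Mfd Γ}
    {l : unitInterval → H3} (h : IsLift Γ c l) : energy Γ c = energyH3 l := by
  have hex : ∃ l, IsLift Γ c l := ⟨l, h⟩
  rw [energy, dif_pos hex]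
  obtain ⟨g, hg, he⟩ := h.exists_perm_eq hΓ hex.choose_spec
  rw [he, energyH3_perm hΓ hg h.smooth]

/-! ### Geodesic cords are vertical chords -/

/-- A path with its momentum `(l, l' / z²)`. -/
def phaseCurve (l : unitInterval → H3) (t : ℝ) : E3 × E3 :=
  (coords l t, ((coords l t 2) ^ 2)⁻¹ • vel (coords l) t)

/-- The Legendre transform `p = l' / z²` turns the geodesic equation with these Christoffel symbols
into Hamilton's equations. -/
lemma isTrajectory_phaseCurve {l : unitInterval → H3} (hl : ContDiffOn ℝ ∞ (coords l) (Icc 0 1))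
    (hgeo : ∀ t ∈ Icc (0 : ℝ) 1, vel (vel (coords l)) t
      + christoffel (coords l t) (vel (coords l) t) (vel (coords l) t) = 0) :
    IsTrajectory (phaseCurve l) := by
  refine ⟨fun t _ => coords_mem l t, fun t ht => ?_⟩
  have hz : coords l t 2 ≠ 0 := (mem_halfSpace.1 (coords_mem l t)).ne'
  have h1 := hasDerivWithinAt_vel hl ht
  have h2 := hasDerivWithinAt_vel (contDiffOn_vel hl) ht
  have h3 : HasDerivWithinAt (fun t => coords l t 2) (vel (coords l) t 2) (Icc 0 1) t :=
    (hasFDerivAt_coord 2 _).comp_hasDerivWithinAt t h1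
  have h4 := h1.prodMk (((h3.pow 2).inv (pow_ne_zero 2 hz)).smul h2)
  refine HasDerivWithinAt.congr_deriv h4 ?_
  rw [eq_neg_of_add_eq_zero_left (hgeo t ht), hamiltonianField_eq]
  simp only [phaseCurve, Pi.inv_apply, Pi.pow_apply]
  generalize vel (coords l) t = v
  generalize coords l t = q at *
  refine Prod.ext ?_ ?_
  · simp [smul_smul, hz]
  · rw [norm_smul, mul_pow, norm_sq_eq_sum]
    refine ext_coords ?_ ?_ ?_
    · simp [christoffel]
      field_simp
      ring
    · simp [christoffel]
      field_simp
      ring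
    · simp [christoffel]
      field_simp
      ring

/-- Perpendicularity to the torus says that the momentum is conormal, so the classification of
Hamiltonian chords applies to cords. -/
lemma IsGeodesicCord.exists_vertical (hΓ : IsHyperbolicGroup Γ) {a : ℝ}
    (ha : IsHoroTorusLevel Γ a) {c : unitInterval → Mfd Γ}
    (hc : IsGeodesicCord Γ (horoTorus Γ a) c) (hne : ∃ t, c t ≠ c 0) {l : unitInterval → H3}
    (hl : IsLift Γ c l) : ∃ g ∈ Γ, ∃ P r μ, ∃ c', IsVerticalChord Γ a P r μ c' ∧
      ∀ t : ℝ, t ∈ Icc (0 : ℝ) 1 →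
        coords (fun t => g (l t)) t = P + (a * Real.exp (-(μ * t))) • e3 := by
  obtain ⟨l₀, hl₀, hgeo, hc0, hc1, hp0, hp1⟩ := hc
  have htraj := isTrajectory_phaseCurve hl₀.smooth hgeo
  have hi0 : coords l₀ 0 = l₀ 0 := coords_coe l₀ 0
  have hi1 : coords l₀ 1 = l₀ 1 := coords_coe l₀ 1
  have hL0 : phaseCurve l₀ 0 ∈ conormalLift Γ (horoTorus Γ a) := by
    refine ⟨?_, fun v hv => ?_⟩
    · rw [phaseCurve, hi0, mem_preimageSet_coe, hl₀.proj_eq]; exact hc0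
    · simp only [phaseCurve, hi0] at hv ⊢
      have := hp0 v hv
      rw [hInner, div_eq_inv_mul] at this
      rw [inner_smul_left]
      exact this
  have hL1 : phaseCurve l₀ 1 ∈ conormalLift Γ (horoTorus Γ a) := by
    refine ⟨?_, fun v hv => ?_⟩
    · rw [phaseCurve, hi1, mem_preimageSet_coe, hl₀.proj_eq]; exact hc1
    · simp only [phaseCurve, hi1] at hv ⊢
      have := hp1 v hv
      rw [hInner, div_eq_inv_mul] at this
      rw [inner_smul_left]
      exact this
  obtain ⟨g, hg, hga⟩ := exists_cotLift_level hL0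
  have htraj' := hΓ.cotLift_comp_isTrajectory hg htraj
  obtain ⟨P, r, μ, hv⟩ := htraj'.isVerticalChord hΓ ha hga (hΓ.cotLift_mem_conormalLift hg hL0)
    (hΓ.cotLift_mem_conormalLift hg hL1) (by
      obtain ⟨t, ht⟩ := hne
      refine ⟨t, t.2, fun h => ht ?_⟩
      have h1 := congrArg (permCoords g⁻¹) (congrArg Prod.fst h)
      simp only [cotLift, phaseCurve, permCoords_inv_apply] at h1
      rw [coords_coe, hi0] at h1
      rw [← hl₀.proj_eq, ← hl₀.proj_eq, Subtype.ext h1])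
  -- The cord hypothesis comes with a lift of its own; the prescribed lift differs from it by a deck
  -- transformation.
  obtain ⟨g₁, hg₁, rfl⟩ := hl.exists_perm_eq hΓ hl₀
  refine ⟨g * g₁, Γ.mul_mem hg hg₁, P, r, μ, _, hv, fun t ht => ?_⟩
  have h1 := congrArg Prod.fst (hv.eq_vertical t ht)
  simp only [cotLift, phaseCurve, coords_perm] at h1
  rw [coords_perm, permCoords_mul, Function.comp, h1]
  refine ext_coords ?_ ?_ ?_ <;> simp [verticalTrajectory, hv.foot]

/-! ### Transport of variations -/

lemma IsVariation.perm (hΓ : IsHyperbolicGroup Γ) {T : Set (Mfd Γ)} {g : Equiv.Perm H3}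
    (hg : g ∈ Γ) {l : unitInterval → H3} {V : unitInterval → E3} {C : ℝ → unitInterval → Mfd Γ}
    (h : IsVariation Γ T l V C) : IsVariation Γ T (fun t => g (l t))
      (fun t => fderiv ℝ (permCoords g) (l t) (V t)) C := by
  obtain ⟨ε, hε, L, hL, hC, hL0, hV⟩ := h
  have hiso := hΓ.isHypIsometry hg
  refine ⟨ε, hε, fun s t => g (L s t), ?_, ?_, ?_, ?_⟩
  · exact (hiso.contDiffOn.comp hL fun x _ => coords_mem (L x.1) x.2).congr
      fun x _ => coords_perm g (L x.1) x.2
  · refine fun s hs => ⟨fun t => ?_, (hC s hs).2⟩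
    rw [← (hC s hs).1 t]
    exact (proj_eq_proj.2 ⟨g, hg, rfl⟩).symm
  · simp only [hL0]
  · intro t
    have h0 : (0 : ℝ) ∈ Ioo (-ε) ε := by simp [hε]
    have hd : DifferentiableAt ℝ (fun s => (L s t : E3)) 0 := by
      have h1 : ContDiffOn ℝ ∞ (fun s => coords (L s) t) (Ioo (-ε) ε) :=
        hL.comp (f := fun s : ℝ => (s, (t : ℝ))) (by fun_prop) fun s hs => ⟨hs, t.2⟩
      simp only [coords_coe] at h1
      exact (h1.contDiffAt (Ioo_mem_nhds h0.1 h0.2)).differentiableAt (by simp)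
    have h2 : DifferentiableAt ℝ (permCoords g) (L 0 t) := hiso.differentiableAt (L 0 t).2
    have h3 := h2.hasFDerivAt.comp_hasDerivAt (0 : ℝ) hd.hasDerivAt
    simp only [← hV t, ← hL0]
    rw [← h3.deriv]
    congr 1
    funext s
    exact (permCoords_coe g (L s t)).symm

lemma contDiffOn_pushField (hΓ : IsHyperbolicGroup Γ) {g : Equiv.Perm H3} (hg : g ∈ Γ)
    {l : unitInterval → H3} (hl : ContDiffOn ℝ ∞ (coords l) (Icc 0 1)) {V : unitInterval → E3}
    (hV : ContDiffOn ℝ ∞ (ext V) (Icc 0 1)) :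
    ContDiffOn ℝ ∞ (ext fun t => fderiv ℝ (permCoords g) (l t) (V t)) (Icc 0 1) := by
  have hiso := hΓ.isHypIsometry hg
  have h1 : ContDiffOn ℝ ∞ (fderiv ℝ (permCoords g)) halfSpace :=
    hiso.contDiffOn.fderiv_of_isOpen isOpen_halfSpace (by simp)
  exact (h1.comp hl fun t _ => coords_mem l t).clm_apply hV

/-- The action of an isometry on vector fields along paths. -/
def pushField (hΓ : IsHyperbolicGroup Γ) (T : Set (Mfd Γ)) {g : Equiv.Perm H3} (hg : g ∈ Γ)
    {l : unitInterval → H3} (hl : ContDiffOn ℝ ∞ (coords l) (Icc 0 1)) :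
    pathTangent Γ T l →ₗ[ℝ] pathTangent Γ T (fun t => g (l t)) where
  toFun V := ⟨fun t => fderiv ℝ (permCoords g) (l t) (V.1 t),
    contDiffOn_pushField hΓ hg hl V.2.1,
    by rw [← permCoords_coe]; exact hΓ.fderiv_mem_tangentSpaceOf hg (l 0).2 V.2.2.1,
    by rw [← permCoords_coe]; exact hΓ.fderiv_mem_tangentSpaceOf hg (l 1).2 V.2.2.2⟩
  map_add' V W := by
    apply Subtype.ext
    funext t
    exact map_add (fderiv ℝ (permCoords g) (l t)) _ _
  map_smul' r V := by
    apply Subtype.ext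
    funext t
    exact map_smul (fderiv ℝ (permCoords g) (l t)) _ _

lemma pushField_injective (hΓ : IsHyperbolicGroup Γ) (T : Set (Mfd Γ)) {g : Equiv.Perm H3}
    (hg : g ∈ Γ) {l : unitInterval → H3} (hl : ContDiffOn ℝ ∞ (coords l) (Icc 0 1)) :
    Function.Injective (pushField hΓ T hg hl) := by
  intro V W h
  apply Subtype.ext
  funext t
  have h1 := congrFun (congrArg Subtype.val h) t
  have h2 := congrArg (fderiv ℝ (permCoords g⁻¹) (permCoords g (l t))) h1
  simp only [pushField, LinearMap.coe_mk, AddHom.coe_mk] at h2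
  rwa [hΓ.fderiv_inv_apply hg (l t).2, hΓ.fderiv_inv_apply hg (l t).2] at h2

/-- Variations and their energies live in `N`, so the same `C` serves both lifts; only the
coordinates of the field change. -/
lemma IsSecondVariation.pullback (hΓ : IsHyperbolicGroup Γ) {T : Set (Mfd Γ)}
    {g : Equiv.Perm H3} (hg : g ∈ Γ) {l : unitInterval → H3}
    (hl : ContDiffOn ℝ ∞ (coords l) (Icc 0 1))
    {B : LinearMap.BilinForm ℝ (pathTangent Γ T fun t => g (l t))}
    (hB : IsSecondVariation Γ T (fun t => g (l t)) B) :
    IsSecondVariation Γ T l (B.compl₁₂ (pushField hΓ T hg hl) (pushField hΓ T hg hl)) where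
  symm V W := hB.symm _ _
  exists_variation V := by
    obtain ⟨C, hC⟩ := hB.exists_variation (pushField hΓ T hg hl V)
    refine ⟨C, ?_⟩
    have := hC.perm hΓ (Γ.inv_mem hg)
    convert this using 1
    · funext t; simp
    · funext t
      simp only [pushField, LinearMap.coe_mk, AddHom.coe_mk]
      rw [← permCoords_coe g, hΓ.fderiv_inv_apply hg (l t).2]
  second_deriv V C hC := hB.second_deriv (pushField hΓ T hg hl V) C (hC.perm hΓ hg)

/-! ### Index and nullity of positive definite forms -/

lemma morseIndex_eq_zero {M : Type*} [AddCommGroup M] [Module ℝ M] {B : LinearMap.BilinForm ℝ M}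
    (hB : ∀ v, v ≠ 0 → 0 < B v v) : morseIndex B = 0 := by
  refine le_antisymm (iSup_le fun W => ?_) zero_le
  have : W.1 = ⊥ := by
    rw [Submodule.eq_bot_iff]
    intro v hv
    by_contra hne
    exact lt_asymm (hB v hne) (W.2 v hv hne)
  rw [this]
  simp

lemma nullity_eq_zero {M : Type*} [AddCommGroup M] [Module ℝ M] {B : LinearMap.BilinForm ℝ M}
    (hB : ∀ v, v ≠ 0 → 0 < B v v) : nullity B = 0 := by
  have : LinearMap.ker B = ⊥ := by
    rw [Submodule.eq_bot_iff]
    intro v hv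
    by_contra hne
    have := hB v hne
    rw [LinearMap.mem_ker.1 hv] at this
    simp at this
  rw [nullity, this]
  simp

end HoroTorus

namespace HoroTorus

/-! ### Calculus on a strip -/

/-- The domain of a variation. -/
def strip (ε : ℝ) : Set (ℝ × ℝ) := Ioo (-ε) ε ×ˢ Icc 0 1

/-- The partial derivative in the direction of the variation parameter. -/
def pds (ε : ℝ) (f : ℝ × ℝ → ℝ) (x : ℝ × ℝ) : ℝ := fderivWithin ℝ f (strip ε) x (1, 0)

/-- The partial derivative in the direction of the time parameter. -/
def pdt (ε : ℝ) (f : ℝ × ℝ → ℝ) (x : ℝ × ℝ) : ℝ := fderivWithin ℝ f (strip ε) x (0, 1)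

section Strip

variable {ε : ℝ} {f g : ℝ × ℝ → ℝ}

lemma uniqueDiffOn_strip : UniqueDiffOn ℝ (strip ε) :=
  isOpen_Ioo.uniqueDiffOn.prod (uniqueDiffOn_Icc zero_lt_one)

lemma strip_subset_closure : strip ε ⊆ closure (interior (strip ε)) := by
  rw [strip, interior_prod_eq, closure_prod_eq, interior_Icc, isOpen_Ioo.interior_eq,
    closure_Ioo zero_ne_one]
  exact prod_mono subset_closure le_rfl

lemma contDiffOn_fderivWithin_apply (hf : ContDiffOn ℝ ∞ f (strip ε)) (v : ℝ × ℝ) :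
    ContDiffOn ℝ ∞ (fun x => fderivWithin ℝ f (strip ε) x v) (strip ε) :=
  (hf.fderivWithin uniqueDiffOn_strip (by simp)).clm_apply contDiffOn_const

lemma contDiffOn_pds (hf : ContDiffOn ℝ ∞ f (strip ε)) : ContDiffOn ℝ ∞ (pds ε f) (strip ε) :=
  contDiffOn_fderivWithin_apply hf _

lemma contDiffOn_pdt (hf : ContDiffOn ℝ ∞ f (strip ε)) : ContDiffOn ℝ ∞ (pdt ε f) (strip ε) :=
  contDiffOn_fderivWithin_apply hf _

lemma hasDerivAt_pds (hf : ContDiffOn ℝ ∞ f (strip ε)) {s t : ℝ} (hs : s ∈ Ioo (-ε) ε)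
    (ht : t ∈ Icc (0 : ℝ) 1) : HasDerivAt (fun s => f (s, t)) (pds ε f (s, t)) s := by
  have h1 := (hf.differentiableOn (by simp) (s, t) ⟨hs, ht⟩).hasFDerivWithinAt
  have h2 : HasDerivWithinAt (fun s : ℝ => (s, t)) (1, 0) (Ioo (-ε) ε) s :=
    (hasDerivWithinAt_id s _).prodMk (hasDerivWithinAt_const s _ t)
  have h3 : MapsTo (fun s : ℝ => (s, t)) (Ioo (-ε) ε) (strip ε) := fun s hs => ⟨hs, ht⟩
  exact (h1.comp_hasDerivWithinAt s h2 h3).hasDerivAt (Ioo_mem_nhds hs.1 hs.2)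

lemma hasDerivWithinAt_pdt (hf : ContDiffOn ℝ ∞ f (strip ε)) {s t : ℝ} (hs : s ∈ Ioo (-ε) ε)
    (ht : t ∈ Icc (0 : ℝ) 1) :
    HasDerivWithinAt (fun t => f (s, t)) (pdt ε f (s, t)) (Icc 0 1) t := by
  have h1 := (hf.differentiableOn (by simp) (s, t) ⟨hs, ht⟩).hasFDerivWithinAt
  have h2 : HasDerivWithinAt (fun t : ℝ => (s, t)) (0, 1) (Icc 0 1) t :=
    (hasDerivWithinAt_const t _ s).prodMk (hasDerivWithinAt_id t _)
  exact h1.comp_hasDerivWithinAt t h2 fun t ht => ⟨hs, ht⟩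

lemma pds_congr (h : EqOn f g (strip ε)) : EqOn (pds ε f) (pds ε g) (strip ε) := fun x hx => by
  rw [pds, pds, fderivWithin_congr h (h hx)]

lemma fderivWithin_fderivWithin_apply (hf : ContDiffOn ℝ ∞ f (strip ε)) {x : ℝ × ℝ}
    (hx : x ∈ strip ε) (v w : ℝ × ℝ) :
    fderivWithin ℝ (fun y => fderivWithin ℝ f (strip ε) y v) (strip ε) x w =
      fderivWithin ℝ (fderivWithin ℝ f (strip ε)) (strip ε) x w v := by
  have h1 : DifferentiableWithinAt ℝ (fderivWithin ℝ f (strip ε)) (strip ε) x :=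
    (hf.fderivWithin (m := ∞) uniqueDiffOn_strip (by simp)).differentiableOn (by simp) x hx
  have h2 := (h1.hasFDerivWithinAt.clm_apply
    (hasFDerivWithinAt_const v x (strip ε))).fderivWithin (uniqueDiffOn_strip x hx)
  rw [h2]
  simp

/-- Symmetry of second derivatives extends to the edges `t = 0, 1` because the strip lies in the
closure of its interior. -/
lemma pds_pdt_comm (hf : ContDiffOn ℝ ∞ f (strip ε)) :
    EqOn (pds ε (pdt ε f)) (pdt ε (pds ε f)) (strip ε) := fun x hx => by
  have hsymm : IsSymmSndFDerivWithinAt ℝ f (strip ε) x :=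
    (hf x hx).isSymmSndFDerivWithinAt (by simpa using WithTop.coe_le_coe.2 (le_top : (2 : ℕ∞) ≤ ⊤))
      uniqueDiffOn_strip (strip_subset_closure hx) hx
  have h1 := fderivWithin_fderivWithin_apply hf hx (0, 1) (1, 0)
  have h2 := fderivWithin_fderivWithin_apply hf hx (1, 0) (0, 1)
  exact h1.trans ((hsymm _ _).trans h2.symm)

lemma continuousOn_slice (hf : ContinuousOn f (strip ε)) {s : ℝ} (hs : s ∈ Ioo (-ε) ε) :
    ContinuousOn (fun t => f (s, t)) (Icc 0 1) :=
  hf.comp (by fun_prop) fun t ht => ⟨hs, ht⟩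

/-- Differentiation under the integral sign. -/
lemma hasDerivAt_integral_strip (hf : ContDiffOn ℝ ∞ f (strip ε)) {s : ℝ} (hs : s ∈ Ioo (-ε) ε) :
    HasDerivAt (fun s => ∫ t in (0 : ℝ)..1, f (s, t)) (∫ t in (0 : ℝ)..1, pds ε f (s, t)) s := by
  have hcont := (contDiffOn_pds hf).continuousOn
  obtain ⟨δ, hδ, hsub⟩ := Metric.nhds_basis_closedBall.mem_iff.1 (Ioo_mem_nhds hs.1 hs.2)
  have hcomp : IsCompact (Metric.closedBall s δ ×ˢ Icc (0 : ℝ) 1) :=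
    (isCompact_closedBall s δ).prod isCompact_Icc
  obtain ⟨M, hM⟩ := hcomp.exists_bound_of_continuousOn (hcont.mono (prod_mono hsub le_rfl))
  have hmeas : ∀ {g : ℝ × ℝ → ℝ}, ContinuousOn g (strip ε) → ∀ s ∈ Ioo (-ε) ε,
      IntervalIntegrable (fun t => g (s, t)) MeasureTheory.volume 0 1 := fun hg s hs =>
    (continuousOn_slice hg hs).intervalIntegrable_of_Icc zero_le_one
  refine (intervalIntegral.hasDerivAt_integral_of_dominated_loc_of_deriv_le
    (F := fun s t => f (s, t)) (F' := fun s t => pds ε f (s, t)) (bound := fun _ => M)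
    (Metric.closedBall_mem_nhds s hδ) ?_ (hmeas hf.continuousOn s hs)
    (hmeas hcont s hs).def'.aestronglyMeasurable ?_ intervalIntegrable_const ?_).2
  · filter_upwards [Ioo_mem_nhds hs.1 hs.2] with s' hs'
    exact (hmeas hf.continuousOn s' hs').def'.aestronglyMeasurable
  · refine Eventually.of_forall fun t ht s' hs' => hM (s', t) ⟨hs', ?_⟩
    rw [uIoc_of_le zero_le_one] at ht
    exact Ioc_subset_Icc_self ht
  · refine Eventually.of_forall fun t ht s' hs' => hasDerivAt_pds hf (hsub hs') ?_
    rw [uIoc_of_le zero_le_one] at ht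
    exact Ioc_subset_Icc_self ht

end Strip

/-- The second derivative of a kinetic energy density at a vertical velocity. -/
lemma deriv_deriv_kinetic {A A' : Fin 3 → ℝ → ℝ} {A'' : Fin 3 → ℝ} {Z Z' F F' : ℝ → ℝ}
    {Z'' F'' μ : ℝ} (hA : ∀ i, ∀ᶠ s in 𝓝 0, HasDerivAt (A i) (A' i s) s)
    (hA' : ∀ i, HasDerivAt (A' i) (A'' i) 0) (hZ : ∀ᶠ s in 𝓝 0, HasDerivAt Z (Z' s) s)
    (hZ' : HasDerivAt Z' Z'' 0) (hZ0 : ∀ᶠ s in 𝓝 0, Z s ≠ 0)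
    (hF : ∀ᶠ s in 𝓝 0, F s = 1 / 2 * ((A 0 s ^ 2 + A 1 s ^ 2 + A 2 s ^ 2) / Z s ^ 2))
    (hF' : ∀ᶠ s in 𝓝 0, HasDerivAt F (F' s) s) (hF'' : HasDerivAt F' F'' 0)
    (h0 : A 0 0 = 0) (h1 : A 1 0 = 0) (h2 : A 2 0 = -(μ * Z 0)) :
    F'' = (A' 0 0 ^ 2 + A' 1 0 ^ 2 + A' 2 0 ^ 2 + 4 * μ * A' 2 0 * Z' 0 + 3 * μ ^ 2 * Z' 0 ^ 2)
      / Z 0 ^ 2 - μ * A'' 2 / Z 0 - μ ^ 2 * Z'' / Z 0 := by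
  -- The first derivative is needed on a whole neighbourhood of `0`, so that it can be
  -- differentiated again.
  have e1 : ∀ᶠ s in 𝓝 0, F' s = (A 0 s * A' 0 s + A 1 s * A' 1 s + A 2 s * A' 2 s) / Z s ^ 2
      - (A 0 s ^ 2 + A 1 s ^ 2 + A 2 s ^ 2) * Z' s / Z s ^ 3 := by
    filter_upwards [hA 0, hA 1, hA 2, hZ, hZ0, hF', hF.eventually_nhds] with s a0 a1 a2 z z0 f f0
    have hd := ((((a0.pow 2).add (a1.pow 2)).add (a2.pow 2)).div (z.pow 2)
      (pow_ne_zero 2 z0)).const_mul (1 / 2)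
    have := f.unique (hd.congr_of_eventuallyEq f0)
    rw [this]
    simp
    field_simp
  have z0 := hZ0.self_of_nhds
  have a0 := (hA 0).self_of_nhds
  have a1 := (hA 1).self_of_nhds
  have a2 := (hA 2).self_of_nhds
  have z := hZ.self_of_nhds
  have hd := (((((a0.mul (hA' 0)).add (a1.mul (hA' 1))).add (a2.mul (hA' 2))).div (z.pow 2)
      (pow_ne_zero 2 z0))).sub (((((a0.pow 2).add (a1.pow 2)).add (a2.pow 2)).mul hZ').div (z.pow 3)
      (pow_ne_zero 3 z0))
  rw [hF''.unique (hd.congr_of_eventuallyEq e1)]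
  simp [h0, h1, h2]
  field_simp
  ring

end HoroTorus

namespace HoroTorus

/-! ### The index form of a vertical chord -/

variable {Γ : Subgroup (Equiv.Perm H3)} {a : ℝ}

/-- The expression `V' + μ V_z e_z`, which is the covariant derivative of `V` along the vertical
geodesic of speed `μ` up to a total derivative. -/
def drift (μ : ℝ) (V : unitInterval → E3) (t : ℝ) : E3 := vel (ext V) t + (μ * ext V t 2) • e3

/-- The integrand of the index form. -/
def indexDensity (a μ : ℝ) (V W : unitInterval → E3) (t : ℝ) : ℝ :=
  ⟪drift μ V t, drift μ W t⟫_ℝ / (a * Real.exp (-(μ * t))) ^ 2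

/-- The second variation of the energy at a vertical chord of speed `μ` starting at height `a`. -/
def indexForm (a μ : ℝ) (V W : unitInterval → E3) : ℝ :=
  (∫ t in (0 : ℝ)..1, indexDensity a μ V W t) +
    2 * μ * (V 1 0 * W 1 0 + V 1 1 * W 1 1) / (a * Real.exp (-μ)) ^ 2

lemma continuousOn_drift {μ : ℝ} {V : unitInterval → E3}
    (hV : ContDiffOn ℝ ∞ (ext V) (Icc 0 1)) : ContinuousOn (drift μ V) (Icc 0 1) := by
  have h1 := (contDiffOn_vel hV).continuousOn
  have h2 : ContinuousOn (fun t => ext V t 2) (Icc 0 1) :=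
    (EuclideanSpace.proj 2 : E3 →L[ℝ] ℝ).continuous.comp_continuousOn hV.continuousOn
  exact h1.add ((continuousOn_const.mul h2).smul continuousOn_const)

lemma continuousOn_indexDensity {μ : ℝ} (ha : 0 < a) {V W : unitInterval → E3}
    (hV : ContDiffOn ℝ ∞ (ext V) (Icc 0 1)) (hW : ContDiffOn ℝ ∞ (ext W) (Icc 0 1)) :
    ContinuousOn (indexDensity a μ V W) (Icc 0 1) :=
  ((continuousOn_drift hV).inner (𝕜 := ℝ) (continuousOn_drift hW)).div (by fun_prop)
    fun t _ => by positivity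

lemma intervalIntegrable_indexDensity {μ : ℝ} (ha : 0 < a) {V W : unitInterval → E3}
    (hV : ContDiffOn ℝ ∞ (ext V) (Icc 0 1)) (hW : ContDiffOn ℝ ∞ (ext W) (Icc 0 1)) :
    IntervalIntegrable (indexDensity a μ V W) MeasureTheory.volume 0 1 :=
  (continuousOn_indexDensity ha hV hW).intervalIntegrable_of_Icc zero_le_one

lemma drift_add {μ : ℝ} {V W : unitInterval → E3} (hV : ContDiffOn ℝ ∞ (ext V) (Icc 0 1))
    (hW : ContDiffOn ℝ ∞ (ext W) (Icc 0 1)) {t : ℝ} (ht : t ∈ Icc (0 : ℝ) 1) :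
    drift μ (V + W) t = drift μ V t + drift μ W t := by
  have h : vel (ext (V + W)) t = vel (ext V) t + vel (ext W) t :=
    vel_eq_of_hasDerivWithinAt ht ((hasDerivWithinAt_vel hV ht).add (hasDerivWithinAt_vel hW ht))
  rw [drift, drift, drift, h, show ext (V + W) t = ext V t + ext W t from rfl]
  simp only [PiLp.add_apply]
  module

lemma drift_smul {μ : ℝ} {V : unitInterval → E3} (hV : ContDiffOn ℝ ∞ (ext V) (Icc 0 1)) (k : ℝ)
    {t : ℝ} (ht : t ∈ Icc (0 : ℝ) 1) : drift μ (k • V) t = k • drift μ V t := by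
  have h : vel (ext (k • V)) t = k • vel (ext V) t :=
    vel_eq_of_hasDerivWithinAt ht ((hasDerivWithinAt_vel hV ht).const_smul k)
  rw [drift, drift, h, show ext (k • V) t = k • ext V t from rfl]
  simp only [PiLp.smul_apply, smul_eq_mul]
  module

lemma indexForm_symm (a μ : ℝ) (V W : unitInterval → E3) :
    indexForm a μ V W = indexForm a μ W V := by
  have h : indexDensity a μ V W = indexDensity a μ W V := by
    funext t
    rw [indexDensity, indexDensity, real_inner_comm]
  rw [indexForm, indexForm, h]
  ring

lemma indexForm_add {μ : ℝ} (ha : 0 < a) {V V' W : unitInterval → E3}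
    (hV : ContDiffOn ℝ ∞ (ext V) (Icc 0 1)) (hV' : ContDiffOn ℝ ∞ (ext V') (Icc 0 1))
    (hW : ContDiffOn ℝ ∞ (ext W) (Icc 0 1)) :
    indexForm a μ (V + V') W = indexForm a μ V W + indexForm a μ V' W := by
  have h : ∫ t in (0 : ℝ)..1, indexDensity a μ (V + V') W t =
      (∫ t in (0 : ℝ)..1, indexDensity a μ V W t) + ∫ t in (0 : ℝ)..1, indexDensity a μ V' W t := by
    rw [← intervalIntegral.integral_add (intervalIntegrable_indexDensity ha hV hW)
      (intervalIntegrable_indexDensity ha hV' hW)]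
    refine intervalIntegral.integral_congr fun t ht => ?_
    rw [uIcc_of_le zero_le_one] at ht
    simp only [indexDensity, drift_add hV hV' ht, inner_add_left, add_div]
  rw [indexForm, indexForm, indexForm, h]
  simp only [Pi.add_apply, PiLp.add_apply]
  ring

lemma indexForm_smul {μ : ℝ} (k : ℝ) {V W : unitInterval → E3}
    (hV : ContDiffOn ℝ ∞ (ext V) (Icc 0 1)) :
    indexForm a μ (k • V) W = k * indexForm a μ V W := by
  have h : ∫ t in (0 : ℝ)..1, indexDensity a μ (k • V) W t =
      k * ∫ t in (0 : ℝ)..1, indexDensity a μ V W t := by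
    rw [← intervalIntegral.integral_const_mul]
    refine intervalIntegral.integral_congr fun t ht => ?_
    rw [uIcc_of_le zero_le_one] at ht
    simp only [indexDensity, drift_smul hV k ht, real_inner_smul_left, mul_div_assoc]
  rw [indexForm, indexForm, h]
  simp only [Pi.smul_apply, PiLp.smul_apply, smul_eq_mul]
  ring

/-- The index form as a bilinear form on the tangent space of the space of paths. -/
def indexBilin (ha : 0 < a) (μ : ℝ) (T : Set (Mfd Γ)) (l : unitInterval → H3) :
    LinearMap.BilinForm ℝ (pathTangent Γ T l) :=
  LinearMap.mk₂ ℝ (fun V W => indexForm a μ V.1 W.1)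
    (fun V V' W => indexForm_add ha V.2.1 V'.2.1 W.2.1)
    (fun k V W => indexForm_smul k V.2.1)
    (fun V W W' => by
      rw [indexForm_symm, indexForm_symm a μ V.1, indexForm_symm a μ V.1]
      exact indexForm_add ha W.2.1 W'.2.1 V.2.1)
    (fun k V W => by
      rw [indexForm_symm, indexForm_symm a μ V.1]
      exact indexForm_smul k W.2.1)

lemma hasDerivWithinAt_coord {f : ℝ → E3} {f' : E3} {s : Set ℝ} {t : ℝ}
    (h : HasDerivWithinAt f f' s t) (i : Fin 3) : HasDerivWithinAt (fun t => f t i) (f' i) s t :=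
  (EuclideanSpace.proj i : E3 →L[ℝ] ℝ).hasFDerivAt.comp_hasDerivWithinAt t h

/-- Both terms are nonnegative. If they vanish, the drift is zero: the horizontal components are
constant and vanish at `t = 1`, while `V_z' = -μ V_z` with `V_z(0) = 0`. -/
lemma indexForm_pos {μ : ℝ} (ha : 0 < a) (hμ : 0 < μ) {V : unitInterval → E3}
    (hV : ContDiffOn ℝ ∞ (ext V) (Icc 0 1)) (h0 : V 0 2 = 0) (hne : V ≠ 0) :
    0 < indexForm a μ V V := by
  have hdens : ∀ t, indexDensity a μ V V t = ‖drift μ V t‖ ^ 2 / (a * Real.exp (-(μ * t))) ^ 2 :=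
    fun t => by rw [indexDensity, real_inner_self_eq_norm_sq]
  have hnn : ∀ t, 0 ≤ indexDensity a μ V V t := fun t => by rw [hdens]; positivity
  have hint : 0 ≤ ∫ t in (0 : ℝ)..1, indexDensity a μ V V t :=
    intervalIntegral.integral_nonneg zero_le_one fun t _ => hnn t
  have hbd : 0 ≤ 2 * μ * (V 1 0 * V 1 0 + V 1 1 * V 1 1) / (a * Real.exp (-μ)) ^ 2 :=
    div_nonneg (mul_nonneg (by positivity) (add_nonneg (mul_self_nonneg _) (mul_self_nonneg _)))
      (by positivity)
  refine lt_of_le_of_ne (add_nonneg hint hbd) fun hzero => hne ?_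
  rw [indexForm, eq_comm, add_eq_zero_iff_of_nonneg hint hbd] at hzero
  obtain ⟨hi, hb⟩ := hzero
  have hdrift : ∀ t ∈ Icc (0 : ℝ) 1, drift μ V t = 0 := by
    intro t ht
    by_contra hne
    refine absurd hi (intervalIntegral.integral_pos zero_lt_one
      (continuousOn_indexDensity ha hV hV) (fun t _ => hnn t) ⟨t, ht, ?_⟩).ne'
    rw [hdens]
    have := norm_pos_iff.2 hne
    positivity
  have hsum : V 1 0 * V 1 0 + V 1 1 * V 1 1 = 0 := by
    rw [div_eq_zero_iff, mul_eq_zero] at hb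
    rcases hb with (h | h) | h
    · linarith
    · exact h
    · exact absurd h (by positivity)
  have hV10 : V 1 0 = 0 := by nlinarith [mul_self_nonneg (V 1 0), mul_self_nonneg (V 1 1)]
  have hV11 : V 1 1 = 0 := by nlinarith [mul_self_nonneg (V 1 0), mul_self_nonneg (V 1 1)]
  have hvel : ∀ t ∈ Icc (0 : ℝ) 1, vel (ext V) t = -((μ * ext V t 2) • e3) := fun t ht =>
    eq_neg_of_add_eq_zero_left (hdrift t ht)
  have hd := fun t (ht : t ∈ Icc (0 : ℝ) 1) i =>
    hasDerivWithinAt_coord (hasDerivWithinAt_vel hV ht) i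
  have e1 : ext V 1 = V 1 := ext_coe V 1
  have e0 : ext V 0 = V 0 := ext_coe V 0
  have one_mem : (1 : ℝ) ∈ Icc (0 : ℝ) 1 := by simp
  have c0 := eq_of_hasDerivWithinAt_zero (f := fun t => ext V t 0)
    (fun t ht => (hd t ht 0).congr_deriv (by simp [hvel t ht]))
  have c1 := eq_of_hasDerivWithinAt_zero (f := fun t => ext V t 1)
    (fun t ht => (hd t ht 1).congr_deriv (by simp [hvel t ht]))
  have c2 := eq_of_hasDerivWithinAt_zero (f := fun t => ext V t 2 * Real.exp (μ * t))
    (fun t ht => by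
      have he : HasDerivWithinAt (fun t => Real.exp (μ * t)) (Real.exp (μ * t) * (μ * 1))
        (Icc 0 1) t := ((hasDerivWithinAt_id t _).const_mul μ).exp
      refine ((hd t ht 2).mul he).congr_deriv ?_
      simp [hvel t ht]
      ring)
  simp only [e0, h0, zero_mul] at c2
  have c0' := c0 1 one_mem
  have c1' := c1 1 one_mem
  simp only [e1, hV10, hV11] at c0' c1'
  funext t
  rw [← ext_coe V t]
  refine ext_coords ((c0 t t.2).trans c0'.symm) ((c1 t t.2).trans c1'.symm) ?_
  exact (mul_eq_zero.1 (c2 t t.2)).resolve_right (Real.exp_pos _).ne'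

/-! ### Normal form of a lift -/

/-- `l` is the normal form of the lift of a geodesic cord. -/
structure IsVerticalLift (Γ : Subgroup (Equiv.Perm H3)) (a : ℝ) (P : E3) (r μ : ℝ)
    (l : unitInterval → H3) : Prop where
  height_pos : 0 < a
  foot : P 2 = 0
  radius_pos : 0 < r
  speed_pos : 0 < μ
  height : a * Real.exp (-μ) = 2 * r
  eq_vertical : ∀ t ∈ Icc (0 : ℝ) 1, coords l t = P + (a * Real.exp (-(μ * t))) • e3
  sphere_subset : ∀ y ∈ halfSpace, ‖y - P‖ ^ 2 = 2 * r * y 2 → y ∈ preimageSet Γ (horoTorus Γ a)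
  eventually_plane : ∀ᶠ y in 𝓝 (P + a • e3), y ∈ preimageSet Γ (horoTorus Γ a) → y 2 = a
  eventually_sphere : ∀ᶠ y in 𝓝 (P + (2 * r) • e3),
    y ∈ preimageSet Γ (horoTorus Γ a) → ‖y - P‖ ^ 2 = 2 * r * y 2

lemma IsVerticalChord.isVerticalLift (hΓ : IsHyperbolicGroup Γ) (ha : IsHoroTorusLevel Γ a)
    {P : E3} {r μ : ℝ} {c : ℝ → E3 × E3} (h : IsVerticalChord Γ a P r μ c) {l : unitInterval → H3}
    (hl : ∀ t ∈ Icc (0 : ℝ) 1, coords l t = P + (a * Real.exp (-(μ * t))) • e3) :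
    IsVerticalLift Γ a P r μ l :=
  ⟨h.height_pos, h.foot, h.radius_pos, h.speed_pos, h.height, hl, h.sphere_subset, by
    have := ha.eventually_mem_iff_of_eq hΓ (q := P + a • e3) (by simp [h.foot])
    filter_upwards [this] with y hy using hy.1, h.eventually_sphere⟩

namespace IsVerticalLift

variable {P : E3} {r μ : ℝ} {l : unitInterval → H3}

lemma coe_zero (h : IsVerticalLift Γ a P r μ l) : (l 0 : E3) = P + a • e3 := by
  have := h.eq_vertical 0 (by simp)
  rw [show coords l 0 = l 0 from coords_coe l 0] at this
  simpa using this

lemma coe_one (h : IsVerticalLift Γ a P r μ l) : (l 1 : E3) = P + (2 * r) • e3 := by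
  have := h.eq_vertical 1 (by simp)
  rw [show coords l 1 = l 1 from coords_coe l 1] at this
  rw [this, mul_one, h.height]

lemma tangent_zero (h : IsVerticalLift Γ a P r μ l) {v : E3}
    (hv : v ∈ tangentSpaceOf (preimageSet Γ (horoTorus Γ a)) (l 0)) : v 2 = 0 := by
  refine fderiv_eq_zero_of_mem_tangentSpaceOf ((hasFDerivAt_coord 2 (l 0)).sub_const a) ?_ hv
  rw [h.coe_zero]
  filter_upwards [h.eventually_plane] with y hy hyS
  rw [hy hyS, sub_self]

lemma tangent_one (h : IsVerticalLift Γ a P r μ l) {v : E3}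
    (hv : v ∈ tangentSpaceOf (preimageSet Γ (horoTorus Γ a)) (l 1)) : v 2 = 0 := by
  have hs : HasFDerivAt (fun y : E3 => y - P) (ContinuousLinearMap.id ℝ E3) (l 1 : E3) :=
    (hasFDerivAt_id _).sub_const P
  have := fderiv_eq_zero_of_mem_tangentSpaceOf
    (hs.norm_sq.sub ((hasFDerivAt_coord 2 (l 1)).const_mul (2 * r))) (by
      rw [h.coe_one]
      filter_upwards [h.eventually_sphere] with y hy hyS
      exact sub_eq_zero.2 (hy hyS)) hv
  simp [h.coe_one, inner_eq_sum] at this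
  have hr := h.radius_pos
  have : r * v 2 = 0 := by linarith
  exact (mul_eq_zero.1 this).resolve_left hr.ne'

lemma contDiffOn_coords (h : IsVerticalLift Γ a P r μ l) : ContDiffOn ℝ ∞ (coords l) (Icc 0 1) := by
  refine ContDiffOn.congr (ContDiff.contDiffOn ?_) h.eq_vertical
  fun_prop

/-- Every vector field in the tangent space of the space of paths is a variational field. -/
lemma exists_variation (h : IsVerticalLift Γ a P r μ l) {V : unitInterval → E3}
    (hV : V ∈ pathTangent Γ (horoTorus Γ a) l) : ∃ C, IsVariation Γ (horoTorus Γ a) l V C := by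
  have hr := h.radius_pos
  have ha := h.height_pos
  have hμ := h.speed_pos
  obtain ⟨hVs, hV0, hV1⟩ := hV
  have hV02 := h.tangent_zero hV0
  have hV12 := h.tangent_one hV1
  have hV2 : ContinuousOn (fun t => ext V t 2) (Icc 0 1) :=
    (EuclideanSpace.proj 2 : E3 →L[ℝ] ℝ).continuous.comp_continuousOn hVs.continuousOn
  obtain ⟨M, hM⟩ := isCompact_Icc.exists_bound_of_continuousOn hV2
  have hM0 : 0 ≤ M := (norm_nonneg _).trans (hM 0 (by simp))
  set κ := V 1 0 ^ 2 + V 1 1 ^ 2 with hκ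
  have hκ0 : 0 ≤ κ := by positivity
  -- For `|s| < r / N`, the bound `|V_z| ≤ N` keeps the varied path in the half-space, and `κ ≤ N²`
  -- keeps the square root below smooth.
  set N := M + κ + 1 with hN
  have hsN : ∀ s ∈ Ioo (-(r / N)) (r / N), |s| * N < r := fun s hs => by
    rw [← lt_div_iff₀ (by linarith)]; exact abs_lt.2 hs
  have hsκ : ∀ s ∈ Ioo (-(r / N)) (r / N), 0 < r ^ 2 - s ^ 2 * κ := fun s hs => by
    have h1 : (|s| * N) ^ 2 < r ^ 2 := by
      have := hsN s hs
      gcongr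
    rw [mul_pow, sq_abs] at h1
    have h2 : s ^ 2 * κ ≤ s ^ 2 * N ^ 2 := by gcongr; nlinarith
    linarith
  -- The height above the centre of the sphere point lying over the horizontal displacement `s
  -- (V_x(1), V_y(1))`.
  set ρ : ℝ → ℝ := fun s => √(r ^ 2 - s ^ 2 * κ) with hρ
  -- The straight-line variation keeps the upper end on the plane. The extra term is zero there,
  -- puts the lower end on the sphere, and is of second order in `s` since `ρ'(0) = 0`, so the
  -- variational field is still `V`.
  set f : ℝ → ℝ → E3 := fun s t => coords l t + s • ext V t + (t * (ρ s - r)) • e3 with hf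
  have hfpos : ∀ s ∈ Ioo (-(r / N)) (r / N), ∀ t ∈ Icc (0 : ℝ) 1, 0 < f s t 2 := by
    intro s hs t ht
    have h1 : -r < s * ext V t 2 := by
      have h2 : |s * ext V t 2| ≤ |s| * N := by
        rw [abs_mul]
        have := hM t ht
        rw [Real.norm_eq_abs] at this
        gcongr
        linarith
      linarith [neg_abs_le (s * ext V t 2), hsN s hs]
    have h3 : 2 * r ≤ a * Real.exp (-(μ * t)) := by
      rw [← h.height]
      have : μ * t ≤ μ := by nlinarith [ht.2]
      gcongr
    have h4 : -r ≤ t * (ρ s - r) := by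
      have : 0 ≤ ρ s := Real.sqrt_nonneg _
      nlinarith [ht.1, ht.2]
    simp only [hf, h.eq_vertical t ht]
    simp [h.foot]
    linarith
  classical
  set L : ℝ → unitInterval → H3 := fun s t =>
    if hh : 0 < f s t 2 then ⟨f s t, hh⟩ else l t with hL
  have hLf : ∀ s ∈ Ioo (-(r / N)) (r / N), ∀ t : unitInterval, (L s t : E3) = f s t :=
    fun s hs t => by simp only [hL, dif_pos (hfpos s hs t t.2)]
  have h0mem : (0 : ℝ) ∈ Ioo (-(r / N)) (r / N) := by
    have : 0 < r / N := by positivity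
    simp [this]
  have hρ0 : ρ 0 = r := by simp [hρ, Real.sqrt_sq hr.le]
  have hρd : HasDerivAt ρ 0 0 := by
    have h1 : HasDerivAt (fun s : ℝ => r ^ 2 - s ^ 2 * κ) 0 0 := by
      simpa using (((hasDerivAt_id (0 : ℝ)).pow 2).mul_const κ).const_sub (r ^ 2)
    simpa using h1.sqrt (hsκ 0 h0mem).ne'
  refine ⟨fun s t => proj Γ (L s t), r / N, by positivity, L, ?_, ?_, ?_, ?_⟩
  · have hsnd : MapsTo (Prod.snd : ℝ × ℝ → ℝ) (Ioo (-(r / N)) (r / N) ×ˢ Icc 0 1) (Icc 0 1) :=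
      fun x hx => hx.2
    have h1 : ContDiffOn ℝ ∞ (fun x : ℝ × ℝ => ρ x.1) (Ioo (-(r / N)) (r / N) ×ˢ Icc 0 1) :=
      ContDiffOn.sqrt (by fun_prop) fun x hx => (hsκ x.1 hx.1).ne'
    have h2 : ContDiffOn ℝ ∞ (fun x : ℝ × ℝ => f x.1 x.2) (Ioo (-(r / N)) (r / N) ×ˢ Icc 0 1) :=
      ((h.contDiffOn_coords.comp contDiffOn_snd hsnd).add
        (contDiffOn_fst.smul (hVs.comp contDiffOn_snd hsnd))).add
        ((contDiffOn_snd.mul (h1.sub contDiffOn_const)).smul contDiffOn_const)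
    refine h2.congr fun x hx => ?_
    rw [coords, ext_of_mem _ hx.2]
    exact hLf x.1 hx.1 ⟨x.2, hx.2⟩
  · intro s hs
    have i0 : coords l ((0 : unitInterval) : ℝ) = l 0 := coords_coe l 0
    have i1 : coords l ((1 : unitInterval) : ℝ) = l 1 := coords_coe l 1
    have j0 : ext V ((0 : unitInterval) : ℝ) = V 0 := ext_coe V 0
    have j1 : ext V ((1 : unitInterval) : ℝ) = V 1 := ext_coe V 1
    refine ⟨fun t => rfl, ?_, ?_⟩
    · rw [← mem_preimageSet_coe]
      apply plane_subset ha
      rw [hLf s hs]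
      simp only [hf, i0, j0, h.coe_zero]
      simp [h.foot, hV02]
    · rw [← mem_preimageSet_coe]
      apply h.sphere_subset _ (L s 1).2
      rw [hLf s hs]
      simp only [hf, i1, j1, h.coe_one]
      have hsq : ρ s ^ 2 = r ^ 2 - s ^ 2 * κ := Real.sq_sqrt (hsκ s hs).le
      rw [norm_sq_eq_sum]
      simp [h.foot, hV12]
      rw [hκ] at hsq
      linear_combination hsq
  · funext t
    apply Subtype.ext
    rw [hLf 0 h0mem]
    simp [hf, hρ0, coords_coe]
  · intro t
    have h1 : (fun s => (L s t : E3)) =ᶠ[𝓝 0] fun s => f s t := by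
      filter_upwards [Ioo_mem_nhds h0mem.1 h0mem.2] with s hs using hLf s hs t
    rw [h1.deriv_eq]
    have h2 : HasDerivAt (fun s => f s t) (ext V t) 0 := by
      have h3 := (((hasDerivAt_id (0 : ℝ)).smul_const (ext V t)).const_add (coords l t)).add
        (((hρd.sub_const r).const_mul (t : ℝ)).smul_const e3)
      refine HasDerivAt.congr_deriv h3 ?_
      simp
    rw [h2.deriv, ext_coe]

end IsVerticalLift

end HoroTorus

namespace HoroTorus

/-! ### The second variation of the energy -/

variable {Γ : Subgroup (Equiv.Perm H3)} {a : ℝ}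

lemma eventually_deriv_eq_zero {h h' : ℝ → ℝ} {k : ℝ}
    (hd : ∀ᶠ s in 𝓝 0, HasDerivAt h (h' s) s) (hk : ∀ᶠ s in 𝓝 0, h s = k) :
    ∀ᶠ s in 𝓝 0, h' s = 0 := by
  filter_upwards [hd, hk.eventually_nhds] with s h1 h2
  exact h1.unique ((hasDerivAt_const s k).congr_of_eventuallyEq h2)

lemma deriv_eq_zero_of_eventually {h : ℝ → ℝ} {h' : ℝ} (hd : HasDerivAt h h' 0)
    (hk : ∀ᶠ s in 𝓝 0, h s = 0) : h' = 0 :=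
  hd.unique ((hasDerivAt_const 0 0).congr_of_eventuallyEq hk)

/-- The vertical acceleration at the top of a curve on a sphere of radius `r`. -/
lemma accel_sphere {x y z x' y' z' : ℝ → ℝ} {x'' y'' z'' r x₀ y₀ : ℝ}
    (hx : ∀ᶠ s in 𝓝 0, HasDerivAt x (x' s) s) (hx' : HasDerivAt x' x'' 0)
    (hy : ∀ᶠ s in 𝓝 0, HasDerivAt y (y' s) s) (hy' : HasDerivAt y' y'' 0)
    (hz : ∀ᶠ s in 𝓝 0, HasDerivAt z (z' s) s) (hz' : HasDerivAt z' z'' 0)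
    (hs : ∀ᶠ s in 𝓝 0, (x s - x₀) ^ 2 + (y s - y₀) ^ 2 + z s ^ 2 = 2 * r * z s)
    (h0 : x 0 = x₀) (h1 : y 0 = y₀) (h2 : z 0 = 2 * r) (h3 : z' 0 = 0) :
    r * z'' = -(x' 0 ^ 2 + y' 0 ^ 2) := by
  have e1 := eventually_deriv_eq_zero
    (h := fun s => (x s - x₀) ^ 2 + (y s - y₀) ^ 2 + z s ^ 2 - 2 * r * z s)
    (h' := fun s => 2 * (x s - x₀) * x' s + 2 * (y s - y₀) * y' s + 2 * z s * z' s
      - 2 * r * z' s) (k := 0) (by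
        filter_upwards [hx, hy, hz] with s x y z
        refine (((((x.sub_const x₀).pow 2).add ((y.sub_const y₀).pow 2)).add (z.pow 2)).sub
          (z.const_mul (2 * r))).congr_deriv ?_
        simp) (by
        filter_upwards [hs] with s h
        linarith)
  have x0 := hx.self_of_nhds
  have y0 := hy.self_of_nhds
  have z0 := hz.self_of_nhds
  have e2 := deriv_eq_zero_of_eventually (((((((x0.sub_const x₀).const_mul 2).mul hx').add
    (((y0.sub_const y₀).const_mul 2).mul hy')).add ((z0.const_mul 2).mul hz')).sub
    (hz'.const_mul (2 * r)))) e1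
  rw [h0, h1, h2, h3] at e2
  linarith

/-- The energy density of a variation with coordinates `f`. -/
def kineticDensity (ε : ℝ) (f : Fin 3 → ℝ × ℝ → ℝ) (x : ℝ × ℝ) : ℝ :=
  1 / 2 * ((pdt ε (f 0) x ^ 2 + pdt ε (f 1) x ^ 2 + pdt ε (f 2) x ^ 2) / f 2 x ^ 2)

lemma contDiffOn_kineticDensity {ε : ℝ} {f : Fin 3 → ℝ × ℝ → ℝ}
    (hf : ∀ i, ContDiffOn ℝ ∞ (f i) (strip ε)) (hpos : ∀ x, 0 < f 2 x) :
    ContDiffOn ℝ ∞ (kineticDensity ε f) (strip ε) :=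
  contDiffOn_const.mul (((((contDiffOn_pdt (hf 0)).pow 2).add ((contDiffOn_pdt (hf 1)).pow 2)).add
    ((contDiffOn_pdt (hf 2)).pow 2)).div ((hf 2).pow 2) fun x _ => (pow_pos (hpos x) 2).ne')

lemma energyH3_eq_integral {ε : ℝ} {L : ℝ → unitInterval → H3}
    (hL : ContDiffOn ℝ ∞ (fun x : ℝ × ℝ => coords (L x.1) x.2) (strip ε))
    (hf : ∀ i, ContDiffOn ℝ ∞ (fun x : ℝ × ℝ => coords (L x.1) x.2 i) (strip ε)) {s : ℝ}
    (hs : s ∈ Ioo (-ε) ε) : energyH3 (L s) =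
      ∫ t in (0 : ℝ)..1, kineticDensity ε (fun i x => coords (L x.1) x.2 i) (s, t) := by
  rw [energyH3, ← intervalIntegral.integral_const_mul]
  refine intervalIntegral.integral_congr fun t ht => ?_
  rw [uIcc_of_le zero_le_one] at ht
  have hLs : ContDiffOn ℝ ∞ (coords (L s)) (Icc 0 1) :=
    hL.comp (f := fun t : ℝ => (s, t)) (by fun_prop) fun t ht => ⟨hs, ht⟩
  have hv : ∀ i, vel (coords (L s)) t i = pdt ε (fun x => coords (L x.1) x.2 i) (s, t) := fun i =>
    (uniqueDiffOn_Icc zero_lt_one t ht).eq_deriv _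
      (hasDerivWithinAt_coord (hasDerivWithinAt_vel hLs ht) i) (hasDerivWithinAt_pdt (hf i) hs ht)
  simp only [hInner, kineticDensity, inner_eq_sum, hv, pow_two]

/-- At a vertical geodesic the second derivative of the energy density differs from the index
density by a total derivative. -/
lemma integral_second_variation {ε μ : ℝ} (hε : 0 < ε) {f : Fin 3 → ℝ × ℝ → ℝ}
    (hf : ∀ i, ContDiffOn ℝ ∞ (f i) (strip ε)) (hpos : ∀ x, 0 < f 2 x)
    (h0 : ∀ t ∈ Icc (0 : ℝ) 1, pdt ε (f 0) (0, t) = 0)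
    (h1 : ∀ t ∈ Icc (0 : ℝ) 1, pdt ε (f 1) (0, t) = 0)
    (h2 : ∀ t ∈ Icc (0 : ℝ) 1, pdt ε (f 2) (0, t) = -(μ * f 2 (0, t))) {Q : ℝ → ℝ}
    (hQc : ContinuousOn Q (Icc 0 1))
    (hQ : ∀ t ∈ Icc (0 : ℝ) 1, Q t = (pdt ε (pds ε (f 0)) (0, t) ^ 2
      + pdt ε (pds ε (f 1)) (0, t) ^ 2
      + (pdt ε (pds ε (f 2)) (0, t) + μ * pds ε (f 2) (0, t)) ^ 2) / f 2 (0, t) ^ 2)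
    (hb0 : pds ε (f 2) (0, 0) = 0) (hb1 : pds ε (f 2) (0, 1) = 0)
    (hb0' : pds ε (pds ε (f 2)) (0, 0) = 0) :
    ∫ t in (0 : ℝ)..1, pds ε (pds ε (kineticDensity ε f)) (0, t) =
      (∫ t in (0 : ℝ)..1, Q t) - μ * (pds ε (pds ε (f 2)) (0, 1) / f 2 (0, 1)) := by
  have hF := contDiffOn_kineticDensity hf hpos
  have h0mem : (0 : ℝ) ∈ Ioo (-ε) ε := by simp [hε]
  have hnhds := Ioo_mem_nhds h0mem.1 h0mem.2
  -- Because `z' = -μ z`, completing the square in the second derivative of the density leaves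
  -- exactly `G'`. The boundary hypotheses kill every term of `G` at the ends except the vertical
  -- acceleration at `t = 1`.
  set G : ℝ → ℝ := fun t => μ * (pds ε (f 2) (0, t) ^ 2 / f 2 (0, t) ^ 2
    - pds ε (pds ε (f 2)) (0, t) / f 2 (0, t)) with hG
  have hG' : ∀ t ∈ Icc (0 : ℝ) 1, HasDerivWithinAt G
      (pds ε (pds ε (kineticDensity ε f)) (0, t) - Q t) (Icc 0 1) t := by
    intro t ht
    have hz := (hpos (0, t)).ne'
    have d0 := hasDerivWithinAt_pdt (hf 2) h0mem ht
    have d1 := hasDerivWithinAt_pdt (contDiffOn_pds (hf 2)) h0mem ht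
    have d2 := hasDerivWithinAt_pdt (contDiffOn_pds (contDiffOn_pds (hf 2))) h0mem ht
    have hd := (((d1.pow 2).div (d0.pow 2) (pow_ne_zero 2 hz)).sub (d2.div d0 hz)).const_mul μ
    refine hd.congr_deriv ?_
    have hcomm : ∀ i, ∀ s ∈ Ioo (-ε) ε,
        pds ε (pdt ε (f i)) (s, t) = pdt ε (pds ε (f i)) (s, t) :=
      fun i s hs => pds_pdt_comm (hf i) ⟨hs, ht⟩
    have hcomm2 : pds ε (pds ε (pdt ε (f 2))) (0, t) = pdt ε (pds ε (pds ε (f 2))) (0, t) :=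
      (pds_congr (pds_pdt_comm (hf 2)) ⟨h0mem, ht⟩).trans
        (pds_pdt_comm (contDiffOn_pds (hf 2)) ⟨h0mem, ht⟩)
    have key := deriv_deriv_kinetic (μ := μ)
      (A := fun i s => pdt ε (f i) (s, t)) (A' := fun i s => pds ε (pdt ε (f i)) (s, t))
      (A'' := fun i => pds ε (pds ε (pdt ε (f i))) (0, t))
      (Z := fun s => f 2 (s, t)) (Z' := fun s => pds ε (f 2) (s, t))
      (Z'' := pds ε (pds ε (f 2)) (0, t))
      (F := fun s => kineticDensity ε f (s, t)) (F' := fun s => pds ε (kineticDensity ε f) (s, t))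
      (F'' := pds ε (pds ε (kineticDensity ε f)) (0, t))
      (fun i => mem_of_superset hnhds fun s hs => hasDerivAt_pds (contDiffOn_pdt (hf i)) hs ht)
      (fun i => hasDerivAt_pds (contDiffOn_pds (contDiffOn_pdt (hf i))) h0mem ht)
      (mem_of_superset hnhds fun s hs => hasDerivAt_pds (hf 2) hs ht)
      (hasDerivAt_pds (contDiffOn_pds (hf 2)) h0mem ht)
      (Eventually.of_forall fun s => (hpos (s, t)).ne') (Eventually.of_forall fun s => rfl)
      (mem_of_superset hnhds fun s hs => hasDerivAt_pds hF hs ht)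
      (hasDerivAt_pds (contDiffOn_pds hF) h0mem ht) (h0 t ht) (h1 t ht) (h2 t ht)
    rw [key, hQ t ht, hcomm2, hcomm 0 0 h0mem, hcomm 1 0 h0mem, hcomm 2 0 h0mem, h2 t ht]
    simp
    field_simp
    ring
  have hcF := continuousOn_slice (contDiffOn_pds (contDiffOn_pds hF)).continuousOn h0mem
  have hftc := intervalIntegral.integral_eq_sub_of_hasDerivAt_of_le zero_le_one
    (fun t ht => (hG' t ht).continuousWithinAt)
    (fun t ht => (hG' t (Ioo_subset_Icc_self ht)).hasDerivAt (Icc_mem_nhds ht.1 ht.2))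
    ((hcF.sub hQc).intervalIntegrable_of_Icc zero_le_one)
  rw [intervalIntegral.integral_sub (hcF.intervalIntegrable_of_Icc zero_le_one)
    (hQc.intervalIntegrable_of_Icc zero_le_one)] at hftc
  simp only [hG, hb0, hb1, hb0'] at hftc
  rw [sub_eq_iff_eq_add'.1 hftc]
  ring

namespace IsVerticalLift

variable {P : E3} {r μ : ℝ} {l : unitInterval → H3}

/-- Differentiate twice under the integral sign. The upper end stays on a plane, so it has no
vertical acceleration. The lower end moves on the sphere, where `accel_sphere` gives acceleration
`-|V_h(1)|² / r`, with `V_h` the horizontal part of `V`; this does not depend on the variation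
chosen. -/
lemma second_deriv (hΓ : IsHyperbolicGroup Γ) (h : IsVerticalLift Γ a P r μ l)
    {V : unitInterval → E3} (hV : V ∈ pathTangent Γ (horoTorus Γ a) l)
    {C : ℝ → unitInterval → Mfd Γ} (hC : IsVariation Γ (horoTorus Γ a) l V C) :
    (∀ᶠ s in 𝓝 0, DifferentiableAt ℝ (fun s => energy Γ (C s)) s) ∧
      HasDerivAt (deriv fun s => energy Γ (C s)) (indexForm a μ V V) 0 := by
  have hr := h.radius_pos
  have ha := h.height_pos
  obtain ⟨hVs, hV0, hV1⟩ := hV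
  have hV02 := h.tangent_zero hV0
  have hV12 := h.tangent_one hV1
  obtain ⟨ε, hε, L, hL, hCL, hL0, hLV⟩ := hC
  change ContDiffOn ℝ ∞ _ (strip ε) at hL
  set f : Fin 3 → ℝ × ℝ → ℝ := fun i x => coords (L x.1) x.2 i with hf_def
  have hf : ∀ i, ContDiffOn ℝ ∞ (f i) (strip ε) := fun i =>
    (EuclideanSpace.proj i : E3 →L[ℝ] ℝ).contDiff.comp_contDiffOn hL
  have hpos : ∀ x, 0 < f 2 x := fun x => coords_mem _ _
  have h0mem : (0 : ℝ) ∈ Ioo (-ε) ε := by simp [hε]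
  have hnhds := Ioo_mem_nhds h0mem.1 h0mem.2
  have z01 : (0 : ℝ) ∈ Icc (0 : ℝ) 1 := by simp
  have o01 : (1 : ℝ) ∈ Icc (0 : ℝ) 1 := by simp
  have hF := contDiffOn_kineticDensity hf hpos
  have hE : ∀ s ∈ Ioo (-ε) ε,
      energy Γ (C s) = ∫ t in (0 : ℝ)..1, kineticDensity ε f (s, t) := by
    intro s hs
    have hlift : IsLift Γ (C s) (L s) :=
      ⟨hL.comp (f := fun t : ℝ => (s, t)) (by fun_prop) fun t ht => ⟨hs, ht⟩, (hCL s hs).1⟩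
    rw [hlift.energy_eq hΓ, energyH3_eq_integral hL hf hs]
  have hE' : ∀ s ∈ Ioo (-ε) ε, HasDerivAt (fun s => energy Γ (C s))
      (∫ t in (0 : ℝ)..1, pds ε (kineticDensity ε f) (s, t)) s := fun s hs =>
    (hasDerivAt_integral_strip hF hs).congr_of_eventuallyEq
      (mem_of_superset (Ioo_mem_nhds hs.1 hs.2) hE)
  refine ⟨mem_of_superset hnhds fun s hs => (hE' s hs).differentiableAt, ?_⟩
  have hE'' := (hasDerivAt_integral_strip (contDiffOn_pds hF) h0mem).congr_of_eventuallyEq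
    (mem_of_superset hnhds fun s hs => (hE' s hs).deriv :
      (deriv fun s => energy Γ (C s)) =ᶠ[𝓝 0] _)
  refine hE''.congr_deriv ?_
  have hf0 : ∀ i, ∀ t ∈ Icc (0 : ℝ) 1, f i (0, t) = (P + (a * Real.exp (-(μ * t))) • e3) i :=
    fun i t ht => by simp only [hf_def, hL0, h.eq_vertical t ht]
  have hVd : ∀ i, ∀ t ∈ Icc (0 : ℝ) 1, ext V t i = pds ε (f i) (0, t) := by
    intro i t ht
    have hd : DifferentiableAt ℝ (fun s => (L s ⟨t, ht⟩ : E3)) 0 := by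
      have h1 : ContDiffOn ℝ ∞ (fun s => coords (L s) t) (Ioo (-ε) ε) :=
        hL.comp (f := fun s : ℝ => (s, t)) (by fun_prop) fun s hs => ⟨hs, ht⟩
      have h2 : (fun s => coords (L s) t) = fun s => (L s ⟨t, ht⟩ : E3) :=
        funext fun s => coords_coe (L s) ⟨t, ht⟩
      rw [h2] at h1
      exact (h1.contDiffAt hnhds).differentiableAt (by simp)
    have h3 := hd.hasDerivAt
    rw [hLV ⟨t, ht⟩] at h3
    have h4 : HasDerivAt (fun s => (L s ⟨t, ht⟩ : E3) i) (V ⟨t, ht⟩ i) 0 :=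
      (EuclideanSpace.proj i : E3 →L[ℝ] ℝ).hasFDerivAt.comp_hasDerivAt 0 h3
    have h5 : (fun s => f i (s, t)) = fun s => (L s ⟨t, ht⟩ : E3) i := by
      funext s
      simp only [hf_def, show coords (L s) t = L s ⟨t, ht⟩ from coords_coe (L s) ⟨t, ht⟩]
    have h6 := hasDerivAt_pds (hf i) h0mem ht
    rw [h5] at h6
    rw [ext_of_mem V ht]
    exact h4.unique h6
  have hVd' : ∀ i, ∀ t ∈ Icc (0 : ℝ) 1, vel (ext V) t i = pdt ε (pds ε (f i)) (0, t) := by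
    intro i t ht
    have h1 := hasDerivWithinAt_coord (hasDerivWithinAt_vel hVs ht) i
    have h2 := (hasDerivWithinAt_pdt (contDiffOn_pds (hf i)) h0mem ht).congr
      (fun t ht => hVd i t ht) (hVd i t ht)
    exact (uniqueDiffOn_Icc zero_lt_one t ht).eq_deriv _ h1 h2
  have hpt : ∀ i, ∀ t ∈ Icc (0 : ℝ) 1,
      pdt ε (f i) (0, t) = -(μ * (a * Real.exp (-(μ * t)))) * e3 i := by
    intro i t ht
    have h1 : HasDerivWithinAt (fun t => (P + (a * Real.exp (-(μ * t))) • e3) i)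
        (-(μ * (a * Real.exp (-(μ * t)))) * e3 i) (Icc 0 1) t := by
      have he : HasDerivWithinAt (fun t => Real.exp (-(μ * t))) (Real.exp (-(μ * t)) * -(μ * 1))
        (Icc 0 1) t := ((hasDerivWithinAt_id t _).const_mul μ).neg.exp
      refine ((((he.const_mul a).mul_const (e3 i)).const_add (P i))).congr_deriv ?_
      ring
    exact (uniqueDiffOn_Icc zero_lt_one t ht).eq_deriv _
      ((hasDerivWithinAt_pdt (hf i) h0mem ht)) (h1.congr (fun t ht => hf0 i t ht) (hf0 i t ht))
  have hcont : ∀ t ∈ Icc (0 : ℝ) 1, ContinuousAt (fun s => coords (L s) t) 0 := fun t ht =>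
    ((hL.comp (f := fun s : ℝ => (s, t)) (by fun_prop) fun s hs => ⟨hs, ht⟩ :
      ContDiffOn ℝ ∞ (fun s => coords (L s) t) (Ioo (-ε) ε)).contDiffAt hnhds).continuousAt
  have c0 : coords l 0 = P + a • e3 := (coords_coe l 0).trans h.coe_zero
  have c1 : coords l 1 = P + (2 * r) • e3 := (coords_coe l 1).trans h.coe_one
  have hplane : ∀ᶠ s in 𝓝 0, f 2 (s, 0) = a := by
    have h1 := hcont 0 z01
    rw [ContinuousAt, hL0, c0] at h1
    filter_upwards [h1.eventually h.eventually_plane, hnhds] with s h2 hs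
    apply h2
    rw [show coords (L s) 0 = L s 0 from coords_coe (L s) 0, mem_preimageSet_coe,
      (hCL s hs).1 0]
    exact (hCL s hs).2.1
  have hsphere : ∀ᶠ s in 𝓝 0, (f 0 (s, 1) - P 0) ^ 2 + (f 1 (s, 1) - P 1) ^ 2 + f 2 (s, 1) ^ 2
      = 2 * r * f 2 (s, 1) := by
    have h1 := hcont 1 o01
    rw [ContinuousAt, hL0, c1] at h1
    filter_upwards [h1.eventually h.eventually_sphere, hnhds] with s h2 hs
    have h3 : coords (L s) 1 ∈ preimageSet Γ (horoTorus Γ a) := by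
      rw [show coords (L s) 1 = L s 1 from coords_coe (L s) 1, mem_preimageSet_coe,
        (hCL s hs).1 1]
      exact (hCL s hs).2.2
    have h4 := h2 h3
    rw [norm_sq_eq_sum] at h4
    simpa [h.foot] using h4
  have hd1 : ∀ i, ∀ t ∈ Icc (0 : ℝ) 1,
      ∀ᶠ s in 𝓝 0, HasDerivAt (fun s => f i (s, t)) (pds ε (f i) (s, t)) s := fun i t ht =>
    mem_of_superset hnhds fun s hs => hasDerivAt_pds (hf i) hs ht
  have hd2 : ∀ i, ∀ t ∈ Icc (0 : ℝ) 1, HasDerivAt (fun s => pds ε (f i) (s, t))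
      (pds ε (pds ε (f i)) (0, t)) 0 := fun i t ht =>
        hasDerivAt_pds (contDiffOn_pds (hf i)) h0mem ht
  have e0 : ext V 0 = V 0 := ext_coe V 0
  have e1 : ext V 1 = V 1 := ext_coe V 1
  have hb0 : pds ε (f 2) (0, 0) = 0 := by rw [← hVd 2 0 z01, e0, hV02]
  have hb1 : pds ε (f 2) (0, 1) = 0 := by rw [← hVd 2 1 o01, e1, hV12]
  have hb0' : pds ε (pds ε (f 2)) (0, 0) = 0 := deriv_eq_zero_of_eventually (hd2 2 0 z01)
    (eventually_deriv_eq_zero (hd1 2 0 z01) hplane)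
  have hf1 : ∀ i, f i (0, 1) = (P + (2 * r) • e3) i := fun i => by
    simp only [hf_def, hL0, c1]
  have hb1' : r * pds ε (pds ε (f 2)) (0, 1) = -(V 1 0 ^ 2 + V 1 1 ^ 2) := by
    have := accel_sphere (hd1 0 1 o01) (hd2 0 1 o01) (hd1 1 1 o01) (hd2 1 1 o01) (hd1 2 1 o01)
      (hd2 2 1 o01) hsphere (by simp [hf1]) (by simp [hf1]) (by simp [hf1, h.foot]) hb1
    rwa [← hVd 0 1 o01, ← hVd 1 1 o01, e1] at this
  rw [integral_second_variation hε hf hpos (μ := μ) (fun t ht => by simp [hpt 0 t ht])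
    (fun t ht => by simp [hpt 1 t ht]) (fun t ht => by simp [hpt 2 t ht, hf0 2 t ht, h.foot])
    (continuousOn_indexDensity ha hVs hVs) (fun t ht => ?_) hb0 hb1 hb0', indexForm, h.height,
    hf1 2]
  -- At height `2r` the boundary term is `μ |V_h|² / (2r²) = 2 μ |V_h|² / (2r)²`, as in `indexForm`.
  · have hr' := hr.ne'
    have : pds ε (pds ε (f 2)) (0, 1) = -(V 1 0 ^ 2 + V 1 1 ^ 2) / r := by
      rw [eq_div_iff hr', mul_comm, hb1']
    rw [this]
    simp [h.foot]
    field_simp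
    ring
  · rw [indexDensity, inner_eq_sum, hf0 2 t ht]
    simp only [drift, PiLp.add_apply, PiLp.smul_apply, smul_eq_mul, e3_zero, e3_one, e3_two,
      mul_zero, mul_one, add_zero, h.foot, zero_add, hVd' _ t ht, hVd 2 t ht]
    ring

lemma isSecondVariation (hΓ : IsHyperbolicGroup Γ) (h : IsVerticalLift Γ a P r μ l) :
    IsSecondVariation Γ (horoTorus Γ a) l (indexBilin h.height_pos μ (horoTorus Γ a) l) where
  symm V W := indexForm_symm a μ V.1 W.1
  exists_variation V := h.exists_variation V.2
  second_deriv V _ hC := h.second_deriv hΓ V.2 hC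

lemma indexBilin_pos (h : IsVerticalLift Γ a P r μ l)
    {V : pathTangent Γ (horoTorus Γ a) l} (hV : V ≠ 0) :
    0 < indexBilin h.height_pos μ (horoTorus Γ a) l V V :=
  indexForm_pos h.height_pos h.speed_pos V.2.1 (h.tangent_zero V.2.2.1)
    fun h0 => hV (Subtype.ext h0)

end IsVerticalLift

theorem exists_isSecondVariation (hΓ : IsHyperbolicGroup Γ) (ha : IsHoroTorusLevel Γ a)
    {c : unitInterval → Mfd Γ} (hc : IsGeodesicCord Γ (horoTorus Γ a) c)
    (hne : ∃ t, c t ≠ c 0) {l : unitInterval → H3} (hl : IsLift Γ c l) :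
    ∃ B : LinearMap.BilinForm ℝ (pathTangent Γ (horoTorus Γ a) l),
      IsSecondVariation Γ (horoTorus Γ a) l B ∧ ∀ V, V ≠ 0 → 0 < B V V := by
  obtain ⟨g, hg, P, r, μ, c', hv, hlv⟩ := hc.exists_vertical hΓ ha hne hl
  have hvl := hv.isVerticalLift hΓ ha hlv
  refine ⟨_, (hvl.isSecondVariation hΓ).pullback hΓ hg hl.smooth, fun V hV => ?_⟩
  exact hvl.indexBilin_pos fun h0 =>
    hV (pushField_injective hΓ _ hg hl.smooth (h0.trans (map_zero _).symm))

end HoroTorus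

end

theorem theorem1p1 (Γ : Subgroup (Equiv.Perm HoroTorus.H3)) (hΓ : HoroTorus.IsHyperbolicGroup Γ)
    (a : ℝ) (ha : HoroTorus.IsHoroTorusLevel Γ a) :
    (∀ c : unitInterval → HoroTorus.Mfd Γ,
      HoroTorus.IsGeodesicCord Γ (HoroTorus.horoTorus Γ a) c → (∃ t, c t ≠ c 0) →
      ∀ l : unitInterval → HoroTorus.H3, HoroTorus.IsLift Γ c l →
      ∃ B : LinearMap.BilinForm ℝ (HoroTorus.pathTangent Γ (HoroTorus.horoTorus Γ a) l),
        HoroTorus.IsSecondVariation Γ (HoroTorus.horoTorus Γ a) l B ∧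
        HoroTorus.morseIndex B = 0 ∧ HoroTorus.nullity B = 0) ∧
    (∀ γ : unitInterval → HoroTorus.Cotangent Γ,
      HoroTorus.IsHamiltonianChord Γ (HoroTorus.horoTorus Γ a) γ → (∃ t, γ t ≠ γ 0) →
      HoroTorus.ChordRigid Γ (HoroTorus.horoTorus Γ a) γ ∧
      HoroTorus.ChordNondegenerate Γ (HoroTorus.horoTorus Γ a) γ) := by
  refine ⟨fun c hc hne l hl => ?_, fun γ hγ hne =>
    ⟨HoroTorus.chordRigid hΓ ha hγ hne, HoroTorus.chordNondegenerate hΓ ha hγ hne⟩⟩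
  obtain ⟨B, hB, hpos⟩ := HoroTorus.exists_isSecondVariation hΓ ha hc hne hl
  exact ⟨B, hB, HoroTorus.morseIndex_eq_zero hpos, HoroTorus.nullity_eq_zero hpos⟩
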